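/- Let $k\ge 2$ and $p<0$ be integers with $\gcd(|p|,k)=1$, and let $$F(z)=z^{p}e^{Az^k}\,\frac{\prod_{\nu}\left(1+\frac{z^k}{a_\nu}\right)}{\prod_{\mu}\left(1-\frac{z^k}{b_\mu}\right)},\qquad F(z)\not\equiv z^p,$$ where $A\ge 0$, $a_\nu,b_\mu>0$, and each of the products is empty, finite or infinite, with $\sum_\nu 1/a_\nu<\infty$ and $\sum_\mu 1/b_\mu<\infty$. For $s\in\mathbb Z$ put $e_s=\exp(i\pi s/k)$ and $$Q_s=\{z\ne 0: 0<\operatorname{Arg}(ze_{-s})<\tfrac{\pi}{k}\},\qquad \widetilde Q_s=\{z\ne 0: 0\le\operatorname{Arg}(ze_{-s})<\tfrac{\pi}{k}\},$$ where $\operatorname{Arg}\in(-\pi,\pi]$ is the principal argument; "$w>0$" means that $w$ is a positive real number. An $\alpha$-point of $F$ is a solution of $F(z)=\alpha$; its multiplicity is the least $n\ge1$ with $F^{(n)}(z)\ne0$, and it is simple (double) if $n=1$ ($n=2$). Let $\alpha\ne 0$ be a complex number such that $F$ has at least one $\alpha$-point, and let $q\in\{0,\dots,k-1\}$ and $\varkappa\in\{0,1\}$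 be such that $\alpha\in\widetilde Q_{2q-\varkappa}$. (1) If $\alpha\in Q_{2q-\varkappa}$, then there is a unique $\alpha$-point $z_0$ of $F$ closest to the origin; it is simple, all the other $\alpha$-points have strictly greater absolute value, and the argument of $z_0$ differs from that of every succeeding $\alpha$-point (every $\alpha$-point of least absolute value among those different from $z_0$). Moreover $z_0\in Q_{2m-\sigma}$, where $\sigma=\varkappa$ for even $p$, $\sigma=1-\varkappa$ for odd $p$, and $m$ is any integer with $pm\equiv q-(-1)^\sigma\left\lceil\frac p2\right\rceil\pmod k$. (2) If $\alpha e_{-2q+\varkappa}>0$ and $p$, $\varkappa$ have the same parity, then again there is a unique $\alpha$-point $z_0$ closest to the origin; it is simple, all the other $\alpha$-points have strictly greater absolute value, and its argument differs from that of every succeeding $\alpha$-point. Moreover $z_0e_{-2m+1}>0$ for every integer $m$ with $pm\equiv q+\left\lceil\frac{p-1}2\right\rceil\pmod k$. (3) If $\alpha e_{-2q+\varkappa}>0$ and $p$, $\varkappa$ have distinct parity, then the two zeros $z_0,z_1$ of $F(z)-\alpha$ closest to the origin are well defined: they are either two distinct simple zeros or one double zero counted as two, and all the other zeros have absolute value strictly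 greater than both. They are equal in absolute value or in argument. Let $m$ be any integer with $pm\equiv q-\left\lceil\frac{p+1}2\right\rceil\pmod k$. If $z_0$ and $z_1$ are equal in argument (in particular, if they form a double zero), then $p=-1$ and both belong to the ray $\{z: ze_{-2m}>0\}$. If $z_0\ne z_1$ and $|z_0|=|z_1|$, then one of them belongs to $Q_{2m}$ and the other one belongs to $Q_{-2s-2m-1}$, where $s$ is any integer with $\operatorname{Im}(\alpha e_{ps})=0$. -/

import Mathlib

noncomputable section

/-- The function
`F(z) = z^p e^{A z^k} ∏_ν (1 + z^k / a_ν) / ∏_μ (1 - z^k / b_μ)`.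
The products are indexed by arbitrary types, so each may be empty, finite or infinite. At the origin
(for `p < 0`) and at the points `z^k = b_μ`, where `F` has its poles, the Lean value is `0`; as only
`α`-points with `α ≠ 0` are considered, poles are never counted as `α`-points. -/
def merF {ι₁ ι₂ : Type*} (k : ℕ) (p : ℤ) (A : ℝ) (a : ι₁ → ℝ) (b : ι₂ → ℝ) (z : ℂ) : ℂ :=
  z ^ p * Complex.exp ((A : ℂ) * z ^ k) * (∏' ν, (1 + z ^ k / (a ν : ℂ))) /
    (∏' μ, (1 - z ^ k / (b μ : ℂ)))

/-- `e_m = exp(i π m / k)`. -/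
def eRot (k : ℕ) (m : ℤ) : ℂ :=
  Complex.exp (Complex.I * ((m : ℂ) / (k : ℂ)) * (Real.pi : ℂ))

/-- The open sector `Q_s = {z ≠ 0 : 0 < Arg (z e_{-s}) < π/k}`. -/
def sectorQ (k : ℕ) (s : ℤ) : Set ℂ :=
  {z | z ≠ 0 ∧ 0 < Complex.arg (z * eRot k (-s)) ∧ Complex.arg (z * eRot k (-s)) < Real.pi / k}

/-- The half-open sector `{z ≠ 0 : 0 ≤ Arg (z e_{-s}) < π/k}`. -/
def sectorQtilde (k : ℕ) (s : ℤ) : Set ℂ :=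
  {z | z ≠ 0 ∧ 0 ≤ Complex.arg (z * eRot k (-s)) ∧ Complex.arg (z * eRot k (-s)) < Real.pi / k}

/-- `w` is a positive real number. -/
def IsPosReal (w : ℂ) : Prop := 0 < w.re ∧ w.im = 0

/-- `f'(z) = ⋯ = f^{(n-1)}(z) = 0 ≠ f^{(n)}(z)`: the value `f z` is taken at `z` with
multiplicity `n ≥ 1`. -/
def HasMultiplicity (f : ℂ → ℂ) (z : ℂ) (n : ℕ) : Prop :=
  1 ≤ n ∧ (∀ j : ℕ, 1 ≤ j → j < n → iteratedDeriv j f z = 0) ∧ iteratedDeriv n f z ≠ 0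

/-- `z₀` is the `α`-point of `f` closest to the origin, it is simple, all the other `α`-points are
strictly farther from the origin, and every succeeding `α`-point (that is, an `α`-point of least
absolute value among the others) has an argument distinct from that of `z₀`. -/
def IsClosestSimple (f : ℂ → ℂ) (α z₀ : ℂ) : Prop :=
  f z₀ = α ∧ HasMultiplicity f z₀ 1 ∧
  (∀ z : ℂ, f z = α → z ≠ z₀ → ‖z₀‖ < ‖z‖) ∧
  (∀ z₁ : ℂ, f z₁ = α → z₁ ≠ z₀ → (∀ z : ℂ, f z = α → z ≠ z₀ → ‖z₁‖ ≤ ‖z‖) →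
    z₁.arg ≠ z₀.arg)

/-- `z₀, z₁` (in this order) are the two zeros of `f - α` closest to the origin, counted with
multiplicity: either a double zero written twice, or two distinct simple zeros; all the other zeros
are strictly farther from the origin. -/
def IsClosestPair (f : ℂ → ℂ) (α z₀ z₁ : ℂ) : Prop :=
  f z₀ = α ∧ f z₁ = α ∧ ‖z₀‖ ≤ ‖z₁‖ ∧
  ((z₀ = z₁ ∧ HasMultiplicity f z₀ 2) ∨
    (z₀ ≠ z₁ ∧ HasMultiplicity f z₀ 1 ∧ HasMultiplicity f z₁ 1)) ∧
  (∀ z : ℂ, f z = α → z ≠ z₀ → z ≠ z₁ → ‖z₁‖ < ‖z‖)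

end

/-! Put w = z^k and ζ = log w = u + iφ. Conjugation and the rotations by 2π/k reduce everything to
the closed strip 0 ≤ φ ≤ π, where log F becomes `logF`: Λ(ζ) = cζ + A e^ζ + Σ log(1 + s_i e^ζ) - Σ
log(1 - t_j e^ζ), with c = p/k. On the open strip each term other than cζ has a ζ-derivative of
positive imaginary part (the term A e^ζ only if A > 0), while cζ has a real one; F ≢ z^p says that
some such term is present. Integrating along a chord gives `PFData.chord`: Im((Λ(ζ₁) - Λ(ζ₀))
conj(ζ₁ - ζ₀)) > 0.

Three kinds of chord carry the proof. Vertical chords: |F| strictly decreases in φ, so each circle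
has at most one point of the strip with |F| = L = |α| (a level point). Chords between level points:
the phase Im Λ grows with the radius along the level set. Horizontal chords: the phase grows along
rays. As p < 0, |F| is large near 0, so the first level point lies on φ = π and has phase pπ/k
(`exists_start`). From there the phase is nondecreasing and takes all intermediate values at level
points (`exists_first_level`).

Write α = L exp(i(N + x)π/k) with 0 ≤ x < 1. The α-points lie over the level points with ±phase = (M
+ x)π/k and M ≡ N mod 2; since gcd(|p|, k) = 1, each M and each sign determine one rotation
(`exists_rotation`, `rotation_unique`). The closest α-points therefore lie over the first level
point whose phase is the least admissible value ≥ pπ/k. This value is (p + x)π/k or (p + 1 - x)π/k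
when 0 < x < 1, and pπ/k or (p + 1)π/k when x = 0, according to parity. Two α-points on one ray
differ in phase by at least 2π, and an admissible phase 2π/k above the lower one produces an α-point
of intermediate modulus; hence the claim on arguments.

For the phase (p + 1)π/k both signs are admissible, and there are two points of equal modulus unless
the level point lies on φ = 0. The phase there is nonnegative, which forces p = -1. On that ray the
logarithmic derivative of F strictly increases up to the first pole, so the pair is either a double
zero or two successive crossings of the level L on the ray. -/

open Complex Filter Topology

noncomputable section

/-! ### Infinite products of linear factors -/

/-- The product `∏ (1 + c_i w)`. -/
def linProd {ι : Type*} (c : ι → ℝ) (w : ℂ) : ℂ := ∏' i, (1 + w * (c i : ℂ))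

lemma summable_norm_mul_ofReal {ι : Type*} {c : ι → ℝ} (hc : Summable c) (w : ℂ) :
    Summable fun i => ‖w * (c i : ℂ)‖ := by
  simp only [norm_mul, Complex.norm_real]
  exact hc.norm.mul_left _

lemma linProd_multipliableLocallyUniformlyOn {ι : Type*} {c : ι → ℝ} (hc : Summable c) :
    MultipliableLocallyUniformlyOn (fun i w => 1 + w * (c i : ℂ)) (Set.univ : Set ℂ) := by
  refine ⟨linProd c, hasProdLocallyUniformlyOn_of_forall_compact isOpen_univ fun K _ hK => ?_⟩
  obtain ⟨M, hM⟩ := hK.isBounded.exists_norm_le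
  refine Summable.hasProdUniformlyOn_one_add hK (hc.norm.mul_left M) (Eventually.of_forall fun i w hw => ?_)
    (fun i => by fun_prop)
  rw [norm_mul, Complex.norm_real]
  exact mul_le_mul_of_nonneg_right (hM w hw) (norm_nonneg _)

lemma linProd_differentiable {ι : Type*} {c : ι → ℝ} (hc : Summable c) :
    Differentiable ℂ (linProd c) := by
  have h := (linProd_multipliableLocallyUniformlyOn hc).hasProdLocallyUniformlyOn
  have h2 := (hasProdLocallyUniformlyOn_iff_tendstoLocallyUniformlyOn.1 h).differentiableOn
    (Eventually.of_forall fun s => by fun_prop) isOpen_univ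
  exact differentiableOn_univ.1 h2

lemma linProd_continuous {ι : Type*} {c : ι → ℝ} (hc : Summable c) :
    Continuous (linProd c) := (linProd_differentiable hc).continuous

lemma linProd_ne_zero_iff {ι : Type*} {c : ι → ℝ} (hc : Summable c) {w : ℂ} :
    linProd c w ≠ 0 ↔ ∀ i, 1 + w * (c i : ℂ) ≠ 0 := by
  refine ⟨fun h i hi => h (tprod_of_exists_eq_zero ⟨i, hi⟩), fun h => ?_⟩
  exact tprod_one_add_ne_zero_of_summable h (summable_norm_mul_ofReal hc w)

lemma linProd_zero {ι : Type*} (c : ι → ℝ) : linProd c 0 = 1 := by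
  simp [linProd]

lemma linProd_conj {ι : Type*} {c : ι → ℝ} (hc : Summable c) (w : ℂ) :
    linProd c (starRingEnd ℂ w) = starRingEnd ℂ (linProd c w) := by
  have hm : Multipliable fun i => 1 + w * (c i : ℂ) :=
    multipliable_one_add_of_summable (summable_norm_mul_ofReal hc w)
  have := hm.map_tprod (starRingEnd ℂ) Complex.continuous_conj
  unfold linProd
  rw [this]
  simp

lemma summable_log_linProd {ι : Type*} {c : ι → ℝ} (hc : Summable c) (w : ℂ) :
    Summable fun i => log (1 + w * (c i : ℂ)) :=
  Complex.summable_log_one_add_of_summable (summable_norm_mul_ofReal hc w).of_norm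

lemma exp_tsum_log_linProd {ι : Type*} {c : ι → ℝ} (hc : Summable c) {w : ℂ}
    (hw : linProd c w ≠ 0) : exp (∑' i, log (1 + w * (c i : ℂ))) = linProd c w :=
  Complex.cexp_tsum_eq_tprod ((linProd_ne_zero_iff hc).1 hw) (summable_log_linProd hc w)

/-- All but finitely many denominators have modulus at least 1/2. The remaining terms do not affect
summability, so no nonvanishing assumption is needed. -/
lemma summable_div_linProd {ι : Type*} {c : ι → ℝ} (hc : Summable c) {w : ℂ} :
    Summable fun i => (c i : ℂ) / (1 + w * (c i : ℂ)) := by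
  have h0 : Tendsto (fun i => w * (c i : ℂ)) cofinite (𝓝 0) :=
    (summable_norm_mul_ofReal hc w).of_norm.tendsto_cofinite_zero
  have h1 : ∀ᶠ i in cofinite, ‖w * (c i : ℂ)‖ < 1 / 2 := by
    have := h0.norm
    rw [norm_zero] at this
    exact this.eventually_lt_const (by norm_num)
  refine Summable.of_norm_bounded_eventually (hc.norm.mul_left 2) ?_
  filter_upwards [h1] with i hi
  have h2 : 1 / 2 ≤ ‖1 + w * (c i : ℂ)‖ := by
    have := norm_sub_le_norm_add (1 : ℂ) (w * (c i : ℂ))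
    rw [norm_one] at this
    linarith
  rw [norm_div, Complex.norm_real, div_le_iff₀ (by linarith)]
  nlinarith [norm_nonneg (c i)]

lemma hasDerivAt_linProd {ι : Type*} {c : ι → ℝ} (hc : Summable c) {w : ℂ}
    (hw : linProd c w ≠ 0) :
    HasDerivAt (linProd c) (linProd c w * ∑' i, (c i : ℂ) / (1 + w * (c i : ℂ))) w := by
  have hne := (linProd_ne_zero_iff hc).1 hw
  have hl : ∀ i, logDeriv (fun w : ℂ => 1 + w * (c i : ℂ)) w = (c i : ℂ) / (1 + w * (c i : ℂ)) := by
    intro i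
    rw [logDeriv_apply]
    congr 1
    have : HasDerivAt (fun w : ℂ => 1 + w * (c i : ℂ)) (1 * (c i : ℂ)) w :=
      ((hasDerivAt_id w).mul_const _).const_add _
    rw [this.deriv, one_mul]
  have key := logDeriv_tprod_eq_tsum (f := fun i w => 1 + w * (c i : ℂ)) isOpen_univ
    (Set.mem_univ w) hne (fun i => by fun_prop)
    (by simp only [hl]; exact summable_div_linProd hc)
    (linProd_multipliableLocallyUniformlyOn hc) hw
  simp only [hl] at key
  have hd := (linProd_differentiable hc w).hasDerivAt
  have e : linProd c w * logDeriv (linProd c) w = deriv (linProd c) w := by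
    rw [logDeriv_apply, mul_div_cancel₀ _ hw]
  rw [← e] at hd
  rw [← key]
  exact hd


/-! ### Chords of the strip and the chord inequality for a single factor -/

/-- The two endpoints lie in the closed strip `0 ≤ Im ζ ≤ π` and the chord between them is not
contained in the boundary of the strip. -/
structure StripChord (ζ₀ ζ₁ : ℂ) : Prop where
  ne : ζ₀ ≠ ζ₁
  nonneg₀ : 0 ≤ ζ₀.im
  nonneg₁ : 0 ≤ ζ₁.im
  le₀ : ζ₀.im ≤ Real.pi
  le₁ : ζ₁.im ≤ Real.pi
  not_bot : ¬ (ζ₀.im = 0 ∧ ζ₁.im = 0)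
  not_top : ¬ (ζ₀.im = Real.pi ∧ ζ₁.im = Real.pi)

lemma exp_im_nonneg_of_strip {ζ : ℂ} (h0 : 0 ≤ ζ.im) (h1 : ζ.im ≤ Real.pi) : 0 ≤ (exp ζ).im := by
  rw [Complex.exp_im]
  exact mul_nonneg (Real.exp_pos _).le (Real.sin_nonneg_of_nonneg_of_le_pi h0 h1)

lemma exp_im_pos_of_strip {ζ : ℂ} (h0 : 0 < ζ.im) (h1 : ζ.im < Real.pi) : 0 < (exp ζ).im := by
  rw [Complex.exp_im]
  exact mul_pos (Real.exp_pos _) (Real.sin_pos_of_pos_of_lt_pi h0 h1)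

lemma StripChord.im_mem {ζ₀ ζ₁ : ℂ} (h : StripChord ζ₀ ζ₁) {τ : ℝ} (h0 : 0 < τ) (h1 : τ < 1) :
    0 < (ζ₀ + τ * (ζ₁ - ζ₀)).im ∧ (ζ₀ + τ * (ζ₁ - ζ₀)).im < Real.pi := by
  have e : (ζ₀ + τ * (ζ₁ - ζ₀)).im = (1 - τ) * ζ₀.im + τ * ζ₁.im := by
    simp; ring
  rw [e]
  have hnb := h.not_bot
  have hnt := h.not_top
  have a0 := h.nonneg₀
  have a1 := h.nonneg₁
  have b0 := h.le₀
  have b1 := h.le₁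
  constructor
  · rcases a0.eq_or_lt with h2 | h2
    · have : 0 < ζ₁.im := lt_of_le_of_ne a1 fun h3 => hnb ⟨h2.symm, h3.symm⟩
      rw [← h2]; nlinarith
    · have : 0 ≤ τ * ζ₁.im := by positivity
      have : 0 < (1 - τ) * ζ₀.im := mul_pos (by linarith) h2
      linarith
  · rcases b0.eq_or_lt with h2 | h2
    · have h3 : ζ₁.im < Real.pi := lt_of_le_of_ne b1 fun h3 => hnt ⟨h2, h3⟩
      have : τ * ζ₁.im < τ * Real.pi := mul_lt_mul_of_pos_left h3 h0
      rw [h2]; linarith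
    · have : (1 - τ) * ζ₀.im < (1 - τ) * Real.pi := mul_lt_mul_of_pos_left h2 (by linarith)
      have : τ * ζ₁.im ≤ τ * Real.pi := mul_le_mul_of_nonneg_left b1 h0.le
      linarith

/-- With Δ = ζ₁ - ζ₀, the function τ ↦ Im(g(exp(ζ₀ + τΔ)) conj Δ) has derivative |Δ|² Im(w g'(w)) at
w = exp(ζ₀ + τΔ). The interior of the chord lies in the open strip, so w is in the open upper
half-plane there. Only continuity is needed at the endpoints, which may lie on the boundary. -/
lemma chord_im_pos {g : ℂ → ℂ} {S : Set ℂ} {ζ₀ ζ₁ : ℂ} (h : StripChord ζ₀ ζ₁)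
    (hg : ContinuousOn g S) (hS : ∀ w : ℂ, 0 < w.im → w ∈ S)
    (e0 : exp ζ₀ ∈ S) (e1 : exp ζ₁ ∈ S)
    (hd : ∀ w : ℂ, 0 < w.im → ∃ d, HasDerivAt g d w ∧ 0 < (w * d).im) :
    0 < ((g (exp ζ₁) - g (exp ζ₀)) * starRingEnd ℂ (ζ₁ - ζ₀)).im := by
  set Δ := ζ₁ - ζ₀ with hΔ
  let f : ℝ → ℝ := fun τ => (g (exp (ζ₀ + τ * Δ)) * starRingEnd ℂ Δ).im
  have hmem : ∀ τ ∈ Set.Icc (0 : ℝ) 1, exp (ζ₀ + τ * Δ) ∈ S := by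
    rintro τ ⟨h0, h1⟩
    rcases h0.eq_or_lt with rfl | h0
    · simpa using e0
    rcases h1.eq_or_lt with rfl | h1
    · simpa [hΔ] using e1
    have := h.im_mem h0 h1
    exact hS _ (exp_im_pos_of_strip this.1 this.2)
  have hcont : ContinuousOn f (Set.Icc 0 1) := by
    have h1 : ContinuousOn (fun τ : ℝ => g (exp (ζ₀ + τ * Δ))) (Set.Icc 0 1) :=
      hg.comp (by fun_prop) hmem
    exact Complex.continuous_im.comp_continuousOn (h1.mul continuousOn_const)
  have hderiv : ∀ τ ∈ interior (Set.Icc (0 : ℝ) 1), 0 < deriv f τ := by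
    intro τ hτ
    rw [interior_Icc] at hτ
    have him := h.im_mem hτ.1 hτ.2
    obtain ⟨d, hd1, hd2⟩ := hd _ (exp_im_pos_of_strip him.1 him.2)
    have hl : HasDerivAt (fun τ : ℝ => ζ₀ + (τ : ℂ) * Δ) (1 * Δ) τ :=
      ((Complex.ofRealCLM.hasDerivAt (x := τ)).mul_const Δ).const_add ζ₀
    have h3 := hl.cexp
    have h4 := (HasDerivAt.comp τ hd1 h3).mul_const (starRingEnd ℂ Δ)
    have h5 : HasDerivAt f (Complex.imCLM
        (d * (exp (ζ₀ + τ * Δ) * (1 * Δ)) * starRingEnd ℂ Δ)) τ :=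
      Complex.imCLM.hasFDerivAt.comp_hasDerivAt τ h4
    rw [h5.deriv]
    have h6 : d * (exp (ζ₀ + τ * Δ) * (1 * Δ)) * starRingEnd ℂ Δ =
        ((Complex.normSq Δ : ℝ) : ℂ) * (exp (ζ₀ + τ * Δ) * d) := by
      rw [← Complex.mul_conj]; ring
    rw [h6, Complex.imCLM_apply, Complex.im_ofReal_mul]
    exact mul_pos (Complex.normSq_pos.2 (sub_ne_zero.2 h.ne.symm)) hd2
  have hm := strictMonoOn_of_deriv_pos (convex_Icc 0 1) hcont hderiv
  have := hm (Set.left_mem_Icc.2 zero_le_one) (Set.right_mem_Icc.2 zero_le_one) zero_lt_one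
  have e0' : f 0 = (g (exp ζ₀) * starRingEnd ℂ Δ).im := by simp [f]
  have e1' : f 1 = (g (exp ζ₁) * starRingEnd ℂ Δ).im := by simp [f, hΔ]
  rw [e0', e1'] at this
  rw [sub_mul, Complex.sub_im]
  linarith

/-- The principal value arg = π on the negative axis is the limit from above, so the branch cut is
harmless from this side. -/
lemma continuousOn_log_upper : ContinuousOn log {x : ℂ | 0 ≤ x.im ∧ x ≠ 0} := by
  rintro x ⟨hx, hx0⟩
  by_cases hs : x ∈ slitPlane
  · exact (continuousAt_clog hs).continuousWithinAt
  · rw [Complex.mem_slitPlane_iff, not_or, not_lt, not_not] at hs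
    have hre : x.re < 0 := lt_of_le_of_ne hs.1 fun h => hx0 (Complex.ext h hs.2)
    exact (continuousWithinAt_log_of_re_neg_of_im_zero hre hs.2).mono fun y hy => hy.1

lemma im_one_add_mul (w : ℂ) (s : ℝ) : (1 + w * (s : ℂ)).im = w.im * s := by simp

lemma one_add_mul_ne_zero_of_im {w : ℂ} {s : ℝ} (hw : w.im ≠ 0) (hs : s ≠ 0) :
    1 + w * (s : ℂ) ≠ 0 := by
  intro h
  have := im_one_add_mul w s
  rw [h] at this
  simp [hw, hs] at this

lemma im_mul_div_one_add_mul (w : ℂ) (s : ℝ) :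
    (w * ((s : ℂ) / (1 + w * (s : ℂ)))).im = w.im * s / normSq (1 + w * (s : ℂ)) := by
  by_cases h : 1 + w * (s : ℂ) = 0
  · simp [h]
  have h2 : normSq (1 + w * (s : ℂ)) ≠ 0 := by simpa using h
  have e : w * ((s : ℂ) / (1 + w * (s : ℂ))) = 1 - (1 + w * (s : ℂ))⁻¹ := by
    field_simp; ring
  rw [e, Complex.sub_im, Complex.inv_im, im_one_add_mul]
  simp; ring

lemma continuousOn_log_one_add_mul {s : ℝ} (hs : 0 ≤ s) :
    ContinuousOn (fun w : ℂ => log (1 + w * (s : ℂ))) {w | 0 ≤ w.im ∧ 1 + w * (s : ℂ) ≠ 0} := by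
  refine continuousOn_log_upper.comp (by fun_prop) ?_
  rintro w ⟨h1, h2⟩
  refine ⟨?_, h2⟩
  rw [im_one_add_mul]; positivity

lemma conj_one_add_mul (w : ℂ) (s : ℝ) :
    1 + starRingEnd ℂ w * (s : ℂ) = starRingEnd ℂ (1 + w * (s : ℂ)) := by simp

/-- For w in the upper half-plane 1 - tw lies in the lower one, where the principal logarithm jumps
at the negative axis. Conjugating before and after selects arg = -π on the cut, which is the
continuous choice. -/
lemma continuousOn_conj_log_one_sub_mul {t : ℝ} (ht : 0 ≤ t) :
    ContinuousOn (fun w : ℂ => -starRingEnd ℂ (log (1 + starRingEnd ℂ w * ((-t : ℝ) : ℂ))))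
      {w | 0 ≤ w.im ∧ 1 + w * ((-t : ℝ) : ℂ) ≠ 0} := by
  refine (Complex.continuous_conj.comp_continuousOn ?_).neg
  refine continuousOn_log_upper.comp
    (f := fun w : ℂ => 1 + starRingEnd ℂ w * ((-t : ℝ) : ℂ)) ?_ ?_
  · exact (continuous_const.add (Complex.continuous_conj.mul continuous_const)).continuousOn
  rintro w ⟨h1, h2⟩
  refine ⟨?_, ?_⟩
  · rw [im_one_add_mul, Complex.conj_im]; nlinarith
  · change 1 + starRingEnd ℂ w * ((-t : ℝ) : ℂ) ≠ 0
    rw [conj_one_add_mul]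
    exact (map_ne_zero _).2 h2

lemma log_term_chord_pos {ζ₀ ζ₁ : ℂ} (h : StripChord ζ₀ ζ₁) {s : ℝ} (hs : 0 < s)
    (e0 : 1 + exp ζ₀ * (s : ℂ) ≠ 0) (e1 : 1 + exp ζ₁ * (s : ℂ) ≠ 0) :
    0 < ((log (1 + exp ζ₁ * (s : ℂ)) - log (1 + exp ζ₀ * (s : ℂ))) *
      starRingEnd ℂ (ζ₁ - ζ₀)).im := by
  refine chord_im_pos h (continuousOn_log_one_add_mul hs.le)
    (fun w hw => ⟨hw.le, one_add_mul_ne_zero_of_im hw.ne' hs.ne'⟩)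
    ⟨exp_im_nonneg_of_strip h.nonneg₀ h.le₀, e0⟩ ⟨exp_im_nonneg_of_strip h.nonneg₁ h.le₁, e1⟩ ?_
  intro w hw
  have hne := one_add_mul_ne_zero_of_im hw.ne' hs.ne'
  refine ⟨(s : ℂ) / (1 + w * (s : ℂ)), ?_, ?_⟩
  · have h1 : HasDerivAt (fun w : ℂ => 1 + w * (s : ℂ)) (1 * (s : ℂ)) w :=
      ((hasDerivAt_id w).mul_const _).const_add _
    rw [one_mul] at h1
    refine h1.clog ?_
    rw [Complex.mem_slitPlane_iff, im_one_add_mul]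
    exact Or.inr (mul_pos hw hs).ne'
  · rw [im_mul_div_one_add_mul]
    exact div_pos (mul_pos hw hs) (Complex.normSq_pos.2 hne)

lemma conj_log_term_chord_pos {ζ₀ ζ₁ : ℂ} (h : StripChord ζ₀ ζ₁) {t : ℝ} (ht : 0 < t)
    (e0 : 1 + exp ζ₀ * ((-t : ℝ) : ℂ) ≠ 0) (e1 : 1 + exp ζ₁ * ((-t : ℝ) : ℂ) ≠ 0) :
    0 < ((-starRingEnd ℂ (log (1 + starRingEnd ℂ (exp ζ₁) * ((-t : ℝ) : ℂ))) -
      -starRingEnd ℂ (log (1 + starRingEnd ℂ (exp ζ₀) * ((-t : ℝ) : ℂ)))) *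
      starRingEnd ℂ (ζ₁ - ζ₀)).im := by
  have ht' : -t ≠ 0 := (neg_neg_of_pos ht).ne
  refine chord_im_pos h (continuousOn_conj_log_one_sub_mul ht.le)
    (fun w hw => ⟨hw.le, one_add_mul_ne_zero_of_im hw.ne' ht'⟩)
    ⟨exp_im_nonneg_of_strip h.nonneg₀ h.le₀, e0⟩ ⟨exp_im_nonneg_of_strip h.nonneg₁ h.le₁, e1⟩ ?_
  intro w hw
  have hne := one_add_mul_ne_zero_of_im hw.ne' ht'
  refine ⟨-(((-t : ℝ) : ℂ) / (1 + w * ((-t : ℝ) : ℂ))), ?_, ?_⟩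
  · have h1 : HasDerivAt (fun w : ℂ => 1 + w * ((-t : ℝ) : ℂ)) (1 * ((-t : ℝ) : ℂ)) w :=
      ((hasDerivAt_id w).mul_const _).const_add _
    rw [one_mul] at h1
    have h2 : 1 + w * ((-t : ℝ) : ℂ) ∈ slitPlane := by
      rw [Complex.mem_slitPlane_iff, im_one_add_mul]
      exact Or.inr (mul_ne_zero hw.ne' ht')
    refine (h1.clog h2).neg.congr_of_eventuallyEq ?_
    have h3 : ∀ᶠ w' in 𝓝 w, 0 < w'.im :=
      (Complex.continuous_im.tendsto w).eventually_const_lt hw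
    filter_upwards [h3] with w' hw'
    simp only [Pi.neg_apply]
    rw [conj_one_add_mul, Complex.log_conj, Complex.conj_conj]
    intro harg
    have := (Complex.arg_eq_pi_iff.1 harg).2
    rw [im_one_add_mul] at this
    exact mul_ne_zero hw'.ne' ht' this
  · rw [mul_neg, Complex.neg_im, im_mul_div_one_add_mul, ← neg_div]
    exact div_pos (by nlinarith) (Complex.normSq_pos.2 hne)

lemma mul_term_chord_pos {ζ₀ ζ₁ : ℂ} (h : StripChord ζ₀ ζ₁) {A : ℝ} (hA : 0 < A) :
    0 < (((A : ℂ) * exp ζ₁ - A * exp ζ₀) * starRingEnd ℂ (ζ₁ - ζ₀)).im := by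
  refine chord_im_pos (S := Set.univ) (g := fun w => (A : ℂ) * w) h (by fun_prop)
    (fun _ _ => trivial) trivial trivial fun w hw => ⟨(A : ℂ) * 1, ?_, ?_⟩
  · exact (hasDerivAt_id w).const_mul _
  · simpa using mul_pos hw hA

/-! ### The logarithm of the whole product and its chord property -/

/-- The data of the function `w ^ c * exp (A w) * ∏ (1 + s_i w) / ∏ (1 - t_j w)` with `c < 0`. -/
structure PFData (ι₁ ι₂ : Type*) where
  A : ℝ
  c : ℝ
  s : ι₁ → ℝ
  t : ι₂ → ℝ
  A_nonneg : 0 ≤ A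
  c_neg : c < 0
  s_pos : ∀ i, 0 < s i
  t_pos : ∀ i, 0 < t i
  s_sum : Summable s
  t_sum : Summable t
  nontrivial : 0 < A ∨ Nonempty ι₁ ∨ Nonempty ι₂

namespace PFData

variable {ι₁ ι₂ : Type*} (P : PFData ι₁ ι₂)

def num (w : ℂ) : ℂ := exp (P.A * w) * linProd P.s w

def den (w : ℂ) : ℂ := linProd (fun i => -P.t i) w

def sTerm (i : ι₁) (w : ℂ) : ℂ := log (1 + w * (P.s i : ℂ))

/-- This is -log(1 - t w) with the branch continuous up to the boundary of the upper half-plane;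
past the pole w = 1/t on the positive axis its imaginary part is +π. -/
def tTerm (i : ι₂) (w : ℂ) : ℂ :=
  -starRingEnd ℂ (log (1 + starRingEnd ℂ w * ((-P.t i : ℝ) : ℂ)))

/-- A branch of `log (num / den)` on the closed upper half plane. -/
def logG (w : ℂ) : ℂ := P.A * w + ∑' i, P.sTerm i w + ∑' i, P.tTerm i w

/-- A branch of the logarithm of `w ^ c * num w / den w`, as a function of `ζ = log w`. -/
def logF (ζ : ℂ) : ℂ := P.c * ζ + P.logG (exp ζ)

lemma num_ne_zero_iff {w : ℂ} : P.num w ≠ 0 ↔ ∀ i, 1 + w * (P.s i : ℂ) ≠ 0 := by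
  rw [num, mul_ne_zero_iff, linProd_ne_zero_iff P.s_sum]
  exact ⟨fun h => h.2, fun h => ⟨exp_ne_zero _, h⟩⟩

lemma den_ne_zero_iff {w : ℂ} : P.den w ≠ 0 ↔ ∀ i, 1 + w * ((-P.t i : ℝ) : ℂ) ≠ 0 :=
  linProd_ne_zero_iff P.t_sum.neg

lemma num_continuous : Continuous P.num := by
  have := linProd_continuous P.s_sum
  unfold num; fun_prop

lemma den_continuous : Continuous P.den := linProd_continuous P.t_sum.neg

lemma num_conj (w : ℂ) : P.num (starRingEnd ℂ w) = starRingEnd ℂ (P.num w) := by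
  rw [num, num, linProd_conj P.s_sum, map_mul, ← Complex.exp_conj, map_mul, Complex.conj_ofReal]

lemma den_conj (w : ℂ) : P.den (starRingEnd ℂ w) = starRingEnd ℂ (P.den w) :=
  linProd_conj P.t_sum.neg w

lemma summable_sTerm (w : ℂ) : Summable fun i => P.sTerm i w := summable_log_linProd P.s_sum w

lemma summable_tTerm (w : ℂ) : Summable fun i => P.tTerm i w :=
  ((summable_log_linProd P.t_sum.neg (starRingEnd ℂ w)).map (starRingEnd ℂ)
    Complex.continuous_conj).neg

lemma exp_logG {w : ℂ} (hn : P.num w ≠ 0) (hd : P.den w ≠ 0) :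
    exp (P.logG w) = P.num w / P.den w := by
  have hn' : linProd P.s w ≠ 0 := (linProd_ne_zero_iff P.s_sum).2 (P.num_ne_zero_iff.1 hn)
  have hd' : linProd (fun i => -P.t i) (starRingEnd ℂ w) ≠ 0 := by
    have := P.den_conj w
    rw [den] at this
    rw [this]
    simpa using hd
  have h1 := exp_tsum_log_linProd P.s_sum hn'
  have h2 := exp_tsum_log_linProd P.t_sum.neg hd'
  have h3 : ∑' i, P.tTerm i w =
      -starRingEnd ℂ (∑' i, log (1 + starRingEnd ℂ w * ((-P.t i : ℝ) : ℂ))) := by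
    rw [(summable_log_linProd P.t_sum.neg (starRingEnd ℂ w)).map_tsum (starRingEnd ℂ)
      Complex.continuous_conj, ← tsum_neg]
    rfl
  have h4 : starRingEnd ℂ (linProd (fun i => -P.t i) (starRingEnd ℂ w)) = P.den w := by
    rw [linProd_conj P.t_sum.neg, Complex.conj_conj, den]
  rw [logG, exp_add, exp_add, h3, exp_neg, Complex.exp_conj, h2, h4, num]
  simp only [sTerm]
  rw [h1, div_eq_mul_inv]

/-- The chord property of `logF`. -/
lemma chord {ζ₀ ζ₁ : ℂ} (h : StripChord ζ₀ ζ₁)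
    (n0 : P.num (exp ζ₀) ≠ 0) (d0 : P.den (exp ζ₀) ≠ 0)
    (n1 : P.num (exp ζ₁) ≠ 0) (d1 : P.den (exp ζ₁) ≠ 0) :
    0 < ((P.logF ζ₁ - P.logF ζ₀) * starRingEnd ℂ (ζ₁ - ζ₀)).im := by
  -- A continuous real-linear functional commutes with the infinite sums, so the inequality can be
  -- added up factor by factor.
  let Λ : ℂ →L[ℝ] ℝ := Complex.imCLM.comp ((ContinuousLinearMap.mul ℝ ℂ).flip
    (starRingEnd ℂ (ζ₁ - ζ₀)))
  have hΛ : ∀ x : ℂ, Λ x = (x * starRingEnd ℂ (ζ₁ - ζ₀)).im := fun x => rfl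
  have hs : ∀ i, 0 < Λ (P.sTerm i (exp ζ₁) - P.sTerm i (exp ζ₀)) := fun i =>
    log_term_chord_pos h (P.s_pos i) (P.num_ne_zero_iff.1 n0 i) (P.num_ne_zero_iff.1 n1 i)
  have ht : ∀ i, 0 < Λ (P.tTerm i (exp ζ₁) - P.tTerm i (exp ζ₀)) := fun i =>
    conj_log_term_chord_pos h (P.t_pos i) (P.den_ne_zero_iff.1 d0 i) (P.den_ne_zero_iff.1 d1 i)
  have hA : 0 ≤ Λ ((P.A : ℂ) * exp ζ₁ - P.A * exp ζ₀) := by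
    rcases P.A_nonneg.eq_or_lt with h0 | h0
    · rw [← h0]; simp
    · exact (mul_term_chord_pos h h0).le
  have hsS := (P.summable_sTerm (exp ζ₁)).sub (P.summable_sTerm (exp ζ₀))
  have htS := (P.summable_tTerm (exp ζ₁)).sub (P.summable_tTerm (exp ζ₀))
  have e : Λ (P.logF ζ₁ - P.logF ζ₀) = Λ ((P.A : ℂ) * exp ζ₁ - P.A * exp ζ₀) +
      ∑' i, Λ (P.sTerm i (exp ζ₁) - P.sTerm i (exp ζ₀)) +
      ∑' i, Λ (P.tTerm i (exp ζ₁) - P.tTerm i (exp ζ₀)) := by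
    rw [← Λ.map_tsum hsS, ← Λ.map_tsum htS,
      (P.summable_sTerm (exp ζ₁)).tsum_sub (P.summable_sTerm (exp ζ₀)),
      (P.summable_tTerm (exp ζ₁)).tsum_sub (P.summable_tTerm (exp ζ₀)), ← map_add, ← map_add]
    -- The power w^c contributes c|ζ₁ - ζ₀|², which is real; hence the sign of c does not matter
    -- here.
    have h0 : Λ (P.c * (ζ₁ - ζ₀)) = 0 := by
      rw [hΛ, mul_assoc, Complex.mul_conj]
      simp [-ofReal_pow, ← Complex.ofReal_mul]
    rw [← zero_add (Λ (_ + _)), ← h0, ← map_add]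
    congr 1
    simp only [logF, logG]
    ring
  rw [← hΛ, e]
  have hs0 : 0 ≤ ∑' i, Λ (P.sTerm i (exp ζ₁) - P.sTerm i (exp ζ₀)) :=
    tsum_nonneg fun i => (hs i).le
  have ht0 : 0 ≤ ∑' i, Λ (P.tTerm i (exp ζ₁) - P.tTerm i (exp ζ₀)) :=
    tsum_nonneg fun i => (ht i).le
  rcases P.nontrivial with h1 | ⟨⟨i⟩⟩ | ⟨⟨i⟩⟩
  · have : 0 < Λ ((P.A : ℂ) * exp ζ₁ - P.A * exp ζ₀) := mul_term_chord_pos h h1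
    linarith
  · have := (Λ.summable hsS).tsum_pos (fun i => (hs i).le) i (hs i)
    linarith
  · have := (Λ.summable htS).tsum_pos (fun i => (ht i).le) i (ht i)
    linarith

end PFData


/-! ### Modulus, phase and level points in the strip -/

/-- Closed-strip coordinate `u + iφ`. -/
def logPt (u φ : ℝ) : ℂ := u + φ * I

@[simp] lemma logPt_re (u φ : ℝ) : (logPt u φ).re = u := by simp [logPt]
@[simp] lemma logPt_im (u φ : ℝ) : (logPt u φ).im = φ := by simp [logPt]

lemma exp_logPt_zero (u : ℝ) : exp (logPt u 0) = (Real.exp u : ℂ) := by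
  simp [logPt]

lemma exp_logPt_pi (u : ℝ) : exp (logPt u Real.pi) = ((-Real.exp u : ℝ) : ℂ) := by
  simp [logPt, exp_add, exp_pi_mul_I]

lemma norm_exp_logPt (u φ : ℝ) : ‖exp (logPt u φ)‖ = Real.exp u := by
  rw [Complex.norm_exp, logPt_re]

lemma continuous_logPt : Continuous fun x : ℝ × ℝ => logPt x.1 x.2 := by
  unfold logPt; fun_prop

namespace PFData

variable {ι₁ ι₂ : Type*} (P : PFData ι₁ ι₂)

/-- The sign of this function is the sign of `|w ^ c * num w / den w| - L`. -/
def gap (L u φ : ℝ) : ℝ :=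
  Real.exp (P.c * u) * ‖P.num (exp (logPt u φ))‖ - L * ‖P.den (exp (logPt u φ))‖

/-- The continuous argument of `w ^ c * num w / den w`. -/
def phase (u φ : ℝ) : ℝ := (P.logF (logPt u φ)).im

lemma num_ne_zero_of_im {w : ℂ} (hw : w.im ≠ 0) : P.num w ≠ 0 :=
  P.num_ne_zero_iff.2 fun i => one_add_mul_ne_zero_of_im hw (P.s_pos i).ne'

lemma den_ne_zero_of_im {w : ℂ} (hw : w.im ≠ 0) : P.den w ≠ 0 :=
  P.den_ne_zero_iff.2 fun i => one_add_mul_ne_zero_of_im hw (neg_neg_of_pos (P.t_pos i)).ne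

lemma num_ne_zero_of_nonneg {x : ℝ} (hx : 0 ≤ x) : P.num x ≠ 0 :=
  P.num_ne_zero_iff.2 fun i => by
    have := P.s_pos i
    have h : 0 < 1 + x * P.s i := by positivity
    exact_mod_cast h.ne'

lemma den_ne_zero_of_nonpos {x : ℝ} (hx : x ≤ 0) : P.den x ≠ 0 :=
  P.den_ne_zero_iff.2 fun i => by
    have h : 0 < 1 + x * (-P.t i) := by nlinarith [P.t_pos i]
    exact_mod_cast h.ne'

lemma num_ne_zero_of_lt_pi {u φ : ℝ} (h0 : 0 ≤ φ) (h1 : φ < Real.pi) :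
    P.num (exp (logPt u φ)) ≠ 0 := by
  rcases h0.eq_or_lt with rfl | h0
  · rw [exp_logPt_zero]; exact P.num_ne_zero_of_nonneg (Real.exp_pos _).le
  · refine P.num_ne_zero_of_im (exp_im_pos_of_strip ?_ ?_).ne' <;> simpa

lemma den_ne_zero_of_pos {u φ : ℝ} (h0 : 0 < φ) (h1 : φ ≤ Real.pi) :
    P.den (exp (logPt u φ)) ≠ 0 := by
  rcases h1.eq_or_lt with rfl | h1
  · rw [exp_logPt_pi]; exact P.den_ne_zero_of_nonpos (neg_nonpos.2 (Real.exp_pos _).le)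
  · refine P.den_ne_zero_of_im (exp_im_pos_of_strip ?_ ?_).ne' <;> simpa

lemma num_den_not_both_zero {u φ : ℝ} (h0 : 0 ≤ φ) (h1 : φ ≤ Real.pi) :
    P.num (exp (logPt u φ)) ≠ 0 ∨ P.den (exp (logPt u φ)) ≠ 0 := by
  rcases h1.lt_or_eq with h | rfl
  · exact Or.inl (P.num_ne_zero_of_lt_pi h0 h)
  · exact Or.inr (P.den_ne_zero_of_pos Real.pi_pos le_rfl)

variable {L : ℝ}

/-- The gap compares moduli after clearing the denominator, so it is continuous through the poles.
It is positive at poles and negative at zeros of the numerator, because the two never vanish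
together. -/
lemma den_ne_zero_of_gap_nonpos {u φ : ℝ} (h0 : 0 ≤ φ) (h1 : φ ≤ Real.pi)
    (h : P.gap L u φ ≤ 0) : P.den (exp (logPt u φ)) ≠ 0 := by
  intro hd
  rcases P.num_den_not_both_zero (u := u) h0 h1 with hn | hn
  · rw [gap, hd, norm_zero, mul_zero, sub_zero] at h
    exact absurd h (not_le.2 (mul_pos (Real.exp_pos _) (norm_pos_iff.2 hn)))
  · exact hn hd

lemma num_ne_zero_of_gap_nonneg (hL : 0 < L) {u φ : ℝ} (h0 : 0 ≤ φ) (h1 : φ ≤ Real.pi)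
    (h : 0 ≤ P.gap L u φ) : P.num (exp (logPt u φ)) ≠ 0 := by
  intro hd
  rcases P.num_den_not_both_zero (u := u) h0 h1 with hn | hn
  · exact hn hd
  · rw [gap, hd, norm_zero, mul_zero, zero_sub] at h
    have := mul_pos hL (norm_pos_iff.2 hn)
    linarith

lemma continuous_gap (L : ℝ) : Continuous fun x : ℝ × ℝ => P.gap L x.1 x.2 := by
  have h1 := P.num_continuous
  have h2 := P.den_continuous
  have h3 := continuous_logPt
  unfold gap
  fun_prop

lemma continuous_gap_left (L φ : ℝ) : Continuous fun u => P.gap L u φ :=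
  (P.continuous_gap L).comp (by fun_prop : Continuous fun u : ℝ => (u, φ))

lemma continuous_gap_right (L u : ℝ) : Continuous fun φ => P.gap L u φ :=
  (P.continuous_gap L).comp (by fun_prop : Continuous fun φ : ℝ => (u, φ))

lemma exp_logF {ζ : ℂ} (hn : P.num (exp ζ) ≠ 0) (hd : P.den (exp ζ) ≠ 0) :
    exp (P.logF ζ) = exp (P.c * ζ) * (P.num (exp ζ) / P.den (exp ζ)) := by
  rw [logF, exp_add, P.exp_logG hn hd]

lemma exp_re_logF {u φ : ℝ} (hn : P.num (exp (logPt u φ)) ≠ 0)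
    (hd : P.den (exp (logPt u φ)) ≠ 0) :
    Real.exp (P.logF (logPt u φ)).re * ‖P.den (exp (logPt u φ))‖ =
      Real.exp (P.c * u) * ‖P.num (exp (logPt u φ))‖ := by
  rw [← Complex.norm_exp, P.exp_logF hn hd, norm_mul, norm_div, Complex.norm_exp]
  have : ((P.c : ℂ) * logPt u φ).re = P.c * u := by simp
  rw [this]
  have := norm_ne_zero_iff.2 hd
  field_simp

lemma gap_eq {u φ : ℝ} (hn : P.num (exp (logPt u φ)) ≠ 0)
    (hd : P.den (exp (logPt u φ)) ≠ 0) :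
    P.gap L u φ = (Real.exp (P.logF (logPt u φ)).re - L) * ‖P.den (exp (logPt u φ))‖ := by
  rw [sub_mul, P.exp_re_logF hn hd, gap]

/-- On a vertical chord the chord property says that Re `logF`, hence the modulus, strictly
decreases as φ grows. An upper endpoint at a zero of the numerator has no logarithm and is treated
separately. -/
lemma gap_neg_of_gap_nonpos (hL : 0 < L) {u φ φ' : ℝ} (h0 : 0 ≤ φ) (h1 : φ < φ')
    (h2 : φ' ≤ Real.pi) (h : P.gap L u φ ≤ 0) : P.gap L u φ' < 0 := by
  have hd := P.den_ne_zero_of_gap_nonpos h0 (h1.le.trans h2) h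
  have hd' : P.den (exp (logPt u φ')) ≠ 0 := P.den_ne_zero_of_pos (h0.trans_lt h1) h2
  have hn : P.num (exp (logPt u φ)) ≠ 0 := P.num_ne_zero_of_lt_pi h0 (h1.trans_le h2)
  by_cases hn' : P.num (exp (logPt u φ')) = 0
  · rw [gap, hn', norm_zero, mul_zero, zero_sub, neg_lt_zero]
    exact mul_pos hL (norm_pos_iff.2 hd')
  have hc : StripChord (logPt u φ) (logPt u φ') := by
    refine ⟨fun e => ?_, ?_, ?_, ?_, ?_, ?_, ?_⟩
    · have := congrArg Complex.im e
      simp at this; linarith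
    all_goals simp only [logPt_im]
    all_goals first | linarith | (rintro ⟨h3, h4⟩; linarith)
  have key := P.chord hc hn hd hn' hd'
  have e : starRingEnd ℂ (logPt u φ' - logPt u φ) = ((φ' - φ : ℝ) : ℂ) * (-I) := by
    simp [logPt]; ring
  rw [e] at key
  have e2 : ((P.logF (logPt u φ') - P.logF (logPt u φ)) * (((φ' - φ : ℝ) : ℂ) * (-I))).im =
      (φ' - φ) * ((P.logF (logPt u φ)).re - (P.logF (logPt u φ')).re) := by
    simp; ring
  rw [e2] at key
  have h3 : (P.logF (logPt u φ')).re < (P.logF (logPt u φ)).re := by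
    have := pos_of_mul_pos_right key (sub_pos.2 h1).le
    linarith
  rw [P.gap_eq hn hd] at h
  rw [P.gap_eq hn' hd']
  have h4 : Real.exp (P.logF (logPt u φ)).re - L ≤ 0 :=
    nonpos_of_mul_nonpos_left h (norm_pos_iff.2 hd)
  have h5 := Real.exp_lt_exp.2 h3
  exact mul_neg_of_neg_of_pos (by linarith) (norm_pos_iff.2 hd')

/-- A point of the closed strip at which the modulus equals `L`. -/
structure Level (L u φ : ℝ) : Prop where
  nonneg : 0 ≤ φ
  le_pi : φ ≤ Real.pi
  gap_eq_zero : P.gap L u φ = 0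

variable {P}

lemma Level.num_ne_zero {u φ : ℝ} (h : P.Level L u φ) (hL : 0 < L) :
    P.num (exp (logPt u φ)) ≠ 0 :=
  P.num_ne_zero_of_gap_nonneg hL h.nonneg h.le_pi h.gap_eq_zero.ge

lemma Level.den_ne_zero {u φ : ℝ} (h : P.Level L u φ) :
    P.den (exp (logPt u φ)) ≠ 0 :=
  P.den_ne_zero_of_gap_nonpos h.nonneg h.le_pi h.gap_eq_zero.le

lemma Level.eq_of_eq (hL : 0 < L) {u φ φ' : ℝ} (h : P.Level L u φ) (h' : P.Level L u φ') :
    φ = φ' := by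
  rcases lt_trichotomy φ φ' with h1 | h1 | h1
  · have := P.gap_neg_of_gap_nonpos hL h.nonneg h1 h'.le_pi h.gap_eq_zero.le
    exact absurd h'.gap_eq_zero this.ne
  · exact h1
  · have := P.gap_neg_of_gap_nonpos hL h'.nonneg h1 h.le_pi h'.gap_eq_zero.le
    exact absurd h.gap_eq_zero this.ne

lemma Level.exp_re {u φ : ℝ} (h : P.Level L u φ) (hL : 0 < L) :
    Real.exp (P.logF (logPt u φ)).re = L := by
  have h1 := P.gap_eq (L := L) (h.num_ne_zero hL) h.den_ne_zero
  rw [h.gap_eq_zero] at h1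
  have := mul_eq_zero.1 h1.symm
  rcases this with h2 | h2
  · linarith
  · exact absurd h2 (norm_ne_zero_iff.2 h.den_ne_zero)

lemma Level.exp_logF {u φ : ℝ} (h : P.Level L u φ) (hL : 0 < L) :
    exp (P.logF (logPt u φ)) = L * exp (P.phase u φ * I) := by
  conv_lhs => rw [← Complex.re_add_im (P.logF (logPt u φ))]
  rw [exp_add, ← Complex.ofReal_exp, h.exp_re hL, phase]

/-- At equal moduli the difference of `logF` is purely imaginary, so the chord property reduces to
(difference of phases)·(u' - u) > 0. -/
lemma Level.phase_lt (hL : 0 < L) {u φ u' φ' : ℝ} (h : P.Level L u φ) (h' : P.Level L u' φ')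
    (hu : u < u') (hb : ¬ (φ = 0 ∧ φ' = 0)) (ht : ¬ (φ = Real.pi ∧ φ' = Real.pi)) :
    P.phase u φ < P.phase u' φ' := by
  have hc : StripChord (logPt u φ) (logPt u' φ') := by
    refine ⟨fun e => ?_, ?_, ?_, ?_, ?_, ?_, ?_⟩
    · have := congrArg Complex.re e
      simp at this; linarith
    all_goals simp only [logPt_im]
    exacts [h.nonneg, h'.nonneg, h.le_pi, h'.le_pi, hb, ht]
  have key := P.chord hc (h.num_ne_zero hL) h.den_ne_zero (h'.num_ne_zero hL) h'.den_ne_zero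
  have hre : (P.logF (logPt u φ)).re = (P.logF (logPt u' φ')).re :=
    Real.exp_injective ((h.exp_re hL).trans (h'.exp_re hL).symm)
  rw [Complex.mul_im] at key
  simp only [Complex.sub_re, Complex.sub_im, Complex.conj_re, Complex.conj_im, logPt_re, hre,
    sub_self, zero_mul, zero_add] at key
  have := pos_of_mul_pos_left key (sub_pos.2 hu).le
  unfold phase
  linarith

/-- Along a ray inside the sector the phase is strictly increasing. -/
lemma phase_lt_of_ray {u u' φ : ℝ} (hu : u < u') (h0 : 0 < φ) (h1 : φ < Real.pi) :
    P.phase u φ < P.phase u' φ := by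
  have hc : StripChord (logPt u φ) (logPt u' φ) := by
    refine ⟨fun e => ?_, ?_, ?_, ?_, ?_, ?_, ?_⟩
    · have := congrArg Complex.re e
      simp at this; linarith
    all_goals simp only [logPt_im]
    all_goals first | linarith | (rintro ⟨h3, h4⟩; linarith)
  have key := P.chord hc (P.num_ne_zero_of_lt_pi h0.le h1) (P.den_ne_zero_of_pos h0 h1.le)
    (P.num_ne_zero_of_lt_pi h0.le h1) (P.den_ne_zero_of_pos h0 h1.le)
  rw [Complex.mul_im] at key
  simp only [Complex.sub_re, Complex.sub_im, Complex.conj_re, Complex.conj_im, logPt_re, logPt_im,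
    sub_self, neg_zero, mul_zero, zero_add] at key
  have := pos_of_mul_pos_left key (sub_pos.2 hu).le
  unfold phase
  linarith

variable (P)

lemma phase_eq (u φ : ℝ) : P.phase u φ = P.c * φ + P.A * (exp (logPt u φ)).im +
    ∑' i, arg (1 + exp (logPt u φ) * (P.s i : ℂ)) +
    ∑' i, arg (1 + starRingEnd ℂ (exp (logPt u φ)) * ((-P.t i : ℝ) : ℂ)) := by
  rw [phase, logF, logG, Complex.add_im, Complex.add_im, Complex.add_im,
    Complex.im_tsum (P.summable_sTerm _), Complex.im_tsum (P.summable_tTerm _)]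
  simp only [sTerm, tTerm, Complex.neg_im, Complex.conj_im, Complex.log_im, neg_neg,
    Complex.im_ofReal_mul, logPt_im]
  ring

lemma summable_arg_s (w : ℂ) : Summable fun i => arg (1 + w * (P.s i : ℂ)) := by
  refine ((Complex.imCLM).summable (P.summable_sTerm w)).congr fun i => ?_
  simp only [sTerm, Complex.imCLM_apply, Complex.log_im]

lemma summable_arg_t (w : ℂ) :
    Summable fun i => arg (1 + starRingEnd ℂ w * ((-P.t i : ℝ) : ℂ)) := by
  have := (Complex.imCLM).summable (P.summable_tTerm w)
  refine this.congr fun i => ?_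
  simp only [tTerm, Complex.imCLM_apply, Complex.neg_im, Complex.conj_im, neg_neg, Complex.log_im]

lemma arg_ofReal_mono {x y : ℝ} (h : x ≤ y) : arg (y : ℂ) ≤ arg (x : ℂ) := by
  rcases lt_or_ge y 0 with hy | hy
  · rw [Complex.arg_ofReal_of_neg hy, Complex.arg_ofReal_of_neg (h.trans_lt hy)]
  · rw [Complex.arg_ofReal_of_nonneg hy]
    rcases lt_or_ge x 0 with hx | hx
    · rw [Complex.arg_ofReal_of_neg hx]; exact Real.pi_pos.le
    · rw [Complex.arg_ofReal_of_nonneg hx]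

/-- Every factor 1 + s w is positive on this ray. Each term of the sum is π once the corresponding
pole has been passed and 0 before, so the phase is π times the number of poles passed. -/
lemma phase_zero (u : ℝ) : P.phase u 0 = ∑' i, arg ((1 - Real.exp u * P.t i : ℝ) : ℂ) := by
  have h1 : ∀ i, arg (1 + (Real.exp u : ℂ) * (P.s i : ℂ)) = 0 := fun i => by
    have := P.s_pos i
    have h : (0 : ℝ) ≤ 1 + Real.exp u * P.s i := by positivity
    have := Complex.arg_ofReal_of_nonneg h
    push_cast at this ⊢
    exact this
  rw [phase_eq, exp_logPt_zero, Complex.ofReal_im, Complex.conj_ofReal]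
  simp only [h1, tsum_zero, mul_zero, zero_add]
  congr 1; ext i; congr 1; push_cast; ring

lemma phase_pi (u : ℝ) : P.phase u Real.pi = P.c * Real.pi +
    ∑' i, arg ((1 - Real.exp u * P.s i : ℝ) : ℂ) := by
  have h1 : ∀ i, arg (1 + ((-Real.exp u : ℝ) : ℂ) * ((-P.t i : ℝ) : ℂ)) = 0 := fun i => by
    have := P.t_pos i
    have h : (0 : ℝ) ≤ 1 + (-Real.exp u) * (-P.t i) := by
      have := mul_pos (Real.exp_pos u) this
      linarith
    have := Complex.arg_ofReal_of_nonneg h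
    push_cast at this ⊢
    exact this
  rw [phase_eq, exp_logPt_pi, Complex.ofReal_im, Complex.conj_ofReal]
  simp only [h1, tsum_zero, mul_zero, add_zero]
  congr 2; ext i; congr 1; push_cast; ring

lemma summable_arg_zero (u : ℝ) : Summable fun i => arg ((1 - Real.exp u * P.t i : ℝ) : ℂ) := by
  refine (P.summable_arg_t (Real.exp u : ℂ)).congr fun i => ?_
  rw [Complex.conj_ofReal]; congr 1; push_cast; ring

lemma summable_arg_pi (u : ℝ) : Summable fun i => arg ((1 - Real.exp u * P.s i : ℝ) : ℂ) := by
  refine (P.summable_arg_s ((-Real.exp u : ℝ) : ℂ)).congr fun i => ?_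
  congr 1; push_cast; ring

lemma phase_zero_mono {u u' : ℝ} (h : u ≤ u') : P.phase u 0 ≤ P.phase u' 0 := by
  rw [phase_zero, phase_zero]
  refine (P.summable_arg_zero u).tsum_le_tsum (fun i => arg_ofReal_mono ?_) (P.summable_arg_zero u')
  have := Real.exp_le_exp.2 h
  nlinarith [P.t_pos i]

lemma phase_pi_mono {u u' : ℝ} (h : u ≤ u') : P.phase u Real.pi ≤ P.phase u' Real.pi := by
  rw [phase_pi, phase_pi]
  refine add_le_add le_rfl
    ((P.summable_arg_pi u).tsum_le_tsum (fun i => arg_ofReal_mono ?_) (P.summable_arg_pi u'))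
  have := Real.exp_le_exp.2 h
  nlinarith [P.s_pos i]

lemma arg_ofReal_nonneg (x : ℝ) : 0 ≤ arg (x : ℂ) := by
  rw [Complex.arg_nonneg_iff]; simp

lemma phase_zero_nonneg (u : ℝ) : 0 ≤ P.phase u 0 := by
  rw [phase_zero]; exact tsum_nonneg fun i => arg_ofReal_nonneg _

variable {P}

/-- Chords inside a boundary ray, which escape the chord property, are covered by the step functions
`phase_zero` and `phase_pi`; there only weak monotonicity holds. -/
lemma Level.phase_le (hL : 0 < L) {u φ u' φ' : ℝ} (h : P.Level L u φ) (h' : P.Level L u' φ')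
    (hu : u ≤ u') : P.phase u φ ≤ P.phase u' φ' := by
  rcases hu.eq_or_lt with rfl | hu'
  · rw [h.eq_of_eq hL h']
  by_cases hb : φ = 0 ∧ φ' = 0
  · rw [hb.1, hb.2]; exact P.phase_zero_mono hu
  by_cases ht : φ = Real.pi ∧ φ' = Real.pi
  · rw [ht.1, ht.2]; exact P.phase_pi_mono hu
  exact (h.phase_lt hL h' hu' hb ht).le

variable (P)

lemma im_logG_ofReal {x : ℝ} (hn : P.num x ≠ 0) (hd : P.den x ≠ 0) :
    ∃ n : ℤ, (P.logG x).im = n * Real.pi := by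
  have h := P.exp_logG hn hd
  have h1 : starRingEnd ℂ (P.num x / P.den x) = P.num x / P.den x := by
    rw [map_div₀, ← P.num_conj, ← P.den_conj, Complex.conj_ofReal]
  have h2 := (Complex.conj_eq_iff_im.1 h1)
  rw [← h, Complex.exp_im] at h2
  obtain ⟨n, hn⟩ := Real.sin_eq_zero_iff.1 ((mul_eq_zero.1 h2).resolve_left (Real.exp_ne_zero _))
  exact ⟨n, hn.symm⟩

lemma phase_eq_logG (u φ : ℝ) : P.phase u φ = P.c * φ + (P.logG (exp (logPt u φ))).im := by
  simp [phase, logF]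

lemma phase_zero_int {u : ℝ} (hd : P.den (exp (logPt u 0)) ≠ 0) :
    ∃ n : ℤ, P.phase u 0 = n * Real.pi := by
  rw [exp_logPt_zero] at hd
  obtain ⟨n, hn⟩ := P.im_logG_ofReal (P.num_ne_zero_of_nonneg (Real.exp_pos u).le) hd
  refine ⟨n, ?_⟩
  rw [phase_eq_logG, exp_logPt_zero, hn]; ring

lemma phase_pi_int {u : ℝ} (hn : P.num (exp (logPt u Real.pi)) ≠ 0) :
    ∃ n : ℤ, P.phase u Real.pi = P.c * Real.pi + n * Real.pi := by
  rw [exp_logPt_pi] at hn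
  obtain ⟨n, hn⟩ := P.im_logG_ofReal hn
    (P.den_ne_zero_of_nonpos (neg_nonpos.2 (Real.exp_pos u).le))
  refine ⟨n, ?_⟩
  rw [phase_eq_logG, exp_logPt_pi, hn]

end PFData


/-! ### The truncated level curve and the order in which phases are attained -/

/-- For ‖x‖ ≤ 1/2 the logarithm is bounded by a multiple of ‖x‖; for larger x the trivial bound π is
at most 2π‖x‖. This global bound dominates the series of arguments uniformly on bounded sets, even
near the zeros and poles. -/
lemma abs_arg_one_add_le (x : ℂ) : |arg (1 + x)| ≤ 2 * Real.pi * ‖x‖ := by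
  have hpi := Real.pi_gt_three
  have hx := norm_nonneg x
  rcases le_or_gt ‖x‖ (1 / 2) with h | h
  · have h1 := Complex.norm_log_one_add_half_le_self h
    have h2 := Complex.abs_im_le_norm (log (1 + x))
    rw [Complex.log_im] at h2
    nlinarith
  · have := Complex.abs_arg_le_pi (1 + x)
    nlinarith

namespace PFData

variable {ι₁ ι₂ : Type*} (P : PFData ι₁ ι₂) {L : ℝ}

lemma gap_pi_nonpos_of_level {u φ : ℝ} (hL : 0 < L) (h : P.Level L u φ) : P.gap L u Real.pi ≤ 0 := by
  rcases h.le_pi.eq_or_lt with rfl | h1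
  · exact h.gap_eq_zero.le
  · exact (P.gap_neg_of_gap_nonpos hL h.nonneg h1 le_rfl h.gap_eq_zero.le).le

/-- `θ` is the truncation to `[0, π]` of the angle at which the modulus equals `L` on the circle
of radius `exp u`. -/
structure IsClamp (L u θ : ℝ) : Prop where
  nonneg : 0 ≤ θ
  le_pi : θ ≤ Real.pi
  gap_pos : ∀ φ, 0 ≤ φ → φ < θ → 0 < P.gap L u φ
  gap_neg : ∀ φ, θ < φ → φ ≤ Real.pi → P.gap L u φ < 0
  num_ne_zero : P.num (exp (logPt u θ)) ≠ 0
  den_ne_zero : P.den (exp (logPt u θ)) ≠ 0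
  cases : P.gap L u θ = 0 ∨ (θ = 0 ∧ P.gap L u 0 < 0) ∨ (θ = Real.pi ∧ 0 < P.gap L u Real.pi)

lemma Level.isClamp {P : PFData ι₁ ι₂} (hL : 0 < L) {u φ : ℝ} (h : P.Level L u φ) :
    P.IsClamp L u φ where
  nonneg := h.nonneg
  le_pi := h.le_pi
  gap_pos φ' h0 h1 := by
    by_contra h2
    exact (P.gap_neg_of_gap_nonpos hL h0 h1 h.le_pi (not_lt.1 h2)).ne h.gap_eq_zero
  gap_neg φ' h0 h1 := P.gap_neg_of_gap_nonpos hL h.nonneg h0 h1 h.gap_eq_zero.le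
  num_ne_zero := h.num_ne_zero hL
  den_ne_zero := h.den_ne_zero
  cases := Or.inl h.gap_eq_zero

lemma exists_isClamp (hL : 0 < L) (u : ℝ) : ∃ θ, P.IsClamp L u θ := by
  have hpi := Real.pi_pos
  rcases lt_or_ge (P.gap L u 0) 0 with h | h
  · exact ⟨0, le_rfl, hpi.le, fun φ h0 h1 => absurd h0 (not_le.2 h1),
      fun φ h0 h1 => P.gap_neg_of_gap_nonpos hL le_rfl h0 h1 h.le,
      P.num_ne_zero_of_lt_pi le_rfl hpi, P.den_ne_zero_of_gap_nonpos le_rfl hpi.le h.le,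
      Or.inr (Or.inl ⟨rfl, h⟩)⟩
  rcases lt_or_ge 0 (P.gap L u Real.pi) with h' | h'
  · refine ⟨Real.pi, hpi.le, le_rfl, fun φ h0 h1 => ?_, fun φ h0 h1 => absurd h0 (not_lt.2 h1),
      P.num_ne_zero_of_gap_nonneg hL hpi.le le_rfl h'.le, P.den_ne_zero_of_pos hpi le_rfl,
      Or.inr (Or.inr ⟨rfl, h'⟩)⟩
    by_contra h2
    have := P.gap_neg_of_gap_nonpos hL h0 h1 le_rfl (not_lt.1 h2)
    linarith
  · obtain ⟨θ, hθ, h0⟩ := intermediate_value_Icc' hpi.le (P.continuous_gap_right L u).continuousOn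
      (Set.mem_Icc.2 ⟨h', h⟩)
    exact ⟨θ, Level.isClamp hL ⟨hθ.1, hθ.2, h0⟩⟩

variable {P} in
lemma IsClamp.unique {u θ θ' : ℝ} (h : P.IsClamp L u θ) (h' : P.IsClamp L u θ') : θ = θ' := by
  by_contra hne
  wlog hlt : θ < θ' generalizing θ θ'
  · exact this h' h (Ne.symm hne) (lt_of_le_of_ne (not_lt.1 hlt) (Ne.symm hne))
  have h1 := h.gap_neg ((θ + θ') / 2) (by linarith) (by linarith [h'.le_pi])
  have h2 := h'.gap_pos ((θ + θ') / 2) (by linarith [h.nonneg]) (by linarith)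
  linarith

/-- The sign of the gap just below and just above θ(u₀) persists for nearby u and traps θ(u). -/
lemma continuous_of_isClamp {θ : ℝ → ℝ} (hθ : ∀ u, P.IsClamp L u (θ u)) : Continuous θ := by
  rw [continuous_iff_continuousAt]
  intro u₀
  refine tendsto_order.2 ⟨fun x hx => ?_, fun x hx => ?_⟩
  · rcases lt_or_ge x 0 with h0 | h0
    · exact Eventually.of_forall fun u => h0.trans_le (hθ u).nonneg
    have h1 := (hθ u₀).gap_pos ((x + θ u₀) / 2) (by linarith) (by linarith)
    filter_upwards [((P.continuous_gap_left L _).tendsto u₀).eventually_const_lt h1] with u hu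
    by_contra h2
    have := (hθ u).gap_neg ((x + θ u₀) / 2) (by linarith) (by linarith [(hθ u₀).le_pi])
    linarith
  · rcases lt_or_ge Real.pi x with h0 | h0
    · exact Eventually.of_forall fun u => (hθ u).le_pi.trans_lt h0
    have h1 := (hθ u₀).gap_neg ((x + θ u₀) / 2) (by linarith) (by linarith)
    filter_upwards [((P.continuous_gap_left L _).tendsto u₀).eventually_lt_const h1] with u hu
    by_contra h2
    have := (hθ u).gap_pos ((x + θ u₀) / 2) (by linarith [(hθ u₀).nonneg]) (by linarith)
    linarith

lemma phase_eq_im (u φ : ℝ) : P.phase u φ = P.c * φ + P.A * (exp (logPt u φ)).im +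
    ∑' i, (P.sTerm i (exp (logPt u φ))).im + ∑' i, (P.tTerm i (exp (logPt u φ))).im := by
  rw [phase, logF, logG, Complex.add_im, Complex.add_im, Complex.add_im,
    Complex.im_tsum (P.summable_sTerm _), Complex.im_tsum (P.summable_tTerm _)]
  simp only [Complex.im_ofReal_mul, logPt_im]
  ring

lemma abs_im_sTerm_le (i : ι₁) (w : ℂ) : |(P.sTerm i w).im| ≤ 2 * Real.pi * ‖w‖ * P.s i := by
  have := abs_arg_one_add_le (w * (P.s i : ℂ))
  rw [norm_mul, Complex.norm_real, Real.norm_of_nonneg (P.s_pos i).le] at this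
  rw [sTerm, Complex.log_im]
  linarith

lemma abs_im_tTerm_le (i : ι₂) (w : ℂ) : |(P.tTerm i w).im| ≤ 2 * Real.pi * ‖w‖ * P.t i := by
  have := abs_arg_one_add_le (starRingEnd ℂ w * ((-P.t i : ℝ) : ℂ))
  rw [norm_mul, Complex.norm_real, norm_neg, Real.norm_of_nonneg (P.t_pos i).le,
    Complex.norm_conj] at this
  rw [tTerm, Complex.neg_im, Complex.conj_im, neg_neg, Complex.log_im]
  linarith

/-- The truncated curve avoids zeros and poles, so each logarithm is continuous along it. The bounds
linear in ‖w‖ permit termwise passage to the limit. -/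
lemma continuous_phase_of_isClamp {θ : ℝ → ℝ} (hθ : ∀ u, P.IsClamp L u (θ u)) :
    Continuous fun u => P.phase u (θ u) := by
  have hc := P.continuous_of_isClamp hθ
  have hw : Continuous fun u => exp (logPt u (θ u)) :=
    Complex.continuous_exp.comp (continuous_logPt.comp (continuous_id.prodMk hc))
  have him : ∀ u, 0 ≤ (exp (logPt u (θ u))).im := fun u =>
    exp_im_nonneg_of_strip (by simpa using (hθ u).nonneg) (by simpa using (hθ u).le_pi)
  rw [continuous_iff_continuousAt]
  intro u₀
  have hs : ContinuousOn (fun u => ∑' i, (P.sTerm i (exp (logPt u (θ u)))).im)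
      (Set.Iio (u₀ + 1)) := by
    refine continuousOn_tsum (u := fun i => 2 * Real.pi * Real.exp (u₀ + 1) * P.s i)
      (fun i => ?_) (P.s_sum.mul_left _) fun i u hu => ?_
    · refine (Complex.continuous_im.comp_continuousOn
        ((continuousOn_log_one_add_mul (P.s_pos i).le).comp hw.continuousOn fun u _ => ⟨him u, ?_⟩))
      exact P.num_ne_zero_iff.1 (hθ u).num_ne_zero i
    · refine (P.abs_im_sTerm_le i _).trans ?_
      rw [norm_exp_logPt]
      have := (Real.exp_lt_exp.2 hu).le
      have := (P.s_pos i).le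
      gcongr
  have ht : ContinuousOn (fun u => ∑' i, (P.tTerm i (exp (logPt u (θ u)))).im)
      (Set.Iio (u₀ + 1)) := by
    refine continuousOn_tsum (u := fun i => 2 * Real.pi * Real.exp (u₀ + 1) * P.t i)
      (fun i => ?_) (P.t_sum.mul_left _) fun i u hu => ?_
    · refine (Complex.continuous_im.comp_continuousOn
        ((continuousOn_conj_log_one_sub_mul (P.t_pos i).le).comp hw.continuousOn
          fun u _ => ⟨him u, ?_⟩))
      exact P.den_ne_zero_iff.1 (hθ u).den_ne_zero i
    · refine (P.abs_im_tTerm_le i _).trans ?_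
      rw [norm_exp_logPt]
      have := (Real.exp_lt_exp.2 hu).le
      have := (P.t_pos i).le
      gcongr
  have hmem : Set.Iio (u₀ + 1) ∈ 𝓝 u₀ := Iio_mem_nhds (by linarith)
  have hs' := hs.continuousAt hmem
  have ht' := ht.continuousAt hmem
  simp only [phase_eq_im]
  refine ((ContinuousAt.add ?_ ?_).add hs').add ht'
  · exact (continuous_const.mul hc).continuousAt
  · exact (continuous_const.mul (Complex.continuous_im.comp hw)).continuousAt

/-- Between two level points every intermediate phase is attained at a level point; the first such
point is returned. -/
lemma exists_first_level (hL : 0 < L) {u₁ φ₁ u₂ φ₂ T : ℝ} (h₁ : P.Level L u₁ φ₁)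
    (h₂ : P.Level L u₂ φ₂) (hu : u₁ ≤ u₂) (hT₁ : P.phase u₁ φ₁ ≤ T) (hT₂ : T ≤ P.phase u₂ φ₂) :
    ∃ u φ, u₁ ≤ u ∧ u ≤ u₂ ∧ P.Level L u φ ∧ P.phase u φ = T ∧
      ∀ u' φ', u₁ ≤ u' → u' < u → P.Level L u' φ' → P.phase u' φ' ≠ T := by
  choose θ hθ using P.exists_isClamp (L := L) hL
  have hc := P.continuous_of_isClamp hθ
  have hp := P.continuous_phase_of_isClamp hθ
  have e : ∀ {u φ : ℝ}, P.Level L u φ → θ u = φ := fun h => (hθ _).unique (h.isClamp hL)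
  let K : Set ℝ := Set.Icc u₁ u₂ ∩ {u | P.phase u (θ u) = T}
  have hK : IsCompact K := isCompact_Icc.inter_right (isClosed_eq hp continuous_const)
  have hne : K.Nonempty := by
    obtain ⟨u, hu, h⟩ := intermediate_value_Icc hu hp.continuousOn
      (show T ∈ Set.Icc (P.phase u₁ (θ u₁)) (P.phase u₂ (θ u₂)) by
        rw [e h₁, e h₂]; exact ⟨hT₁, hT₂⟩)
    exact ⟨u, hu, h⟩
  obtain ⟨u, ⟨hu1, hu2⟩, hmin⟩ := hK.exists_isLeast hne
  have hmin' : ∀ u', u₁ ≤ u' → u' < u → P.phase u' (θ u') ≠ T := fun u' h1 h2 h3 =>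
    absurd (hmin ⟨⟨h1, h2.le.trans hu1.2⟩, h3⟩) (not_le.2 h2)
  -- If the phase near u stays in a translate of πℤ, continuity makes it constant there. The value T
  -- would then be attained before u, against minimality.
  have hfalse : ∀ (hgt : u₁ < u) (d : ℝ), (∀ᶠ u' in 𝓝 u, ∃ n : ℤ,
      P.phase u' (θ u') = d + n * Real.pi) → False := by
    intro hgt d h
    obtain ⟨n₀, hn₀⟩ := h.self_of_nhds
    have h1 : ∀ᶠ u' in 𝓝 u, |P.phase u' (θ u') - P.phase u (θ u)| < Real.pi := by
      have := Metric.tendsto_nhds.1 (hp.tendsto u) Real.pi Real.pi_pos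
      simpa [Real.dist_eq] using this
    have h2 : ∀ᶠ u' in 𝓝[<] u, u' ∈ Set.Ioo u₁ u := Ioo_mem_nhdsLT hgt
    obtain ⟨u', ⟨⟨n, hn⟩, h3⟩, h4⟩ :=
      (((h.and h1).filter_mono (nhdsWithin_le_nhds (s := Set.Iio u))).and h2).exists
    refine hmin' u' h4.1.le h4.2 ?_
    rw [hn, hn₀] at h3
    have h5 : d + n * Real.pi - (d + n₀ * Real.pi) = ((n - n₀ : ℤ) : ℝ) * Real.pi := by
      push_cast; ring
    rw [h5, abs_mul, abs_of_pos Real.pi_pos] at h3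
    have h6 : |((n - n₀ : ℤ) : ℝ)| < 1 := by
      by_contra h7
      nlinarith [Real.pi_pos, not_lt.1 h7]
    have h7 : n - n₀ = 0 := by
      rw [← Int.abs_lt_one_iff]; exact_mod_cast h6
    have h8 : n = n₀ := by omega
    rw [hn, h8, ← hn₀]
    exact hu2
  refine ⟨u, θ u, hu1.1, hu1.2, ⟨(hθ u).nonneg, (hθ u).le_pi, ?_⟩, hu2,
    fun u' φ' h1 h2 h3 h4 => hmin' u' h1 h2 (by rw [e h3]; exact h4)⟩
  have hgt : P.gap L u (θ u) ≠ 0 → u₁ < u := by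
    intro h
    refine lt_of_le_of_ne hu1.1 ?_
    rintro rfl
    rw [e h₁] at h
    exact h h₁.gap_eq_zero
  -- Where the truncation is active, the curve runs locally along a boundary ray and its phase lies
  -- in such a translate; hence the first time is a genuine level point.
  rcases (hθ u).cases with h | ⟨h0, h⟩ | ⟨h0, h⟩
  · exact h
  · exfalso
    refine hfalse (hgt (by rw [h0]; exact h.ne)) 0 ?_
    filter_upwards [((P.continuous_gap_left L 0).tendsto u).eventually_lt_const h] with u' hu'
    have h3 : θ u' = 0 := by
      by_contra h4
      exact absurd ((hθ u').gap_pos 0 le_rfl (lt_of_le_of_ne (hθ u').nonneg (Ne.symm h4)))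
        (not_lt.2 hu'.le)
    have h4 := (hθ u').den_ne_zero
    rw [h3] at h4 ⊢
    simpa using P.phase_zero_int h4
  · exfalso
    refine hfalse (hgt (by rw [h0]; exact h.ne')) (P.c * Real.pi) ?_
    filter_upwards [((P.continuous_gap_left L Real.pi).tendsto u).eventually_const_lt h] with u' hu'
    have h3 : θ u' = Real.pi := by
      by_contra h4
      exact absurd ((hθ u').gap_neg Real.pi (lt_of_le_of_ne (hθ u').le_pi h4) le_rfl)
        (not_lt.2 hu'.le)
    have h4 := (hθ u').num_ne_zero
    rw [h3] at h4 ⊢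
    exact P.phase_pi_int h4

lemma tendsto_gap_pi_atBot (L : ℝ) : Tendsto (fun u => P.gap L u Real.pi) atBot atTop := by
  have h0 : Tendsto (fun u : ℝ => exp (logPt u Real.pi)) atBot (𝓝 0) := by
    simp only [exp_logPt_pi]
    have : Tendsto (fun u : ℝ => -Real.exp u) atBot (𝓝 (-0)) := Real.tendsto_exp_atBot.neg
    rw [neg_zero] at this
    exact (Complex.continuous_ofReal.tendsto 0).comp this
  have hn : Tendsto (fun u : ℝ => ‖P.num (exp (logPt u Real.pi))‖) atBot (𝓝 1) := by
    have := ((P.num_continuous.tendsto 0).comp h0).norm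
    simpa [num, linProd_zero] using this
  have hd : Tendsto (fun u : ℝ => -(L * ‖P.den (exp (logPt u Real.pi))‖)) atBot (𝓝 (-(L * 1))) := by
    have := (((P.den_continuous.tendsto 0).comp h0).norm.const_mul L).neg
    simpa [den, linProd_zero] using this
  have he : Tendsto (fun u : ℝ => Real.exp (P.c * u)) atBot atTop :=
    Real.tendsto_exp_atTop.comp (tendsto_id.const_mul_atBot_of_neg P.c_neg)
  exact (he.atTop_mul_pos one_pos hn).atTop_add hd

/-- The first level point lies on the ray `φ = π`. -/
lemma exists_start (hL : 0 < L) {u φ : ℝ} (h : P.Level L u φ) :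
    ∃ u₁, P.Level L u₁ Real.pi ∧ (∀ u' φ', P.Level L u' φ' → u₁ ≤ u') ∧
      (∀ i, Real.exp u₁ * P.s i < 1) := by
  obtain ⟨u₀, hu₀⟩ := (eventually_atBot.1
    ((P.tendsto_gap_pi_atBot L).eventually_gt_atTop 0))
  have hcont := P.continuous_gap_left L Real.pi
  let K : Set ℝ := Set.Icc u₀ u ∩ {u | P.gap L u Real.pi ≤ 0}
  have hK : IsCompact K := isCompact_Icc.inter_right (isClosed_le hcont continuous_const)
  have hlow : ∀ u', P.gap L u' Real.pi ≤ 0 → u₀ ≤ u' := fun u' h' => by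
    by_contra h2
    exact absurd (hu₀ u' (not_le.1 h2).le) (not_lt.2 h')
  have hu : P.gap L u Real.pi ≤ 0 := P.gap_pi_nonpos_of_level hL h
  obtain ⟨u₁, ⟨h1, h2⟩, hmin⟩ := hK.exists_isLeast ⟨u, ⟨hlow u hu, le_rfl⟩, hu⟩
  have hpos : ∀ u' < u₁, 0 < P.gap L u' Real.pi := by
    intro u' hu'
    by_contra h3
    exact absurd (hmin ⟨⟨hlow _ (not_lt.1 h3), hu'.le.trans h1.2⟩, not_lt.1 h3⟩) (not_le.2 hu')
  have hge : 0 ≤ P.gap L u₁ Real.pi := by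
    refine ge_of_tendsto (hcont.tendsto u₁ |>.mono_left (nhdsWithin_le_nhds (s := Set.Iio u₁))) ?_
    filter_upwards [self_mem_nhdsWithin] with u' hu' using (hpos u' hu').le
  refine ⟨u₁, ⟨Real.pi_pos.le, le_rfl, le_antisymm h2 hge⟩, fun u' φ' h' => ?_, fun i => ?_⟩
  · by_contra h3
    exact absurd (hpos u' (not_le.1 h3)) (not_lt.2 (P.gap_pi_nonpos_of_level hL h'))
  -- Otherwise the zero w = -1/s_i lies at radius at most exp u₁ on the negative ray, where the gap
  -- is still nonnegative, whereas it is negative at a zero.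
  · by_contra h3
    have hs := P.s_pos i
    have h4 : -Real.log (P.s i) ≤ u₁ := by
      have := Real.log_nonneg (not_lt.1 h3)
      rw [Real.log_mul (Real.exp_ne_zero _) hs.ne', Real.log_exp] at this
      linarith
    have h5 : 0 ≤ P.gap L (-Real.log (P.s i)) Real.pi := by
      rcases h4.eq_or_lt with h4 | h4
      · rw [h4]; exact hge
      · exact (hpos _ h4).le
    have h6 := P.num_ne_zero_iff.1 (P.num_ne_zero_of_gap_nonneg hL Real.pi_pos.le le_rfl h5) i
    rw [exp_logPt_pi, Real.exp_neg, Real.exp_log hs] at h6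
    apply h6
    have : (P.s i : ℂ) ≠ 0 := by exact_mod_cast hs.ne'
    push_cast
    field_simp
    ring

lemma phase_pi_eq {u : ℝ} (h : ∀ i, Real.exp u * P.s i < 1) :
    P.phase u Real.pi = P.c * Real.pi := by
  rw [phase_pi]
  have : ∀ i, arg ((1 - Real.exp u * P.s i : ℝ) : ℂ) = 0 := fun i =>
    Complex.arg_ofReal_of_nonneg (by linarith [h i])
  simp only [this, tsum_zero, add_zero]

end PFData


/-! ### The logarithmic derivative and its growth on the positive axis -/

namespace PFData

variable {ι₁ ι₂ : Type*} (P : PFData ι₁ ι₂) {L : ℝ}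

/-- The logarithmic derivative of `num / den`. -/
def dlogG (w : ℂ) : ℂ := P.A + ∑' i, (P.s i : ℂ) / (1 + w * (P.s i : ℂ)) -
  ∑' i, ((-P.t i : ℝ) : ℂ) / (1 + w * ((-P.t i : ℝ) : ℂ))

/-- The logarithmic derivative of `w ^ c * num w / den w` with respect to `log w`. -/
def dlogF (w : ℂ) : ℂ := P.c + w * P.dlogG w

/-- The restriction of `dlogF` to the real axis. -/
def dlogR (x : ℝ) : ℝ := P.c + (P.A * x + ∑' i, x * (P.s i / (1 + x * P.s i)) +
  ∑' i, x * (P.t i / (1 - x * P.t i)))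

lemma hasDerivAt_num {w : ℂ} (hn : P.num w ≠ 0) :
    HasDerivAt P.num (P.num w * (P.A + ∑' i, (P.s i : ℂ) / (1 + w * (P.s i : ℂ)))) w := by
  have hn' : linProd P.s w ≠ 0 := (linProd_ne_zero_iff P.s_sum).2 (P.num_ne_zero_iff.1 hn)
  have h1 : HasDerivAt (fun w : ℂ => exp (P.A * w)) (exp (P.A * w) * (P.A * 1)) w :=
    ((hasDerivAt_id w).const_mul (P.A : ℂ)).cexp
  have h2 := h1.mul (hasDerivAt_linProd P.s_sum hn')
  refine h2.congr_deriv ?_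
  simp only [num]
  ring

lemma hasDerivAt_den {w : ℂ} (hd : P.den w ≠ 0) :
    HasDerivAt P.den
      (P.den w * ∑' i, ((-P.t i : ℝ) : ℂ) / (1 + w * ((-P.t i : ℝ) : ℂ))) w :=
  hasDerivAt_linProd P.t_sum.neg hd

lemma hasDerivAt_num_div_den {w : ℂ} (hn : P.num w ≠ 0) (hd : P.den w ≠ 0) :
    HasDerivAt (fun w => P.num w / P.den w) (P.num w / P.den w * P.dlogG w) w := by
  refine ((P.hasDerivAt_num hn).div (P.hasDerivAt_den hd) hd).congr_deriv ?_
  rw [dlogG]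
  generalize ∑' i, (P.s i : ℂ) / (1 + w * (P.s i : ℂ)) = S
  generalize ∑' i, ((-P.t i : ℝ) : ℂ) / (1 + w * ((-P.t i : ℝ) : ℂ)) = T
  field_simp

lemma dlogG_summable_s (w : ℂ) :
    Summable fun i => w * ((P.s i : ℂ) / (1 + w * (P.s i : ℂ))) :=
  (summable_div_linProd P.s_sum).mul_left w

lemma dlogG_summable_t (w : ℂ) :
    Summable fun i => w * (((-P.t i : ℝ) : ℂ) / (1 + w * ((-P.t i : ℝ) : ℂ))) :=
  (summable_div_linProd P.t_sum.neg).mul_left w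

lemma dlogF_eq (w : ℂ) : P.dlogF w = P.c + (P.A * w +
    ∑' i, w * ((P.s i : ℂ) / (1 + w * (P.s i : ℂ))) -
    ∑' i, w * (((-P.t i : ℝ) : ℂ) / (1 + w * ((-P.t i : ℝ) : ℂ)))) := by
  rw [tsum_mul_left, tsum_mul_left, dlogF, dlogG]
  ring

/-- The imaginary part is Im w times a sum of nonnegative terms, at least one of them positive.
Therefore every α-point with non-real z^k is simple. -/
lemma dlogF_im_ne_zero {w : ℂ} (hw : w.im ≠ 0) : (P.dlogF w).im ≠ 0 := by
  let f : ι₁ → ℝ := fun i => P.s i / normSq (1 + w * (P.s i : ℂ))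
  let g : ι₂ → ℝ := fun i => P.t i / normSq (1 + w * ((-P.t i : ℝ) : ℂ))
  have hf : ∀ i, (w * ((P.s i : ℂ) / (1 + w * (P.s i : ℂ)))).im = w.im * f i := fun i => by
    rw [im_mul_div_one_add_mul, mul_div_assoc]
  have hg : ∀ i, (w * (((-P.t i : ℝ) : ℂ) / (1 + w * ((-P.t i : ℝ) : ℂ)))).im = -(w.im * g i) :=
    fun i => by
      rw [im_mul_div_one_add_mul]; simp only [g]; ring
  have hfs : Summable f := by
    have := Complex.imCLM.summable (P.dlogG_summable_s w)
    simp only [Complex.imCLM_apply, hf] at this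
    exact (summable_mul_left_iff hw).1 this
  have hgs : Summable g := by
    have := (Complex.imCLM.summable (P.dlogG_summable_t w)).neg
    simp only [Complex.imCLM_apply, hg, neg_neg] at this
    exact (summable_mul_left_iff hw).1 this
  have hfp : ∀ i, 0 < f i := fun i => div_pos (P.s_pos i)
    (Complex.normSq_pos.2 (one_add_mul_ne_zero_of_im hw (P.s_pos i).ne'))
  have hgp : ∀ i, 0 < g i := fun i => div_pos (P.t_pos i)
    (Complex.normSq_pos.2 (one_add_mul_ne_zero_of_im hw (neg_neg_of_pos (P.t_pos i)).ne))
  have e : (P.dlogF w).im = w.im * (P.A + ∑' i, f i + ∑' i, g i) := by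
    rw [dlogF_eq, Complex.add_im, Complex.sub_im, Complex.add_im,
      Complex.im_tsum (P.dlogG_summable_s w), Complex.im_tsum (P.dlogG_summable_t w)]
    simp only [hf, hg, Complex.ofReal_im, Complex.im_ofReal_mul]
    rw [tsum_neg, tsum_mul_left, tsum_mul_left]
    ring
  rw [e]
  refine mul_ne_zero hw (ne_of_gt ?_)
  have h1 : 0 ≤ ∑' i, f i := tsum_nonneg fun i => (hfp i).le
  have h2 : 0 ≤ ∑' i, g i := tsum_nonneg fun i => (hgp i).le
  rcases P.nontrivial with h | ⟨⟨i⟩⟩ | ⟨⟨i⟩⟩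
  · linarith
  · linarith [hfs.tsum_pos (fun i => (hfp i).le) i (hfp i), P.A_nonneg]
  · linarith [hgs.tsum_pos (fun i => (hgp i).le) i (hgp i), P.A_nonneg]

lemma dlogF_ofReal (x : ℝ) : P.dlogF x = (P.dlogR x : ℂ) := by
  rw [dlogF_eq, dlogR]
  push_cast
  rw [sub_eq_add_neg, ← tsum_neg]
  congr 3
  ext i
  rw [mul_neg, ← sub_eq_add_neg, neg_div, mul_neg, neg_neg]

lemma summable_dlogR_s (x : ℝ) : Summable fun i => x * (P.s i / (1 + x * P.s i)) := by
  have := P.dlogG_summable_s x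
  rw [← Complex.summable_ofReal]
  refine this.congr fun i => ?_
  push_cast; ring

lemma summable_dlogR_t (x : ℝ) : Summable fun i => x * (P.t i / (1 - x * P.t i)) := by
  have := (P.dlogG_summable_t x).neg
  rw [← Complex.summable_ofReal]
  refine this.congr fun i => ?_
  push_cast
  rw [mul_neg, ← sub_eq_add_neg, neg_div, mul_neg, neg_neg]

lemma dlogR_neg {x : ℝ} (hx : 0 < x) (hs : ∀ i, x * P.s i < 1) : P.dlogR (-x) < 0 := by
  have h1 : ∑' i, (-x) * (P.s i / (1 + (-x) * P.s i)) ≤ 0 := tsum_nonpos fun i => by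
    have h2 : 0 < 1 + (-x) * P.s i := by linarith [hs i]
    have := div_pos (P.s_pos i) h2
    nlinarith
  have h2 : ∑' i, (-x) * (P.t i / (1 - (-x) * P.t i)) ≤ 0 := tsum_nonpos fun i => by
    have h2 : 0 < 1 - (-x) * P.t i := by nlinarith [P.t_pos i]
    have := div_pos (P.t_pos i) h2
    nlinarith
  have h3 := mul_nonneg P.A_nonneg hx.le
  rw [dlogR]
  linarith [P.c_neg]

/-- A lower bound for the growth of `dlogR` on the right of `x`, before the first pole. -/
lemma exists_dlogR_growth {x : ℝ} (hx : 0 < x) : ∃ δ : ℝ, 0 < δ ∧ ∀ y, x < y → y ≤ x + 1 →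
    (∀ i, y * P.t i < 1) → δ * (y - x) ≤ P.dlogR y - P.dlogR x := by
  have hs : ∀ i y, x < y → x * (P.s i / (1 + x * P.s i)) ≤ y * (P.s i / (1 + y * P.s i)) := by
    intro i y hy
    have h := P.s_pos i
    have h1 : 0 < 1 + x * P.s i := by positivity
    have h2 : 0 < 1 + y * P.s i := by nlinarith
    rw [← mul_div_assoc, ← mul_div_assoc, div_le_div_iff₀ h1 h2]
    nlinarith
  have ht : ∀ i y, x < y → y * P.t i < 1 →
      x * (P.t i / (1 - x * P.t i)) + P.t i * (y - x) ≤ y * (P.t i / (1 - y * P.t i)) := by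
    intro i y hy hy1
    have h := P.t_pos i
    have h1 : 0 < 1 - x * P.t i := by nlinarith
    have h2 : 0 < 1 - y * P.t i := by linarith
    have e : y * (P.t i / (1 - y * P.t i)) - x * (P.t i / (1 - x * P.t i)) =
        P.t i * (y - x) / ((1 - y * P.t i) * (1 - x * P.t i)) := by
      rw [← mul_div_assoc, ← mul_div_assoc, div_sub_div _ _ h2.ne' h1.ne']
      congr 1; ring
    -- Both factors of the denominator lie in (0, 1] before the first pole, so dropping them
    -- decreases the quotient.
    have h3 : P.t i * (y - x) ≤ P.t i * (y - x) / ((1 - y * P.t i) * (1 - x * P.t i)) := by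
      rw [le_div_iff₀ (mul_pos h2 h1)]
      have h4 : (1 - y * P.t i) * (1 - x * P.t i) ≤ 1 := by
        have : 0 ≤ x * P.t i := by positivity
        have : 0 ≤ y * P.t i := by nlinarith
        nlinarith
      have h5 : 0 ≤ P.t i * (y - x) := mul_nonneg h.le (by linarith)
      nlinarith
    linarith
  have hS : ∀ y, x < y →
      ∑' i, x * (P.s i / (1 + x * P.s i)) ≤ ∑' i, y * (P.s i / (1 + y * P.s i)) := fun y hy =>
    (P.summable_dlogR_s x).tsum_le_tsum (fun i => hs i y hy) (P.summable_dlogR_s y)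
  have hT' : ∀ y i, x < y → (∀ i, y * P.t i < 1) →
      x * (P.t i / (1 - x * P.t i)) ≤ y * (P.t i / (1 - y * P.t i)) := fun y i hy hy1 => by
    have := mul_nonneg (P.t_pos i).le (sub_pos.2 hy).le
    linarith [ht i y hy (hy1 i)]
  have hT : ∀ y, x < y → (∀ i, y * P.t i < 1) →
      ∑' i, x * (P.t i / (1 - x * P.t i)) ≤ ∑' i, y * (P.t i / (1 - y * P.t i)) :=
    fun y hy hy1 => (P.summable_dlogR_t x).tsum_le_tsum (fun i => hT' y i hy hy1)
      (P.summable_dlogR_t y)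
  have hA : ∀ y, x < y → P.A * x ≤ P.A * y := fun y hy =>
    mul_le_mul_of_nonneg_left hy.le P.A_nonneg
  rcases P.nontrivial with h | ⟨⟨i⟩⟩ | ⟨⟨i⟩⟩
  · refine ⟨P.A, h, fun y hy _ hy1 => ?_⟩
    have h1 := hS y hy
    have h2 := hT y hy hy1
    simp only [dlogR]
    linarith
  · have h := P.s_pos i
    have hpos : 0 < (1 + (x + 1) * P.s i) * (1 + x * P.s i) := by positivity
    -- The difference quotient of x ↦ x s/(1 + x s) is s/((1 + y s)(1 + x s)); the bound y ≤ x + 1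
    -- provides a constant independent of y.
    refine ⟨P.s i / ((1 + (x + 1) * P.s i) * (1 + x * P.s i)), div_pos h hpos,
      fun y hy hy2 hy1 => ?_⟩
    have h2 := hT y hy hy1
    have h3 := hA y hy
    have h4 := ((P.summable_dlogR_s y).sub (P.summable_dlogR_s x)).le_tsum i
      fun j _ => sub_nonneg.2 (hs j y hy)
    rw [(P.summable_dlogR_s y).tsum_sub (P.summable_dlogR_s x)] at h4
    have h1 : 0 < 1 + x * P.s i := by positivity
    have h5 : 0 < 1 + y * P.s i := by nlinarith
    have e : y * (P.s i / (1 + y * P.s i)) - x * (P.s i / (1 + x * P.s i)) =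
        P.s i / ((1 + y * P.s i) * (1 + x * P.s i)) * (y - x) := by
      field_simp; ring
    have h6 : P.s i / ((1 + (x + 1) * P.s i) * (1 + x * P.s i)) ≤
        P.s i / ((1 + y * P.s i) * (1 + x * P.s i)) := by
      gcongr
    have h7 := mul_le_mul_of_nonneg_right h6 (sub_pos.2 hy).le
    simp only [dlogR]
    linarith
  · refine ⟨P.t i, P.t_pos i, fun y hy _ hy1 => ?_⟩
    have h2 := hS y hy
    have h3 := hA y hy
    have h4 := ((P.summable_dlogR_t y).sub (P.summable_dlogR_t x)).le_tsum i
      fun j _ => sub_nonneg.2 (hT' y j hy hy1)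
    rw [(P.summable_dlogR_t y).tsum_sub (P.summable_dlogR_t x)] at h4
    have h5 := ht i y hy (hy1 i)
    simp only [dlogR]
    linarith

lemma dlogR_lt_of_le_add_one {x y : ℝ} (hx : 0 < x) (hxy : x < y) (hy1 : y ≤ x + 1)
    (hy : ∀ i, y * P.t i < 1) : P.dlogR x < P.dlogR y := by
  obtain ⟨δ, hδ, h⟩ := P.exists_dlogR_growth hx
  have := h y hxy hy1 hy
  nlinarith [mul_pos hδ (sub_pos.2 hxy)]

lemma dlogR_strictMonoOn {y₀ : ℝ} (hy : ∀ i, y₀ * P.t i < 1) {x y : ℝ} (hx : 0 < x) (hxy : x < y)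
    (hyy : y ≤ y₀) : P.dlogR x < P.dlogR y := by
  have hlt : ∀ z, z ≤ y₀ → ∀ i, z * P.t i < 1 := fun z hz i =>
    lt_of_le_of_lt (mul_le_mul_of_nonneg_right hz (P.t_pos i).le) (hy i)
  have key : ∀ n : ℕ, ∀ y, x < y → y ≤ y₀ → y ≤ x + n → P.dlogR x < P.dlogR y := by
    intro n
    induction n with
    | zero => intro y h1 _ h2; simp at h2; linarith
    | succ n ih =>
      intro y h1 h2 h3
      push_cast at h3
      rcases le_or_gt y (x + 1) with h4 | h4
      · exact P.dlogR_lt_of_le_add_one hx h1 h4 (hlt y h2)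
      · have h5 := ih (y - 1) (by linarith) (by linarith) (by linarith)
        exact h5.trans (P.dlogR_lt_of_le_add_one (by linarith) (by linarith) (by linarith)
          (hlt y h2))
  obtain ⟨n, hn⟩ := exists_nat_ge (y - x)
  exact key n y hxy hyy (by linarith)

lemma differentiableAt_dlogF {w : ℂ} (hn : P.num w ≠ 0) (hd : P.den w ≠ 0) :
    DifferentiableAt ℂ P.dlogF w := by
  have hnum : Differentiable ℂ P.num := by
    have := linProd_differentiable P.s_sum
    unfold num; fun_prop
  have hden : Differentiable ℂ P.den := linProd_differentiable P.t_sum.neg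
  have h1 : ∀ᶠ z in 𝓝 w, P.num z ≠ 0 := P.num_continuous.continuousAt.eventually_ne hn
  have h2 : ∀ᶠ z in 𝓝 w, P.den z ≠ 0 := P.den_continuous.continuousAt.eventually_ne hd
  have h3 : P.dlogF =ᶠ[𝓝 w] fun z =>
      P.c + z * (deriv P.num z / P.num z - deriv P.den z / P.den z) := by
    filter_upwards [h1, h2] with z hz1 hz2
    rw [(P.hasDerivAt_num hz1).deriv, (P.hasDerivAt_den hz2).deriv,
      mul_div_cancel_left₀ _ hz1, mul_div_cancel_left₀ _ hz2, dlogF, dlogG]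
  refine DifferentiableAt.congr_of_eventuallyEq ?_ h3
  have h4 : DifferentiableAt ℂ (deriv P.num) w := (hnum.analyticAt w).deriv.differentiableAt
  have h5 : DifferentiableAt ℂ (deriv P.den) w := (hden.analyticAt w).deriv.differentiableAt
  have h6 := hnum w
  have h7 := hden w
  exact (differentiableAt_id.mul ((h4.div h6 hn).sub (h5.div h7 hd))).const_add (P.c : ℂ)

/-- The linear growth bound keeps the right difference quotients of `dlogR` above some δ > 0. This
makes the second derivative of F nonzero at a critical α-point. -/
lemma deriv_dlogF_ofReal_ne_zero {x : ℝ} (hx : 0 < x) (ht : ∀ i, x * P.t i < 1) :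
    deriv P.dlogF x ≠ 0 := by
  have hn : P.num x ≠ 0 := P.num_ne_zero_of_nonneg hx.le
  have hd : P.den x ≠ 0 := P.den_ne_zero_iff.2 fun i => by
    have h : 0 < 1 + x * (-P.t i) := by linarith [ht i]
    exact_mod_cast h.ne'
  have h1 := (P.differentiableAt_dlogF hn hd).hasDerivAt.comp_ofReal
  have h2 : HasDerivAt P.dlogR (deriv P.dlogF x).re x := by
    have := Complex.reCLM.hasFDerivAt.comp_hasDerivAt x h1
    simp only [dlogF_ofReal] at this
    exact this
  obtain ⟨δ, hδ, hgr⟩ := P.exists_dlogR_growth hx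
  -- There may be infinitely many poles; nonvanishing of the denominator near x excludes all of them
  -- from a common interval.
  have hnear : ∀ᶠ y in 𝓝[>] x, ∀ i, y * P.t i < 1 := by
    have h3 : ∀ᶠ z : ℝ in 𝓝 x, P.den z ≠ 0 :=
      (P.den_continuous.comp Complex.continuous_ofReal).continuousAt.eventually_ne hd
    obtain ⟨ε, hε, h4⟩ := Metric.eventually_nhds_iff.1 h3
    filter_upwards [Ioo_mem_nhdsGT (show x < x + ε by linarith)] with y hy i
    by_contra h5
    have hti := P.t_pos i
    have h6 : x < 1 / P.t i := by rw [lt_div_iff₀ hti]; exact ht i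
    have h7 : 1 / P.t i ≤ y := by rw [div_le_iff₀ hti]; exact not_lt.1 h5
    have h8 := P.den_ne_zero_iff.1 (@h4 (1 / P.t i) (by
      rw [Real.dist_eq, abs_lt]; constructor <;> linarith [hy.2])) i
    apply h8
    have : (P.t i : ℂ) ≠ 0 := by exact_mod_cast hti.ne'
    push_cast
    field_simp
    ring
  have hslope : Tendsto (slope P.dlogR x) (𝓝[>] x) (𝓝 (deriv P.dlogF x).re) :=
    (hasDerivAt_iff_tendsto_slope.1 h2).mono_left
      (nhdsWithin_mono _ fun y hy => ne_of_gt hy)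
  have h9 : δ ≤ (deriv P.dlogF x).re := by
    refine ge_of_tendsto hslope ?_
    filter_upwards [hnear, Ioo_mem_nhdsGT (show x < x + 1 by linarith)] with y hy hy2
    rw [slope_def_field, le_div_iff₀ (by linarith [hy2.1])]
    exact hgr y hy2.1 hy2.2.le hy
  intro h0
  rw [h0] at h9
  simp at h9
  linarith

end PFData


/-! ### Behaviour on the positive and the negative ray -/

namespace PFData

variable {ι₁ ι₂ : Type*} (P : PFData ι₁ ι₂) {L : ℝ}

/-- The function `w ^ c * num w / den w` in the coordinate `ζ = log w`. -/
def stripF (ζ : ℂ) : ℂ := exp (P.c * ζ) * (P.num (exp ζ) / P.den (exp ζ))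

/-- The restriction of `stripF` to the real axis. -/
def rayF (u : ℝ) : ℝ := (P.stripF u).re

lemma stripF_ofReal (u : ℝ) : P.stripF u = (P.rayF u : ℂ) := by
  have h : starRingEnd ℂ (P.stripF u) = P.stripF u := by
    rw [stripF, map_mul, map_div₀, ← P.num_conj, ← P.den_conj, ← Complex.exp_conj,
      ← Complex.exp_conj, map_mul, Complex.conj_ofReal, Complex.conj_ofReal]
  rw [rayF]
  exact (Complex.conj_eq_iff_re.1 h).symm

lemma hasDerivAt_stripF {ζ : ℂ} (hn : P.num (exp ζ) ≠ 0) (hd : P.den (exp ζ) ≠ 0) :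
    HasDerivAt P.stripF (P.stripF ζ * P.dlogF (exp ζ)) ζ := by
  have h1 : HasDerivAt (fun ζ : ℂ => exp (P.c * ζ)) (exp (P.c * ζ) * (P.c * 1)) ζ :=
    ((hasDerivAt_id ζ).const_mul (P.c : ℂ)).cexp
  have h2 := HasDerivAt.comp ζ (P.hasDerivAt_num_div_den hn hd) (Complex.hasDerivAt_exp ζ)
  refine (h1.mul h2).congr_deriv ?_
  simp only [stripF, dlogF, Function.comp]
  ring

lemma hasDerivAt_rayF {u : ℝ} (hd : P.den (Real.exp u) ≠ 0) :
    HasDerivAt P.rayF (P.rayF u * P.dlogR (Real.exp u)) u := by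
  have hn : P.num (exp (u : ℂ)) ≠ 0 := by
    rw [← Complex.ofReal_exp]; exact P.num_ne_zero_of_nonneg (Real.exp_pos u).le
  have hd' : P.den (exp (u : ℂ)) ≠ 0 := by rwa [← Complex.ofReal_exp]
  have h1 := (P.hasDerivAt_stripF hn hd').comp_ofReal
  have h2 := Complex.reCLM.hasFDerivAt.comp_hasDerivAt u h1
  rw [stripF_ofReal, ← Complex.ofReal_exp, dlogF_ofReal, ← Complex.ofReal_mul,
    Complex.reCLM_apply, Complex.ofReal_re] at h2
  exact h2

lemma gap_ray {u : ℝ} (hd : P.den (Real.exp u) ≠ 0) :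
    P.gap L u 0 = (|P.rayF u| - L) * ‖P.den (Real.exp u)‖ := by
  have h : |P.rayF u| = ‖P.stripF u‖ := by rw [stripF_ofReal, Complex.norm_real, Real.norm_eq_abs]
  have h2 := norm_ne_zero_iff.2 hd
  have h3 : ‖P.stripF u‖ =
      Real.exp (P.c * u) * (‖P.num (Real.exp u)‖ / ‖P.den (Real.exp u)‖) := by
    rw [stripF, norm_mul, norm_div, Complex.norm_exp, ← Complex.ofReal_exp, ← Complex.ofReal_mul,
      Complex.ofReal_re]
  rw [h, h3, gap, exp_logPt_zero]
  field_simp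

variable {P} in
lemma Level.stripF_eq {u φ : ℝ} (h : P.Level L u φ) (hL : 0 < L) :
    P.stripF (logPt u φ) = L * exp (P.phase u φ * I) := by
  rw [← h.exp_logF hL, P.exp_logF (h.num_ne_zero hL) h.den_ne_zero, stripF]

lemma logPt_zero (u : ℝ) : logPt u 0 = u := by simp [logPt]

variable {P} in
lemma Level.rayF_eq {u : ℝ} (h : P.Level L u 0) (hL : 0 < L) (hp : P.phase u 0 = 0) :
    P.rayF u = L := by
  have := h.stripF_eq hL
  rw [hp, logPt_zero, stripF_ofReal] at this
  simpa using this

lemma lt_one_of_phase_zero {u : ℝ} (hd : P.den (exp (logPt u 0)) ≠ 0) (hp : P.phase u 0 = 0) :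
    ∀ i, Real.exp u * P.t i < 1 := by
  intro i
  rw [phase_zero] at hp
  have h1 := (P.summable_arg_zero u).le_tsum i fun j _ => arg_ofReal_nonneg _
  rw [hp] at h1
  have h2 : arg ((1 - Real.exp u * P.t i : ℝ) : ℂ) = 0 := le_antisymm h1 (arg_ofReal_nonneg _)
  rw [Complex.arg_eq_zero_iff, Complex.ofReal_re] at h2
  refine lt_of_le_of_ne (by linarith [h2.1]) fun h3 => ?_
  rw [exp_logPt_zero] at hd
  apply P.den_ne_zero_iff.1 hd i
  have : (Real.exp u : ℂ) * (P.t i : ℂ) = 1 := by exact_mod_cast h3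
  push_cast at this ⊢
  rw [mul_neg, this]; ring

lemma phase_zero_eq {u : ℝ} (h : ∀ i, Real.exp u * P.t i < 1) : P.phase u 0 = 0 := by
  rw [phase_zero]
  have : ∀ i, arg ((1 - Real.exp u * P.t i : ℝ) : ℂ) = 0 := fun i =>
    Complex.arg_ofReal_of_nonneg (by linarith [h i])
  simp only [this, tsum_zero]

lemma den_ne_zero_of_lt_one {u : ℝ} (h : ∀ i, Real.exp u * P.t i < 1) :
    P.den (Real.exp u) ≠ 0 :=
  P.den_ne_zero_iff.2 fun i => by
    have h : 0 < 1 + Real.exp u * (-P.t i) := by linarith [h i]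
    exact_mod_cast h.ne'

lemma gap_neg_of_rayF {u : ℝ} (hd : P.den (Real.exp u) ≠ 0) (h0 : 0 < P.rayF u)
    (h : P.rayF u < L) : P.gap L u 0 < 0 := by
  rw [P.gap_ray hd, abs_of_pos h0]
  exact mul_neg_of_neg_of_pos (by linarith) (norm_pos_iff.2 hd)

lemma eventually_den_ne_zero {u : ℝ} (hd : P.den (Real.exp u) ≠ 0) :
    ∀ᶠ v : ℝ in 𝓝 u, P.den (Real.exp v) ≠ 0 :=
  (P.den_continuous.comp (Complex.continuous_ofReal.comp Real.continuous_exp)).continuousAt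
    |>.eventually_ne hd

/-- At the first level point of phase zero on the positive ray, the modulus does not increase. -/
lemma dlogR_nonpos_of_first (hL : 0 < L) {u₁ u₂ : ℝ} (h₁ : P.Level L u₁ Real.pi)
    (h₂ : P.Level L u₂ 0) (hu : u₁ ≤ u₂) (hp : P.phase u₂ 0 = 0)
    (hfirst : ∀ u' φ', u₁ ≤ u' → u' < u₂ → P.Level L u' φ' → P.phase u' φ' ≠ 0) :
    P.dlogR (Real.exp u₂) ≤ 0 := by
  by_contra hpos
  rw [not_le] at hpos
  have hpi := Real.pi_pos
  -- The level on the circle of radius exp u₁ is reached at φ = π, so the modulus at φ = 0 is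
  -- larger. A positive derivative at u₂ would put the modulus below L just before u₂, and an
  -- earlier crossing on the ray would follow.
  have hgap1 : 0 < P.gap L u₁ 0 := by
    by_contra h
    exact (P.gap_neg_of_gap_nonpos hL le_rfl hpi le_rfl (not_lt.1 h)).ne h₁.gap_eq_zero
  have hlt : u₁ < u₂ := by
    refine lt_of_le_of_ne hu ?_
    rintro rfl
    exact hgap1.ne' h₂.gap_eq_zero
  have hno := P.lt_one_of_phase_zero h₂.den_ne_zero hp
  have hd := P.den_ne_zero_of_lt_one hno
  have hf := P.hasDerivAt_rayF hd
  have hfL := h₂.rayF_eq hL hp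
  rw [hfL] at hf
  have hslope := (hasDerivAt_iff_tendsto_slope.1 hf).mono_left
    (nhdsWithin_mono u₂ fun y (hy : y < u₂) => ne_of_lt hy)
  have e1 : ∀ᶠ v in 𝓝[<] u₂, 0 < slope P.rayF u₂ v :=
    hslope.eventually_const_lt (mul_pos hL hpos)
  have e2 : ∀ᶠ v in 𝓝[<] u₂, 0 < P.rayF v :=
    (hf.continuousAt.tendsto.eventually_const_lt (by rw [hfL]; exact hL)).filter_mono
      nhdsWithin_le_nhds
  have e3 := (P.eventually_den_ne_zero hd).filter_mono (nhdsWithin_le_nhds (s := Set.Iio u₂))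
  obtain ⟨v, ⟨⟨h4, h5⟩, h6⟩, h7⟩ := (((e1.and e2).and e3).and (Ioo_mem_nhdsLT hlt)).exists
  have h8 : P.rayF v < L := by
    rw [slope_def_field, hfL] at h4
    rcases div_pos_iff.1 h4 with h | h <;> linarith [h7.2, h.1, h.2]
  have h9 := P.gap_neg_of_rayF h6 h5 h8
  obtain ⟨u', hu', h10⟩ := intermediate_value_Icc' h7.1.le
    (P.continuous_gap_left L 0).continuousOn (Set.mem_Icc.2 ⟨h9.le, hgap1.le⟩)
  have hl : P.Level L u' 0 := ⟨le_rfl, hpi.le, h10⟩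
  refine hfirst u' 0 hu'.1 (hu'.2.trans_lt h7.2) hl (le_antisymm ?_ (P.phase_zero_nonneg u'))
  exact (P.phase_zero_mono (hu'.2.trans h7.2.le)).trans hp.le

/-- The modulus on the positive ray returns to L: either there is a pole, or the factor other than
w^c grows at least like C e^u, which beats e^{cu} because c > -1. -/
lemma exists_gap_zero_nonneg (hL : 0 < L) (hc : -1 < P.c) {u₂ : ℝ}
    (hno : ∀ i, Real.exp u₂ * P.t i < 1) : ∃ u, u₂ ≤ u ∧ 0 ≤ P.gap L u 0 := by
  rcases isEmpty_or_nonempty ι₂ with hE | ⟨⟨i⟩⟩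
  · have key : ∃ C : ℝ, 0 < C ∧ ∀ u, P.c * u + (u + Real.log C) ≤ (P.logF (logPt u 0)).re := by
      have hre : ∀ u, (P.logF (logPt u 0)).re = P.c * u + (P.A * Real.exp u +
          ∑' i, (P.sTerm i (Real.exp u)).re) := by
        intro u
        have h0 : ∑' i, P.tTerm i (Real.exp u) = 0 := tsum_empty
        rw [logF, logG, exp_logPt_zero, h0, add_zero, Complex.add_re, Complex.add_re,
          Complex.re_tsum (P.summable_sTerm _), logPt_zero]
        simp only [Complex.re_ofReal_mul, Complex.ofReal_re]
      have hs : ∀ u i, (P.sTerm i (Real.exp u)).re = Real.log (1 + Real.exp u * P.s i) := by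
        intro u i
        have h : (0 : ℝ) < 1 + Real.exp u * P.s i := by
          have := P.s_pos i
          positivity
        rw [sTerm, Complex.log_re, ← Complex.ofReal_mul, ← Complex.ofReal_one, ← Complex.ofReal_add,
          Complex.norm_real, Real.norm_of_nonneg h.le]
      have hs0 : ∀ u i, 0 ≤ (P.sTerm i (Real.exp u)).re := by
        intro u i
        rw [hs]
        refine Real.log_nonneg ?_
        have := mul_pos (Real.exp_pos u) (P.s_pos i)
        linarith
      have hlog : ∀ u C : ℝ, 0 < C → u + Real.log C ≤ Real.log (1 + Real.exp u * C) := by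
        intro u C hC
        have : u + Real.log C = Real.log (Real.exp u * C) := by
          rw [Real.log_mul (Real.exp_ne_zero u) hC.ne', Real.log_exp]
        rw [this]
        exact Real.log_le_log (by positivity) (by linarith)
      rcases P.nontrivial with h | ⟨⟨i⟩⟩ | ⟨⟨i⟩⟩
      · refine ⟨P.A, h, fun u => ?_⟩
        rw [hre]
        have h1 : 0 ≤ ∑' i, (P.sTerm i (Real.exp u)).re := tsum_nonneg (hs0 u)
        have h2 := hlog u P.A h
        have h3 : Real.log (1 + Real.exp u * P.A) ≤ Real.exp u * P.A := by
          have := Real.log_le_sub_one_of_pos (show 0 < 1 + Real.exp u * P.A by positivity)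
          linarith
        linarith
      · refine ⟨P.s i, P.s_pos i, fun u => ?_⟩
        rw [hre]
        have hsum : Summable fun i => (P.sTerm i (Real.exp u)).re :=
          Complex.reCLM.summable (P.summable_sTerm _)
        have h1 := hsum.le_tsum i fun j _ => hs0 u j
        have h2 := hlog u (P.s i) (P.s_pos i)
        have h3 := mul_nonneg P.A_nonneg (Real.exp_pos u).le
        have h4 := hs u i
        linarith
      · exact hE.elim i
    obtain ⟨C, hC, hk⟩ := key
    have hc1 : 0 < P.c + 1 := by linarith
    refine ⟨max u₂ ((Real.log L - Real.log C) / (P.c + 1)), le_max_left _ _, ?_⟩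
    set u := max u₂ ((Real.log L - Real.log C) / (P.c + 1)) with hu
    have h1 : Real.log L - Real.log C ≤ u * (P.c + 1) := by
      rw [← div_le_iff₀ hc1]; exact le_max_right _ _
    have hd : P.den (exp (logPt u 0)) ≠ 0 := P.den_ne_zero_iff.2 fun i => hE.elim i
    rw [P.gap_eq (P.num_ne_zero_of_lt_pi le_rfl Real.pi_pos) hd]
    refine mul_nonneg (sub_nonneg.2 ?_) (norm_nonneg _)
    rw [← Real.log_le_iff_le_exp hL]
    linarith [hk u]
  · have ht := P.t_pos i
    refine ⟨-Real.log (P.t i), ?_, ?_⟩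
    · have := Real.log_neg (mul_pos (Real.exp_pos u₂) ht) (hno i)
      rw [Real.log_mul (Real.exp_ne_zero _) ht.ne', Real.log_exp] at this
      linarith
    · have hd : P.den (exp (logPt (-Real.log (P.t i)) 0)) = 0 := by
        by_contra h
        refine P.den_ne_zero_iff.1 h i ?_
        rw [exp_logPt_zero, Real.exp_neg, Real.exp_log ht]
        have : (P.t i : ℂ) ≠ 0 := by exact_mod_cast ht.ne'
        push_cast
        field_simp
        ring
      rw [gap, hd, norm_zero, mul_zero, sub_zero]
      positivity

/-- The gap is positive at a pole, so no pole can be crossed while it stays nonpositive. -/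
lemma lt_one_of_gap_nonpos {u₂ u₃ : ℝ} (hno : ∀ i, Real.exp u₂ * P.t i < 1)
    (h : ∀ u, u₂ ≤ u → u ≤ u₃ → P.gap L u 0 ≤ 0) : ∀ i, Real.exp u₃ * P.t i < 1 := by
  intro i
  by_contra h3
  have ht := P.t_pos i
  have h1 := Real.log_neg (mul_pos (Real.exp_pos u₂) ht) (hno i)
  have h2 := Real.log_nonneg (not_lt.1 h3)
  rw [Real.log_mul (Real.exp_ne_zero _) ht.ne', Real.log_exp] at h1 h2
  have h4 := P.den_ne_zero_of_gap_nonpos le_rfl Real.pi_pos.le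
    (h (-Real.log (P.t i)) (by linarith) (by linarith))
  refine P.den_ne_zero_iff.1 h4 i ?_
  rw [exp_logPt_zero, Real.exp_neg, Real.exp_log ht]
  have : (P.t i : ℂ) ≠ 0 := by exact_mod_cast ht.ne'
  push_cast
  field_simp
  ring

/-- After a transversal level point on the positive ray, the next level point lies on the same ray
and is transversal too. -/
lemma exists_next_on_ray (hL : 0 < L) (hc : -1 < P.c) {u₂ : ℝ} (h₂ : P.Level L u₂ 0)
    (hp : P.phase u₂ 0 = 0) (hneg : P.dlogR (Real.exp u₂) < 0) :
    ∃ u₃, u₂ < u₃ ∧ P.Level L u₃ 0 ∧ P.phase u₃ 0 = 0 ∧ 0 < P.dlogR (Real.exp u₃) ∧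
      ∀ u φ, u₂ < u → u < u₃ → ¬ P.Level L u φ := by
  have hpi := Real.pi_pos
  have hno := P.lt_one_of_phase_zero h₂.den_ne_zero hp
  have hd := P.den_ne_zero_of_lt_one hno
  have hf := P.hasDerivAt_rayF hd
  have hfL := h₂.rayF_eq hL hp
  rw [hfL] at hf
  have hslope := (hasDerivAt_iff_tendsto_slope.1 hf).mono_left
    (nhdsWithin_mono u₂ fun y (hy : u₂ < y) => ne_of_gt hy)
  have e1 : ∀ᶠ v in 𝓝[>] u₂, slope P.rayF u₂ v < 0 :=
    hslope.eventually_lt_const (mul_neg_of_pos_of_neg hL hneg)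
  have e2 : ∀ᶠ v in 𝓝[>] u₂, 0 < P.rayF v :=
    (hf.continuousAt.tendsto.eventually_const_lt (by rw [hfL]; exact hL)).filter_mono
      nhdsWithin_le_nhds
  have e3 := (P.eventually_den_ne_zero hd).filter_mono (nhdsWithin_le_nhds (s := Set.Ioi u₂))
  have e4 : ∀ᶠ v in 𝓝[>] u₂, P.gap L v 0 < 0 := by
    filter_upwards [e1, e2, e3, self_mem_nhdsWithin] with v h4 h5 h6 (h7 : u₂ < v)
    refine P.gap_neg_of_rayF h6 h5 ?_
    rw [slope_def_field, hfL] at h4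
    rcases div_neg_iff.1 h4 with h | h <;> linarith [h.1, h.2]
  obtain ⟨v₀, hv₀, hv⟩ := (mem_nhdsGT_iff_exists_Ioo_subset).1 e4
  have hv₀' : u₂ < v₀ := hv₀
  set v₁ := (u₂ + v₀) / 2 with hv₁
  have hcont := P.continuous_gap_left L 0
  have hgv : ∀ v, u₂ < v → v < v₀ → P.gap L v 0 < 0 := fun v h h' => hv ⟨h, h'⟩
  have hgv1 : P.gap L v₁ 0 < 0 := hgv v₁ (by rw [hv₁]; linarith) (by rw [hv₁]; linarith)
  obtain ⟨u₄, hu₄, hg₄⟩ := P.exists_gap_zero_nonneg (L := L) hL hc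
    (u₂ := v₁) (P.lt_one_of_gap_nonpos hno fun u h h' => by
      rcases h.eq_or_lt with rfl | h
      · exact h₂.gap_eq_zero.le
      · exact (hgv u h (by rw [hv₁] at h'; linarith)).le)
  let K : Set ℝ := Set.Icc v₁ u₄ ∩ {u | 0 ≤ P.gap L u 0}
  have hK : IsCompact K := isCompact_Icc.inter_right (isClosed_le continuous_const hcont)
  obtain ⟨u₃, ⟨h3, h3'⟩, hmin⟩ := hK.exists_isLeast ⟨u₄, ⟨hu₄, le_rfl⟩, hg₄⟩
  have hltv : v₁ < u₃ := by
    refine lt_of_le_of_ne h3.1 ?_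
    intro h
    rw [← h] at h3'
    exact absurd hgv1 (not_lt.2 h3')
  have hneg' : ∀ u, u₂ < u → u < u₃ → P.gap L u 0 < 0 := by
    intro u h h'
    rcases lt_or_ge u v₁ with h5 | h5
    · exact hgv u h (by rw [hv₁] at h5; linarith)
    · by_contra h6
      exact absurd (hmin ⟨⟨h5, h'.le.trans h3.2⟩, not_lt.1 h6⟩) (not_le.2 h')
  have hlt : u₂ < u₃ := by rw [hv₁] at hltv; linarith
  have hle : P.gap L u₃ 0 ≤ 0 := by
    refine le_of_tendsto (hcont.tendsto u₃ |>.mono_left (nhdsWithin_le_nhds (s := Set.Iio u₃))) ?_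
    filter_upwards [Ioo_mem_nhdsLT hlt] with u hu using (hneg' u hu.1 hu.2).le
  have hlev : P.Level L u₃ 0 := ⟨le_rfl, hpi.le, le_antisymm hle h3'⟩
  have hle' : ∀ u, u₂ ≤ u → u ≤ u₃ → P.gap L u 0 ≤ 0 := by
    intro u h h'
    rcases h.eq_or_lt with rfl | h
    · exact h₂.gap_eq_zero.le
    rcases h'.eq_or_lt with rfl | h'
    · exact hle
    · exact (hneg' u h h').le
  have hno3 := P.lt_one_of_gap_nonpos hno hle'
  have hp3 := P.phase_zero_eq hno3
  have hno' : ∀ u, u ≤ u₃ → ∀ i, Real.exp u * P.t i < 1 := fun u hu i =>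
    lt_of_le_of_lt (mul_le_mul_of_nonneg_right (Real.exp_le_exp.2 hu) (P.t_pos i).le) (hno3 i)
  have hder : ∀ u, u ≤ u₃ → HasDerivAt P.rayF (P.rayF u * P.dlogR (Real.exp u)) u := fun u hu =>
    P.hasDerivAt_rayF (P.den_ne_zero_of_lt_one (hno' u hu))
  refine ⟨u₃, hlt, hlev, hp3, ?_, fun u φ h h' hl => ?_⟩
  -- Rolle between the two crossings gives a zero of `dlogR`, which is strictly increasing up to u₃;
  -- hence it is positive at u₃.
  · obtain ⟨ξ, hξ, h5⟩ := exists_hasDerivAt_eq_zero hlt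
      (fun u hu => (hder u hu.2).continuousAt.continuousWithinAt)
      (hfL.trans (hlev.rayF_eq hL hp3).symm) (fun u hu => hder u hu.2.le)
    have h6 : P.rayF ξ ≠ 0 := by
      intro h7
      have h8 : P.stripF ξ = 0 := by rw [stripF_ofReal, h7, Complex.ofReal_zero]
      rw [stripF, ← Complex.ofReal_exp] at h8
      exact mul_ne_zero (exp_ne_zero _) (div_ne_zero (P.num_ne_zero_of_nonneg (Real.exp_pos ξ).le)
        (P.den_ne_zero_of_lt_one (hno' ξ hξ.2.le))) h8
    have h7 := (mul_eq_zero.1 h5).resolve_left h6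
    have := P.dlogR_strictMonoOn hno3 (Real.exp_pos ξ) (Real.exp_lt_exp.2 hξ.2) le_rfl
    linarith
  -- Between the crossings the gap is negative at φ = 0, where the modulus on the circle is largest,
  -- so the circle has no level point.
  · rcases hl.nonneg.eq_or_lt with h0 | h0
    · have := hneg' u h h'
      have hz := hl.gap_eq_zero
      rw [← h0] at hz
      linarith
    · have := P.gap_neg_of_gap_nonpos hL le_rfl h0 hl.le_pi (hneg' u h h').le
      exact this.ne hl.gap_eq_zero

/-- On the negative ray the modulus is strictly decreasing before the first zero. -/
lemma not_two_levels_pi (hL : 0 < L) {u u' : ℝ} (h : P.Level L u Real.pi)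
    (h' : P.Level L u' Real.pi) (hu : u < u') (hp : P.phase u' Real.pi = P.c * Real.pi) : False := by
  have hs : ∀ i, Real.exp u' * P.s i < 1 := by
    intro i
    rw [phase_pi] at hp
    have h1 := (P.summable_arg_pi u').le_tsum i fun j _ => arg_ofReal_nonneg _
    have h2 : arg ((1 - Real.exp u' * P.s i : ℝ) : ℂ) = 0 :=
      le_antisymm (by linarith) (arg_ofReal_nonneg _)
    rw [Complex.arg_eq_zero_iff, Complex.ofReal_re] at h2
    refine lt_of_le_of_ne (by linarith [h2.1]) fun h3 => ?_
    have hn := h'.num_ne_zero hL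
    rw [exp_logPt_pi] at hn
    apply P.num_ne_zero_iff.1 hn i
    have : (Real.exp u' : ℂ) * (P.s i : ℂ) = 1 := by exact_mod_cast h3
    push_cast at this ⊢
    rw [neg_mul, this]; ring
  have he := Real.exp_lt_exp.2 hu
  have hre : ∀ v, (P.logF (logPt v Real.pi)).re = P.c * v - P.A * Real.exp v +
      ∑' i, (P.sTerm i ((-Real.exp v : ℝ) : ℂ)).re +
      ∑' i, (P.tTerm i ((-Real.exp v : ℝ) : ℂ)).re := by
    intro v
    rw [logF, logG, exp_logPt_pi, Complex.add_re, Complex.add_re, Complex.add_re,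
      Complex.re_tsum (P.summable_sTerm _), Complex.re_tsum (P.summable_tTerm _)]
    simp only [Complex.re_ofReal_mul, Complex.ofReal_re, logPt_re]
    ring
  have hsT : ∀ v i, (P.sTerm i ((-Real.exp v : ℝ) : ℂ)).re = Real.log (1 - Real.exp v * P.s i) := by
    intro v i
    rw [sTerm, Complex.log_re, ← Complex.ofReal_mul, ← Complex.ofReal_one, ← Complex.ofReal_add,
      Complex.norm_real, Real.norm_eq_abs, Real.log_abs]
    congr 1; ring
  have htT : ∀ v i, (P.tTerm i ((-Real.exp v : ℝ) : ℂ)).re =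
      -Real.log (1 + Real.exp v * P.t i) := by
    intro v i
    rw [tTerm, Complex.neg_re, Complex.conj_re, Complex.log_re, Complex.conj_ofReal,
      ← Complex.ofReal_mul, ← Complex.ofReal_one, ← Complex.ofReal_add,
      Complex.norm_real, Real.norm_eq_abs, Real.log_abs]
    congr 2; ring
  have hS : ∑' i, (P.sTerm i ((-Real.exp u' : ℝ) : ℂ)).re ≤
      ∑' i, (P.sTerm i ((-Real.exp u : ℝ) : ℂ)).re := by
    refine (Complex.reCLM.summable (P.summable_sTerm _)).tsum_le_tsum (fun i => ?_)
      (Complex.reCLM.summable (P.summable_sTerm _))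
    have h1 := P.s_pos i
    have h2 := hs i
    simp only [hsT]
    exact Real.log_le_log (by linarith) (by nlinarith)
  have hT : ∑' i, (P.tTerm i ((-Real.exp u' : ℝ) : ℂ)).re ≤
      ∑' i, (P.tTerm i ((-Real.exp u : ℝ) : ℂ)).re := by
    refine (Complex.reCLM.summable (P.summable_tTerm _)).tsum_le_tsum (fun i => ?_)
      (Complex.reCLM.summable (P.summable_tTerm _))
    have h1 := P.t_pos i
    simp only [htT]
    refine neg_le_neg (Real.log_le_log (by positivity) (by nlinarith))
  have hA := mul_le_mul_of_nonneg_left he.le P.A_nonneg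
  have hcu := mul_lt_mul_of_neg_left hu P.c_neg
  have heq : (P.logF (logPt u Real.pi)).re = (P.logF (logPt u' Real.pi)).re :=
    Real.exp_injective ((h.exp_re hL).trans (h'.exp_re hL).symm)
  rw [hre, hre] at heq
  linarith

end PFData


/-! ### Back to the variable z: k-th roots, rotations and multiplicities -/

/-- The point `exp ((u + iτ) / k)`. -/
def rootPt (k : ℕ) (u τ : ℝ) : ℂ := exp (logPt u τ / k)

lemma rootPt_ne_zero (k : ℕ) (u τ : ℝ) : rootPt k u τ ≠ 0 := exp_ne_zero _

lemma rootPt_pow {k : ℕ} (hk : k ≠ 0) (u τ : ℝ) : rootPt k u τ ^ k = exp (logPt u τ) := by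
  rw [rootPt, ← Complex.exp_nat_mul]
  congr 1
  have : (k : ℂ) ≠ 0 := by exact_mod_cast hk
  field_simp

lemma norm_rootPt (k : ℕ) (u τ : ℝ) : ‖rootPt k u τ‖ = Real.exp (u / k) := by
  rw [rootPt, Complex.norm_exp]
  congr 1
  rw [← Complex.ofReal_natCast, Complex.div_ofReal_re, logPt_re]

lemma rootPt_eq (k : ℕ) (u τ : ℝ) :
    rootPt k u τ = Real.exp (u / k) * exp ((τ / k : ℝ) * I) := by
  rw [rootPt, logPt, Complex.ofReal_exp, ← exp_add]
  congr 1
  push_cast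
  ring

lemma rootPt_norm_lt {k : ℕ} (hk : k ≠ 0) {u u' τ τ' : ℝ} :
    ‖rootPt k u τ‖ < ‖rootPt k u' τ'‖ ↔ u < u' := by
  have : (0 : ℝ) < k := by positivity
  rw [norm_rootPt, norm_rootPt, Real.exp_lt_exp, div_lt_div_iff_of_pos_right this]

lemma rootPt_add_period {k : ℕ} (hk : k ≠ 0) (u τ : ℝ) (l : ℤ) :
    rootPt k u (τ + 2 * Real.pi * (k * l)) = rootPt k u τ := by
  rw [rootPt, rootPt, Complex.exp_eq_exp_iff_exists_int]
  refine ⟨l, ?_⟩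
  have : (k : ℂ) ≠ 0 := by exact_mod_cast hk
  simp only [logPt]
  push_cast
  field_simp
  ring

lemma exists_rootPt {k : ℕ} (hk : k ≠ 0) {z : ℂ} (hz : z ≠ 0) :
    rootPt k (k * Real.log ‖z‖) (k * arg z) = z := by
  have : (k : ℂ) ≠ 0 := by exact_mod_cast hk
  conv_rhs => rw [← exp_log hz]
  rw [rootPt]
  congr 1
  rw [logPt, Complex.log]
  push_cast
  field_simp

lemma exists_strip_rep (τ : ℝ) : ∃ (φ ε : ℝ) (j : ℤ), 0 ≤ φ ∧ φ ≤ Real.pi ∧ (ε = 1 ∨ ε = -1) ∧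
    τ = ε * φ + 2 * Real.pi * j := by
  have hpi := Real.pi_pos
  have h := abs_sub_round (τ / (2 * Real.pi))
  set j := round (τ / (2 * Real.pi))
  have h1 : |τ - 2 * Real.pi * j| ≤ Real.pi := by
    have e : τ - 2 * Real.pi * j = (2 * Real.pi) * (τ / (2 * Real.pi) - j) := by
      field_simp
    rw [e, abs_mul, abs_of_pos (by positivity)]
    nlinarith
  rcases le_total 0 (τ - 2 * Real.pi * j) with h2 | h2
  · refine ⟨_, 1, j, abs_nonneg _, h1, Or.inl rfl, ?_⟩
    rw [abs_of_nonneg h2]; ring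
  · refine ⟨_, -1, j, abs_nonneg _, h1, Or.inr rfl, ?_⟩
    rw [abs_of_nonpos h2]; ring

namespace PFData

variable {ι₁ ι₂ : Type*} (P : PFData ι₁ ι₂) {L : ℝ}

/-- The function `z ^ p * num (z ^ k) / den (z ^ k)`. -/
def rootF (k : ℕ) (p : ℤ) (z : ℂ) : ℂ := z ^ p * (P.num (z ^ k) / P.den (z ^ k))

variable {k : ℕ} {p : ℤ}

lemma rootF_rootPt (hk : k ≠ 0) (hc : P.c = p / k) (u τ : ℝ) :
    P.rootF k p (rootPt k u τ) = P.stripF (logPt u τ) := by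
  rw [rootF, stripF, rootPt_pow hk, rootPt, ← Complex.exp_int_mul, hc]
  congr 2
  push_cast
  ring

lemma exp_logPt_add (u τ : ℝ) (j : ℤ) :
    exp (logPt u (τ + 2 * Real.pi * j)) = exp (logPt u τ) := by
  rw [Complex.exp_eq_exp_iff_exists_int]
  refine ⟨j, ?_⟩
  simp only [logPt]; push_cast; ring

lemma logPt_neg (u τ : ℝ) : logPt u (-τ) = starRingEnd ℂ (logPt u τ) := by
  simp [logPt]

lemma stripF_add (u τ : ℝ) (j : ℤ) : P.stripF (logPt u (τ + 2 * Real.pi * j)) =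
    exp ((2 * Real.pi * P.c * j : ℝ) * I) * P.stripF (logPt u τ) := by
  rw [stripF, stripF, exp_logPt_add, ← mul_assoc, ← exp_add]
  congr 2
  simp only [logPt]; push_cast; ring

lemma stripF_conj (ζ : ℂ) : P.stripF (starRingEnd ℂ ζ) = starRingEnd ℂ (P.stripF ζ) := by
  rw [stripF, stripF, map_mul, map_div₀, ← P.num_conj, ← P.den_conj, ← Complex.exp_conj,
    ← Complex.exp_conj, map_mul, Complex.conj_ofReal]

-- Reflection in the real axis changes the sign of the phase, and a turn of w by 2πj adds 2πcj
-- through the branch of w^c.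
variable {P} in
lemma Level.stripF_rep (hL : 0 < L) {u φ : ℝ} (h : P.Level L u φ) {ε : ℝ} (hε : ε = 1 ∨ ε = -1)
    (j : ℤ) : P.stripF (logPt u (ε * φ + 2 * Real.pi * j)) =
      L * exp ((ε * P.phase u φ + 2 * Real.pi * P.c * j : ℝ) * I) := by
  have h1 : P.stripF (logPt u (ε * φ)) = L * exp ((ε * P.phase u φ : ℝ) * I) := by
    rcases hε with rfl | rfl
    · rw [one_mul, one_mul, h.stripF_eq hL]
    · rw [neg_one_mul, logPt_neg, stripF_conj, h.stripF_eq hL, map_mul, ← Complex.exp_conj]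
      simp
  rw [stripF_add, h1, mul_left_comm, ← exp_add]
  congr 2
  push_cast; ring

lemma norm_stripF_rep {u φ : ℝ} {ε : ℝ} (hε : ε = 1 ∨ ε = -1)
    (j : ℤ) : ‖P.stripF (logPt u (ε * φ + 2 * Real.pi * j))‖ = ‖P.stripF (logPt u φ)‖ := by
  rw [stripF_add, norm_mul, Complex.norm_exp_ofReal_mul_I, one_mul]
  rcases hε with rfl | rfl
  · rw [one_mul]
  · rw [neg_one_mul, logPt_neg, stripF_conj, Complex.norm_conj]

lemma level_of_norm_stripF (hL : 0 < L) {u φ : ℝ} (h0 : 0 ≤ φ) (h1 : φ ≤ Real.pi)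
    (h : ‖P.stripF (logPt u φ)‖ = L) : P.Level L u φ := by
  refine ⟨h0, h1, ?_⟩
  have hd : P.den (exp (logPt u φ)) ≠ 0 := by
    -- At a pole the quotient has the default value 0, which is not of modulus L > 0.
    intro hd
    rw [stripF, hd, div_zero, mul_zero, norm_zero] at h
    exact hL.ne h
  have hd' := norm_ne_zero_iff.2 hd
  rw [gap, ← h, stripF, norm_mul, norm_div, Complex.norm_exp]
  have : ((P.c : ℂ) * logPt u φ).re = P.c * u := by simp
  rw [this]
  field_simp
  ring

lemma rootF_zero (hp : p < 0) : P.rootF k p 0 = 0 := by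
  rw [rootF, zero_zpow _ hp.ne, zero_mul]

/-- Every point at which `rootF` takes the value `L exp (i (N + x) π / k)` comes from a level
point. -/
lemma exists_level_of_rootF_eq (hk : k ≠ 0) (hp : p < 0) (hc : P.c = p / k) (hL : 0 < L)
    {N : ℤ} {x : ℝ} {z : ℂ}
    (hz : P.rootF k p z = L * exp (((N + x) * (Real.pi / k) : ℝ) * I)) :
    ∃ (u φ ε : ℝ) (j M n : ℤ), P.Level L u φ ∧ (ε = 1 ∨ ε = -1) ∧
      z = rootPt k u (ε * φ + 2 * Real.pi * j) ∧
      ε * P.phase u φ = (M + x) * (Real.pi / k) ∧ 2 * p * j + M = N + 2 * k * n := by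
  have hk0 : (k : ℝ) ≠ 0 := by exact_mod_cast hk
  have hz0 : z ≠ 0 := by
    rintro rfl
    rw [P.rootF_zero hp] at hz
    exact mul_ne_zero (by exact_mod_cast hL.ne') (exp_ne_zero _) hz.symm
  have hrep := exists_rootPt hk hz0
  obtain ⟨φ, ε, j, h0, h1, hε, hτ⟩ := exists_strip_rep (k * arg z)
  set u := k * Real.log ‖z‖
  rw [hτ] at hrep
  rw [← hrep, P.rootF_rootPt hk hc] at hz
  have hlev : P.Level L u φ := by
    refine P.level_of_norm_stripF hL h0 h1 ?_
    rw [← P.norm_stripF_rep hε j, hz, norm_mul, Complex.norm_exp_ofReal_mul_I, mul_one,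
      Complex.norm_real, Real.norm_of_nonneg hL.le]
  rw [hlev.stripF_rep hL hε] at hz
  have h2 := mul_left_cancel₀ (show (L : ℂ) ≠ 0 by exact_mod_cast hL.ne') hz
  obtain ⟨n, hn⟩ := Complex.exp_eq_exp_iff_exists_int.1 h2
  have h3 : ε * P.phase u φ + 2 * Real.pi * P.c * j =
      (N + x) * (Real.pi / k) + n * (2 * Real.pi) := by
    have := congrArg Complex.im hn
    simpa using this
  -- The integer M absorbs the period 2π of the exponential and the rotation, both of which shift it
  -- by an even amount.
  refine ⟨u, φ, ε, j, N + 2 * k * n - 2 * p * j, n, hlev, hε, hrep.symm, ?_, by ring⟩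
  rw [hc] at h3
  push_cast
  field_simp at h3 ⊢
  linarith

lemma rootF_eq_of_level (hk : k ≠ 0) (hc : P.c = p / k) (hL : 0 < L)
    {N : ℤ} {x : ℝ} {u φ ε : ℝ} {j M n : ℤ} (h : P.Level L u φ) (hε : ε = 1 ∨ ε = -1)
    (hph : ε * P.phase u φ = (M + x) * (Real.pi / k)) (hj : 2 * p * j + M = N + 2 * k * n) :
    P.rootF k p (rootPt k u (ε * φ + 2 * Real.pi * j)) =
      L * exp (((N + x) * (Real.pi / k) : ℝ) * I) := by
  have hk0 : (k : ℝ) ≠ 0 := by exact_mod_cast hk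
  rw [P.rootF_rootPt hk hc, h.stripF_rep hL hε]
  congr 1
  rw [Complex.exp_eq_exp_iff_exists_int]
  refine ⟨n, ?_⟩
  have e : ε * P.phase u φ + 2 * Real.pi * P.c * j =
      (N + x) * (Real.pi / k) + n * (2 * Real.pi) := by
    have hj' : (2 * p * j + M : ℝ) = N + 2 * k * n := by exact_mod_cast hj
    rw [hph, hc]
    field_simp
    linear_combination hj'
  rw [e]
  push_cast
  ring

/-- Halving the difference N - M leaves a linear congruence modulo k, solvable because p is
invertible modulo k. -/
lemma exists_rotation {k : ℕ} {p : ℤ} (hpk : Nat.gcd p.natAbs k = 1) {M N : ℤ}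
    (h : M ≡ N [ZMOD 2]) : ∃ j n : ℤ, 2 * p * j + M = N + 2 * k * n := by
  obtain ⟨m, hm⟩ := h.dvd
  have hg : IsCoprime p (k : ℤ) := by
    rw [Int.isCoprime_iff_gcd_eq_one]; simpa [Int.gcd] using hpk
  obtain ⟨a, b, hab⟩ := hg
  exact ⟨m * a, -(m * b), by linear_combination (2 * m) * hab - hm⟩

lemma rotation_unique {k : ℕ} {p : ℤ} (hpk : Nat.gcd p.natAbs k = 1) {M N j n j' n' : ℤ}
    (h : 2 * p * j + M = N + 2 * k * n) (h' : 2 * p * j' + M = N + 2 * k * n') :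
    ∃ l : ℤ, j' = j + k * l := by
  have hg : IsCoprime p (k : ℤ) := by
    rw [Int.isCoprime_iff_gcd_eq_one]; simpa [Int.gcd] using hpk
  have h1 : (k : ℤ) ∣ p * (j' - j) := ⟨n' - n, by linarith⟩
  obtain ⟨l, hl⟩ := hg.symm.dvd_of_dvd_mul_left h1
  exact ⟨l, by linarith⟩

lemma rootPt_rotation_eq {k : ℕ} {p : ℤ} (hk : k ≠ 0) (hpk : Nat.gcd p.natAbs k = 1)
    {M N j n j' n' : ℤ} (h : 2 * p * j + M = N + 2 * k * n) (h' : 2 * p * j' + M = N + 2 * k * n')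
    (u τ : ℝ) : rootPt k u (τ + 2 * Real.pi * j') = rootPt k u (τ + 2 * Real.pi * j) := by
  obtain ⟨l, rfl⟩ := rotation_unique hpk h h'
  rw [← rootPt_add_period hk u (τ + 2 * Real.pi * j) l]
  congr 1
  push_cast; ring

lemma hasDerivAt_rootF (hc : P.c = p / k) (hk : k ≠ 0) {z : ℂ} (hz : P.rootF k p z ≠ 0)
    (hz0 : z ≠ 0) :
    HasDerivAt (P.rootF k p) (P.rootF k p z * (k / z * P.dlogF (z ^ k))) z := by
  have hkC : (k : ℂ) ≠ 0 := by exact_mod_cast hk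
  have hq : P.num (z ^ k) / P.den (z ^ k) ≠ 0 := fun h => hz (by rw [rootF, h, mul_zero])
  obtain ⟨hn, hd⟩ := div_ne_zero_iff.1 hq
  have h1 := hasDerivAt_zpow p z (Or.inl hz0)
  have h2 : HasDerivAt (fun y => P.num (y ^ k) / P.den (y ^ k))
      (P.num (z ^ k) / P.den (z ^ k) * P.dlogG (z ^ k) * (k * z ^ (k - 1))) z :=
    HasDerivAt.comp z (h := fun y : ℂ => y ^ k) (P.hasDerivAt_num_div_den hn hd)
      (hasDerivAt_pow k z)
  refine (h1.mul h2).congr_deriv ?_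
  simp only [rootF, dlogF, hc]
  rw [zpow_sub_one₀ hz0]
  have h3 : z ^ k = z ^ (k - 1) * z := by rw [← pow_succ, Nat.sub_add_cancel (Nat.pos_of_ne_zero hk)]
  have h4 : z ^ (k - 1) = z ^ k * z⁻¹ := by rw [h3, mul_assoc, mul_inv_cancel₀ hz0, mul_one]
  rw [h4]
  push_cast
  field_simp

lemma hasMultiplicity_one (hc : P.c = p / k) (hk : k ≠ 0) (hp : p < 0) {z : ℂ}
    (hz : P.rootF k p z ≠ 0) (hD : P.dlogF (z ^ k) ≠ 0) : HasMultiplicity (P.rootF k p) z 1 := by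
  have hz0 : z ≠ 0 := by rintro rfl; exact hz (P.rootF_zero hp)
  refine ⟨le_rfl, fun j h1 h2 => by omega, ?_⟩
  rw [iteratedDeriv_one, (P.hasDerivAt_rootF hc hk hz hz0).deriv]
  exact mul_ne_zero hz (mul_ne_zero (div_ne_zero (by exact_mod_cast hk) hz0) hD)

lemma hasMultiplicity_two (hc : P.c = p / k) (hk : k ≠ 0) (hp : p < 0) {z : ℂ}
    (hz : P.rootF k p z ≠ 0) {x : ℝ} (hx : 0 < x) (hzx : z ^ k = x) (ht : ∀ i, x * P.t i < 1)
    (hD : P.dlogR x = 0) : HasMultiplicity (P.rootF k p) z 2 := by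
  have hz0 : z ≠ 0 := by rintro rfl; exact hz (P.rootF_zero hp)
  have hkC : (k : ℂ) ≠ 0 := by exact_mod_cast hk
  have hq : P.num (z ^ k) / P.den (z ^ k) ≠ 0 := fun h => hz (by rw [rootF, h, mul_zero])
  obtain ⟨hn, hd⟩ := div_ne_zero_iff.1 hq
  have hD' : P.dlogF (z ^ k) = 0 := by rw [hzx, dlogF_ofReal, hD, Complex.ofReal_zero]
  have h1 := P.hasDerivAt_rootF hc hk hz hz0
  refine ⟨by norm_num, fun j hj1 hj2 => ?_, ?_⟩
  · obtain rfl : j = 1 := by omega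
    rw [iteratedDeriv_one, h1.deriv, hD', mul_zero, mul_zero]
  · rw [iteratedDeriv_succ, iteratedDeriv_one]
    have e : deriv (P.rootF k p) =ᶠ[𝓝 z]
        fun y => P.rootF k p y * (k / y * P.dlogF (y ^ k)) := by
      filter_upwards [h1.continuousAt.eventually_ne hz, eventually_ne_nhds hz0] with y hy hy0
      exact (P.hasDerivAt_rootF hc hk hy hy0).deriv
    rw [e.deriv_eq]
    have h2 : HasDerivAt (fun y => P.dlogF (y ^ k))
        (deriv P.dlogF (z ^ k) * (k * z ^ (k - 1))) z :=
      HasDerivAt.comp z (h := fun y : ℂ => y ^ k)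
        (P.differentiableAt_dlogF hn hd).hasDerivAt (hasDerivAt_pow k z)
    have h3 : HasDerivAt (fun y : ℂ => (k : ℂ) / y) (-(k : ℂ) / z ^ 2) z := by
      have := (hasDerivAt_inv hz0).const_mul (k : ℂ)
      refine (this.congr_deriv ?_)
      field_simp
    have h4 := h1.mul (h3.mul h2)
    have h5 : deriv (fun y => P.rootF k p y * (k / y * P.dlogF (y ^ k))) z = _ := h4.deriv
    rw [h5]
    simp only [hD', mul_zero, zero_mul, zero_add]
    -- The derivative is F·(k/z)·`dlogF`(z^k); where the last factor vanishes, only the term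
    -- differentiating that factor survives.
    refine mul_ne_zero hz (mul_ne_zero (div_ne_zero hkC hz0) (mul_ne_zero ?_
      (mul_ne_zero hkC (pow_ne_zero _ hz0))))
    rw [hzx]
    exact P.deriv_dlogF_ofReal_ne_zero hx ht

end PFData


/-! ### Sectors and the closest α-points -/

lemma rootPt_mul_eRot {k : ℕ} (u τ : ℝ) (m : ℤ) :
    rootPt k u τ * eRot k m = rootPt k u (τ + m * Real.pi) := by
  rw [rootPt, eRot, rootPt, ← exp_add]
  congr 1
  simp only [logPt]
  push_cast
  ring

lemma arg_rootPt {k : ℕ} {u τ : ℝ} (h0 : -Real.pi < τ / k) (h1 : τ / k ≤ Real.pi) :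
    arg (rootPt k u τ) = τ / k := by
  rw [rootPt_eq, Complex.exp_mul_I, Complex.arg_mul_cos_add_sin_mul_I (Real.exp_pos _) ⟨h0, h1⟩]

lemma rootPt_mem_sectorQ {k : ℕ} (hk : k ≠ 0) {u τ : ℝ} {s : ℤ} (h0 : s * Real.pi < τ)
    (h1 : τ < (s + 1) * Real.pi) : rootPt k u τ ∈ sectorQ k s := by
  have hpi := Real.pi_pos
  have hk1 : (1 : ℝ) ≤ k := by exact_mod_cast Nat.one_le_iff_ne_zero.2 hk
  have hk0 : (0 : ℝ) < k := by linarith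
  have e : τ + ((-s : ℤ) : ℝ) * Real.pi = τ - s * Real.pi := by push_cast; ring
  have h2 : 0 < (τ - s * Real.pi) / k := div_pos (by linarith) hk0
  have h3 : (τ - s * Real.pi) / k < Real.pi / k := by
    apply div_lt_div_of_pos_right _ hk0; linarith
  have h4 : Real.pi / k ≤ Real.pi := div_le_self hpi.le hk1
  refine ⟨rootPt_ne_zero _ _ _, ?_⟩
  rw [rootPt_mul_eRot, e, arg_rootPt (by linarith) (by linarith)]
  exact ⟨h2, h3⟩

lemma isPosReal_rootPt_zero (k : ℕ) (u : ℝ) : IsPosReal (rootPt k u 0) := by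
  rw [rootPt_eq, zero_div, Complex.ofReal_zero, zero_mul, Complex.exp_zero, mul_one]
  exact ⟨by rw [Complex.ofReal_re]; exact Real.exp_pos _, Complex.ofReal_im _⟩

lemma rootPt_eq_of_arg_eq {k : ℕ} (hk : k ≠ 0) {u τ : ℝ} {z : ℂ} (hz : z ≠ 0)
    (h : arg z = arg (rootPt k u τ)) : z = rootPt k (k * Real.log ‖z‖) τ := by
  have hk0 : (k : ℝ) ≠ 0 := by exact_mod_cast hk
  have h1 := Complex.norm_mul_exp_arg_mul_I (rootPt k u τ)
  rw [norm_rootPt, rootPt_eq k u τ] at h1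
  have h2 := mul_left_cancel₀ (show ((Real.exp (u / k) : ℝ) : ℂ) ≠ 0 by
    exact_mod_cast Real.exp_ne_zero _) h1
  rw [rootPt_eq, mul_div_cancel_left₀ _ hk0, Real.exp_log (norm_pos_iff.2 hz), ← h2,
    ← rootPt_eq, ← h, Complex.norm_mul_exp_arg_mul_I]

namespace PFData

variable {ι₁ ι₂ : Type*} (P : PFData ι₁ ι₂) {L : ℝ} {k : ℕ} {p : ℤ}

/-- The phases of level points lying below the points at which `rootF` takes the value
`L exp (i (N + x) π / k)`. -/
def IsTarget (k : ℕ) (N : ℤ) (x y : ℝ) : Prop :=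
  ∃ (ε : ℝ) (M : ℤ), (ε = 1 ∨ ε = -1) ∧ ε * y = (M + x) * (Real.pi / k) ∧ M ≡ N [ZMOD 2]

lemma modEq_of_rotation {M N j n : ℤ} (h : 2 * p * j + M = N + 2 * k * n) : M ≡ N [ZMOD 2] := by
  rw [Int.modEq_iff_dvd]
  exact ⟨p * j - k * n, by linarith⟩

/-- No level point has phase below cπ, so T is the least target phase that can occur. It is attained
no later than any other target, and monotonicity of the phase makes its first occurrence the
innermost target. -/
lemma exists_first_target (hL : 0 < L) {tgt : ℝ → Prop} {T : ℝ}
    (hex : ∃ u φ, P.Level L u φ ∧ tgt (P.phase u φ)) (hT₀ : P.c * Real.pi ≤ T)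
    (hT : ∀ y, tgt y → P.c * Real.pi ≤ y → T ≤ y) :
    ∃ u₁ u₀ φ₀, P.Level L u₁ Real.pi ∧ u₁ ≤ u₀ ∧ P.Level L u₀ φ₀ ∧ P.phase u₀ φ₀ = T ∧
      (∀ u φ, P.Level L u φ → tgt (P.phase u φ) → u₀ ≤ u) ∧
      ∀ u φ, u₁ ≤ u → u < u₀ → P.Level L u φ → P.phase u φ ≠ T := by
  obtain ⟨u, φ, hl, ht⟩ := hex
  obtain ⟨u₁, h₁, hmin, hs⟩ := P.exists_start hL hl
  have hp₁ := P.phase_pi_eq hs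
  have hge : ∀ u φ, P.Level L u φ → P.c * Real.pi ≤ P.phase u φ := fun u φ h =>
    hp₁ ▸ h₁.phase_le hL h (hmin u φ h)
  obtain ⟨u₀, φ₀, h2, h3, h4, h5, h6⟩ := P.exists_first_level hL h₁ hl (hmin u φ hl)
    (by rw [hp₁]; exact hT₀) (hT _ ht (hge u φ hl))
  refine ⟨u₁, u₀, φ₀, h₁, h2, h4, h5, fun u' φ' hl' ht' => ?_, h6⟩
  by_contra hlt
  rw [not_le] at hlt
  refine h6 u' φ' (hmin _ _ hl') hlt hl' (le_antisymm ?_ (hT _ ht' (hge _ _ hl')))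
  rw [← h5]
  exact hl'.phase_le hL h4 hlt.le

/-- Two points on a ray at which `rootF` takes the same value are separated by a third one, of
intermediate modulus. -/
lemma exists_between_of_arg_eq (hk : 2 ≤ k) (hpk : Nat.gcd p.natAbs k = 1)
    (hc : P.c = p / k) (hL : 0 < L) {N M j n : ℤ} {x u₀ φ₀ ε : ℝ} (hlev : P.Level L u₀ φ₀)
    (hε : ε = 1 ∨ ε = -1) (hph : ε * P.phase u₀ φ₀ = (M + x) * (Real.pi / k))
    (hj : 2 * p * j + M = N + 2 * k * n) (h0 : 0 < φ₀)
    (hpi : φ₀ < Real.pi ∨ (φ₀ = Real.pi ∧ P.phase u₀ Real.pi = P.c * Real.pi)) {z : ℂ}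
    (hz : P.rootF k p z = L * exp (((N + x) * (Real.pi / k) : ℝ) * I))
    (harg : arg z = arg (rootPt k u₀ (ε * φ₀ + 2 * Real.pi * j)))
    (hlt : ‖rootPt k u₀ (ε * φ₀ + 2 * Real.pi * j)‖ < ‖z‖) :
    ∃ z', P.rootF k p z' = L * exp (((N + x) * (Real.pi / k) : ℝ) * I) ∧
      ‖rootPt k u₀ (ε * φ₀ + 2 * Real.pi * j)‖ < ‖z'‖ ∧ ‖z'‖ < ‖z‖ := by
  have hk0 : k ≠ 0 := by omega
  have hkR : (2 : ℝ) ≤ k := by exact_mod_cast hk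
  have hkne : (k : ℝ) ≠ 0 := by linarith
  have hπ := Real.pi_pos
  have hz0 : z ≠ 0 := by
    rintro rfl
    rw [norm_zero] at hlt
    exact absurd hlt (not_lt.2 (norm_nonneg _))
  have hzr := rootPt_eq_of_arg_eq hk0 hz0 harg
  set u₁ := k * Real.log ‖z‖
  rw [hzr, rootPt_norm_lt hk0] at hlt
  have hz₀ := P.rootF_eq_of_level hk0 hc hL (x := x) hlev hε hph hj
  rw [hzr] at hz
  have hlev₁ : P.Level L u₁ φ₀ := by
    refine P.level_of_norm_stripF hL hlev.nonneg hlev.le_pi ?_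
    rw [← P.norm_stripF_rep hε j, ← P.rootF_rootPt hk0 hc, hz, norm_mul,
      Complex.norm_exp_ofReal_mul_I, mul_one, Complex.norm_real, Real.norm_of_nonneg hL.le]
  have hexp : exp ((ε * P.phase u₁ φ₀ + 2 * Real.pi * P.c * j : ℝ) * I) =
      exp ((ε * P.phase u₀ φ₀ + 2 * Real.pi * P.c * j : ℝ) * I) := by
    refine mul_left_cancel₀ (show (L : ℂ) ≠ 0 by exact_mod_cast hL.ne') ?_
    rw [← hlev₁.stripF_rep hL hε, ← hlev.stripF_rep hL hε, ← P.rootF_rootPt hk0 hc,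
      ← P.rootF_rootPt hk0 hc, hz, hz₀]
  obtain ⟨l, hl⟩ := Complex.exp_eq_exp_iff_exists_int.1 hexp
  have hl' : ε * P.phase u₁ φ₀ = ε * P.phase u₀ φ₀ + l * (2 * Real.pi) := by
    have := congrArg Complex.im hl
    simp at this
    linarith
  have hmono : P.phase u₀ φ₀ < P.phase u₁ φ₀ := by
    rcases hpi with h1 | ⟨h1, h2⟩
    · exact phase_lt_of_ray hlt h0 h1
    · subst h1
      refine lt_of_le_of_ne (P.phase_pi_mono hlt.le) fun h3 => ?_
      exact P.not_two_levels_pi hL hlev hlev₁ hlt (by rw [← h3, h2])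
  -- Equal values on the same ray force phases congruent modulo 2π, and the outer phase is strictly
  -- larger.
  have hstep : P.phase u₀ φ₀ + 2 * Real.pi ≤ P.phase u₁ φ₀ := by
    have key : ∃ l' : ℤ, P.phase u₁ φ₀ - P.phase u₀ φ₀ = l' * (2 * Real.pi) := by
      rcases hε with rfl | rfl
      · exact ⟨l, by linarith⟩
      · exact ⟨-l, by push_cast; linarith⟩
    obtain ⟨l', h⟩ := key
    have h1 : (0 : ℝ) < l' := by
      by_contra h2
      nlinarith [not_lt.1 h2]
    have h2 : 0 < l' := by exact_mod_cast h1
    have h3 : (1 : ℝ) ≤ l' := by exact_mod_cast h2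
    nlinarith
  have hω : 2 * (Real.pi / k) ≤ Real.pi := by
    rw [← mul_div_assoc, div_le_iff₀ (by linarith)]; nlinarith
  have hω0 : 0 < Real.pi / k := by positivity
  -- Raising the phase by 2π/k changes M by ±2 and so keeps its parity. Since k ≥ 2, this phase lies
  -- strictly between the two given ones.
  obtain ⟨u', φ', h1, h2, hlev', hph', -⟩ := P.exists_first_level hL hlev hlev₁ hlt.le
    (T := P.phase u₀ φ₀ + 2 * (Real.pi / k)) (by linarith) (by linarith)
  have hM : ∃ M' : ℤ, M' ≡ N [ZMOD 2] ∧ ε * P.phase u' φ' = (M' + x) * (Real.pi / k) := by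
    have hMN : M ≡ N [ZMOD 2] := modEq_of_rotation hj
    rcases hε with rfl | rfl
    · refine ⟨M + 2, by simpa using hMN, ?_⟩
      rw [hph']; push_cast; linarith
    · refine ⟨M - 2, by simpa using hMN, ?_⟩
      rw [hph']; push_cast; linarith
  obtain ⟨M', hMN', hM'⟩ := hM
  obtain ⟨j', n', hj'⟩ := exists_rotation hpk hMN'
  refine ⟨_, P.rootF_eq_of_level hk0 hc hL hlev' hε hM' hj', ?_, ?_⟩
  · rw [rootPt_norm_lt hk0]
    refine lt_of_le_of_ne h1 ?_
    rintro rfl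
    rw [hlev'.eq_of_eq hL hlev] at hph'
    linarith
  · rw [hzr, rootPt_norm_lt hk0]
    refine lt_of_le_of_ne h2 ?_
    intro h
    rw [h] at hph' hlev'
    rw [hlev'.eq_of_eq hL hlev₁] at hph'
    linarith

/-- Any α-point on the minimal circle lies over the same level point, so uniqueness is only a matter
of signs and rotations, supplied by `huniq`. An α-point next in modulus cannot share the argument,
by `exists_between_of_arg_eq`. -/
lemma isClosestSimple_of_level (hk : 2 ≤ k) (hp : p < 0) (hpk : Nat.gcd p.natAbs k = 1)
    (hc : P.c = p / k) (hL : 0 < L) {N M j n : ℤ} {x u₀ φ₀ ε : ℝ} (hlev : P.Level L u₀ φ₀)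
    (hε : ε = 1 ∨ ε = -1) (hph : ε * P.phase u₀ φ₀ = (M + x) * (Real.pi / k))
    (hj : 2 * p * j + M = N + 2 * k * n) (h0 : 0 < φ₀)
    (hpi : φ₀ < Real.pi ∨ (φ₀ = Real.pi ∧ P.phase u₀ Real.pi = P.c * Real.pi))
    (hmin : ∀ u φ, P.Level L u φ → IsTarget k N x (P.phase u φ) → u₀ ≤ u)
    (huniq : ∀ (ε' : ℝ) (M' j' n' : ℤ), (ε' = 1 ∨ ε' = -1) →
      ε' * P.phase u₀ φ₀ = (M' + x) * (Real.pi / k) → 2 * p * j' + M' = N + 2 * k * n' →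
      rootPt k u₀ (ε' * φ₀ + 2 * Real.pi * j') = rootPt k u₀ (ε * φ₀ + 2 * Real.pi * j))
    (hD : P.dlogF (exp (logPt u₀ (ε * φ₀))) ≠ 0) :
    IsClosestSimple (P.rootF k p) (L * exp (((N + x) * (Real.pi / k) : ℝ) * I))
      (rootPt k u₀ (ε * φ₀ + 2 * Real.pi * j)) := by
  have hk0 : k ≠ 0 := by omega
  have hα : (L : ℂ) * exp (((N + x) * (Real.pi / k) : ℝ) * I) ≠ 0 :=
    mul_ne_zero (by exact_mod_cast hL.ne') (exp_ne_zero _)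
  have hz₀ := P.rootF_eq_of_level hk0 hc hL (x := x) hlev hε hph hj
  have hfar : ∀ z : ℂ, P.rootF k p z = L * exp (((N + x) * (Real.pi / k) : ℝ) * I) →
      z ≠ rootPt k u₀ (ε * φ₀ + 2 * Real.pi * j) →
      ‖rootPt k u₀ (ε * φ₀ + 2 * Real.pi * j)‖ < ‖z‖ := by
    intro z hz hne
    obtain ⟨u, φ, ε', j', M', n', hl, hε', rfl, hph', hj'⟩ :=
      P.exists_level_of_rootF_eq hk0 hp hc hL hz
    rw [rootPt_norm_lt hk0]
    refine lt_of_le_of_ne (hmin u φ hl ⟨ε', M', hε', hph', modEq_of_rotation hj'⟩) ?_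
    rintro rfl
    rw [hl.eq_of_eq hL hlev] at hph' hne
    exact hne (huniq ε' M' j' n' hε' hph' hj')
  refine ⟨hz₀, ?_, hfar, fun z₁ hz₁ hne hleast harg => ?_⟩
  · refine P.hasMultiplicity_one hc hk0 hp (by rw [hz₀]; exact hα) ?_
    rwa [rootPt_pow hk0, exp_logPt_add]
  · obtain ⟨z', h1, h2, h3⟩ := P.exists_between_of_arg_eq hk hpk hc hL hlev hε hph hj h0 hpi hz₁
      harg (hfar z₁ hz₁ hne)
    exact absurd (hleast z' h1 fun h => by rw [h] at h2; exact lt_irrefl _ h2) (not_le.2 h3)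

lemma exp_logPt_im_ne_zero {u φ ε : ℝ} (h0 : 0 < φ) (h1 : φ < Real.pi) (hε : ε = 1 ∨ ε = -1) :
    (exp (logPt u (ε * φ))).im ≠ 0 := by
  have h := (exp_im_pos_of_strip (ζ := logPt u φ) (by simpa using h0) (by simpa using h1)).ne'
  rcases hε with rfl | rfl
  · rwa [one_mul]
  · rwa [neg_one_mul, logPt_neg, Complex.exp_conj, Complex.conj_im, neg_ne_zero]

lemma c_mul_pi (hc : P.c = p / k) : P.c * Real.pi = p * (Real.pi / k) := by
  rw [hc]; ring

lemma exists_target (hk : k ≠ 0) (hp : p < 0) (hc : P.c = p / k) (hL : 0 < L) {N : ℤ} {x : ℝ}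
    (hne : ∃ z, P.rootF k p z = L * exp (((N + x) * (Real.pi / k) : ℝ) * I)) :
    ∃ u φ, P.Level L u φ ∧ IsTarget k N x (P.phase u φ) := by
  obtain ⟨z, hz⟩ := hne
  obtain ⟨u, φ, ε, j, M, n, hl, hε, -, hph, hj⟩ := P.exists_level_of_rootF_eq hk hp hc hL hz
  exact ⟨u, φ, hl, ε, M, hε, hph, modEq_of_rotation hj⟩

/-- On φ = π the phase lies in pπ/k + πℤ. A value above pπ/k exceeds it by at least π, which is more
than π/k since k ≥ 2. -/
lemma phase_pi_ne (hk : 2 ≤ k) (hc : P.c = p / k) (hL : 0 < L) {u T : ℝ}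
    (h : P.Level L u Real.pi) (hT : P.phase u Real.pi = T) (h0 : p * (Real.pi / k) < T)
    (h1 : T ≤ (p + 1) * (Real.pi / k)) : False := by
  have hkR : (2 : ℝ) ≤ k := by exact_mod_cast hk
  have hω0 : 0 < Real.pi / k := div_pos Real.pi_pos (by linarith)
  have hπ : Real.pi = k * (Real.pi / k) := by field_simp
  obtain ⟨n, hn⟩ := P.phase_pi_int (h.num_ne_zero hL)
  rw [hT, P.c_mul_pi hc] at hn
  have h2 : (0 : ℝ) < n := by
    by_contra h3
    nlinarith [not_lt.1 h3, Real.pi_pos]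
  have h3 : 0 < n := by exact_mod_cast h2
  have h4 : (1 : ℝ) ≤ n := by exact_mod_cast h3
  nlinarith [Real.pi_pos]

/-- The closest point lies in the interior of a sector. -/
lemma exists_closest_interior (hk : 2 ≤ k) (hp : p < 0) (hpk : Nat.gcd p.natAbs k = 1)
    (hc : P.c = p / k) (hL : 0 < L) {N M₀ : ℤ} {x T ε₀ : ℝ}
    (hne : ∃ z, P.rootF k p z = L * exp (((N + x) * (Real.pi / k) : ℝ) * I))
    (hε₀ : ε₀ = 1 ∨ ε₀ = -1) (hT₀ : p * (Real.pi / k) < T) (hT₁ : T < (p + 1) * (Real.pi / k))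
    (hM₀ : ε₀ * T = (M₀ + x) * (Real.pi / k))
    (hT : ∀ y, IsTarget k N x y → p * (Real.pi / k) ≤ y → T ≤ y)
    (huniq : ∀ (ε' : ℝ) (M' : ℤ), (ε' = 1 ∨ ε' = -1) → ε' * T = (M' + x) * (Real.pi / k) →
      M' ≡ N [ZMOD 2] → ε' = ε₀ ∧ M' = M₀) :
    ∃ u₀ φ₀, 0 < φ₀ ∧ φ₀ < Real.pi ∧ ∀ j n : ℤ, 2 * p * j + M₀ = N + 2 * k * n →
      IsClosestSimple (P.rootF k p) (L * exp (((N + x) * (Real.pi / k) : ℝ) * I))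
        (rootPt k u₀ (ε₀ * φ₀ + 2 * Real.pi * j)) := by
  have hk0 : k ≠ 0 := by omega
  have hkR : (2 : ℝ) ≤ k := by exact_mod_cast hk
  have hω0 : 0 < Real.pi / k := div_pos Real.pi_pos (by linarith)
  obtain ⟨u₁, u₀, φ₀, -, -, hlev, hph, hmin, -⟩ := P.exists_first_target hL
    (T := T) (P.exists_target hk0 hp hc hL hne) (by rw [P.c_mul_pi hc]; exact hT₀.le)
    (by rw [P.c_mul_pi hc]; exact hT)
  have hp1 : (p : ℝ) + 1 ≤ 0 := by exact_mod_cast Int.add_one_le_iff.2 hp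
  have h0 : 0 < φ₀ := by
    refine lt_of_le_of_ne hlev.nonneg ?_
    rintro rfl
    have := P.phase_zero_nonneg u₀
    nlinarith
  have h1 : φ₀ < Real.pi := by
    refine lt_of_le_of_ne hlev.le_pi ?_
    rintro rfl
    exact P.phase_pi_ne hk hc hL hlev hph hT₀ hT₁.le
  refine ⟨u₀, φ₀, h0, h1, fun j n hj => ?_⟩
  refine P.isClosestSimple_of_level hk hp hpk hc hL hlev hε₀ (by rw [hph]; exact hM₀) hj h0
    (Or.inl h1) hmin (fun ε' M' j' n' hε' hph' hj' => ?_) ?_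
  · rw [hph] at hph'
    obtain ⟨rfl, rfl⟩ := huniq ε' M' hε' hph' (modEq_of_rotation hj')
    exact rootPt_rotation_eq hk0 hpk hj hj' _ _
  · intro h
    have := P.dlogF_im_ne_zero (exp_logPt_im_ne_zero (u := u₀) h0 h1 hε₀)
    rw [h] at this
    exact this rfl

lemma closest_of_mem_sector (hk : 2 ≤ k) (hp : p < 0) (hpk : Nat.gcd p.natAbs k = 1)
    (hc : P.c = p / k) (hL : 0 < L) {N : ℤ} {x : ℝ} (hx0 : 0 < x) (hx1 : x < 1)
    (hne : ∃ z, P.rootF k p z = L * exp (((N + x) * (Real.pi / k) : ℝ) * I)) :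
    ∃ z₀, IsClosestSimple (P.rootF k p) (L * exp (((N + x) * (Real.pi / k) : ℝ) * I)) z₀ ∧
      (p ≡ N [ZMOD 2] → ∀ m n : ℤ, 2 * p * m + p = N + 2 * k * n → z₀ ∈ sectorQ k (2 * m)) ∧
      (¬ p ≡ N [ZMOD 2] → ∀ m n : ℤ, 2 * p * m - (p + 1) = N + 2 * k * n →
        z₀ ∈ sectorQ k (2 * m - 1)) := by
  have hk0 : k ≠ 0 := by omega
  have hkR : (2 : ℝ) ≤ k := by exact_mod_cast hk
  have hω0 : 0 < Real.pi / k := div_pos Real.pi_pos (by linarith)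
  by_cases hpN : p ≡ N [ZMOD 2]
  -- With ε = 1 the least admissible M is p. With ε = -1 the phase is (-M - x)π/k, where -M > p and
  -- parity gives -M ≥ p + 2, which is larger.
  · obtain ⟨u₀, φ₀, h0, h1, hcl⟩ := P.exists_closest_interior hk hp hpk hc hL (M₀ := p) (ε₀ := 1)
      (T := (p + x) * (Real.pi / k)) hne (Or.inl rfl) (by nlinarith) (by nlinarith)
      (by rw [one_mul])
      (by
        rintro y ⟨ε, M, rfl | rfl, hy, hM⟩ hy0
        · rw [one_mul] at hy
          rw [hy] at hy0 ⊢
          have h1 : (p : ℝ) ≤ M + x := le_of_mul_le_mul_right hy0 hω0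
          have h2 : p ≤ M := by
            have : (p : ℝ) < M + 1 := by linarith
            exact Int.lt_add_one_iff.1 (by exact_mod_cast this)
          have h3 : (p : ℝ) ≤ M := by exact_mod_cast h2
          gcongr
        · have hy' : y = (-M - x) * (Real.pi / k) := by linarith
          rw [hy'] at hy0 ⊢
          have h1 : (p : ℝ) ≤ -M - x := le_of_mul_le_mul_right hy0 hω0
          have h2 : p < -M := by
            have : (p : ℝ) < -M := by linarith
            exact_mod_cast this
          have h3 : p + 2 ≤ -M := by
            have : p % 2 = M % 2 := hpN.trans hM.symm
            omega
          have h4 : (p : ℝ) + 2 ≤ -M := by exact_mod_cast h3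
          exact mul_le_mul_of_nonneg_right (by linarith) hω0.le)
      (by
        rintro ε' M' (rfl | rfl) h hM
        · rw [one_mul] at h
          have h1 : (p : ℝ) + x = M' + x := mul_right_cancel₀ hω0.ne' h
          refine ⟨rfl, ?_⟩
          have : (M' : ℝ) = p := by linarith
          exact_mod_cast this
        · exfalso
          have h1 : -((p : ℝ) + x) = M' + x := by
            apply mul_right_cancel₀ hω0.ne'
            linarith
          have h2 : 0 < -M' - p := by
            have : (0 : ℝ) < -M' - p := by linarith
            exact_mod_cast this
          have h3 : -M' - p < 2 := by
            have : -(M' : ℝ) - p < 2 := by linarith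
            exact_mod_cast this
          have : p % 2 = M' % 2 := hpN.trans hM.symm
          omega)
    obtain ⟨j, n, hj⟩ := exists_rotation hpk hpN
    refine ⟨_, hcl j n hj, fun _ m n' hm => ?_, fun h => absurd hpN h⟩
    rw [← rootPt_rotation_eq hk0 hpk hj hm]
    apply rootPt_mem_sectorQ hk0
    · push_cast; linarith
    · push_cast; linarith
  -- Parity now excludes M = p for ε = 1, so the least phase comes from ε = -1 with M = -(p + 1);
  -- the closest point is obtained by reflection and lies in an odd sector.
  · obtain ⟨u₀, φ₀, h0, h1, hcl⟩ := P.exists_closest_interior hk hp hpk hc hL (M₀ := -(p + 1))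
      (ε₀ := -1) (T := (p + 1 - x) * (Real.pi / k)) hne (Or.inr rfl) (by nlinarith) (by nlinarith)
      (by push_cast; ring)
      (by
        rintro y ⟨ε, M, rfl | rfl, hy, hM⟩ hy0
        · rw [one_mul] at hy
          rw [hy] at hy0 ⊢
          have h1 : (p : ℝ) ≤ M + x := le_of_mul_le_mul_right hy0 hω0
          have h2 : p ≤ M := by
            have : (p : ℝ) < M + 1 := by linarith
            exact Int.lt_add_one_iff.1 (by exact_mod_cast this)
          have h3 : p + 1 ≤ M := by
            refine lt_of_le_of_ne h2 ?_
            rintro rfl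
            exact hpN hM
          have h4 : (p : ℝ) + 1 ≤ M := by exact_mod_cast h3
          exact mul_le_mul_of_nonneg_right (by linarith) hω0.le
        · have hy' : y = (-M - x) * (Real.pi / k) := by linarith
          rw [hy'] at hy0 ⊢
          have h1 : (p : ℝ) ≤ -M - x := le_of_mul_le_mul_right hy0 hω0
          have h2 : p < -M := by
            have : (p : ℝ) < -M := by linarith
            exact_mod_cast this
          have h4 : (p : ℝ) + 1 ≤ -M := by exact_mod_cast Int.add_one_le_iff.2 h2
          exact mul_le_mul_of_nonneg_right (by linarith) hω0.le)
      (by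
        rintro ε' M' (rfl | rfl) h hM
        · exfalso
          rw [one_mul] at h
          have h1 : (p : ℝ) + 1 - x = M' + x := mul_right_cancel₀ hω0.ne' h
          have h2 : 0 < p + 1 - M' := by
            have : (0 : ℝ) < p + 1 - M' := by linarith
            exact_mod_cast this
          have h3 : p + 1 - M' < 2 := by
            have : (p : ℝ) + 1 - M' < 2 := by linarith
            exact_mod_cast this
          obtain rfl : M' = p := by omega
          exact hpN hM
        · have h1 : -((p : ℝ) + 1 - x) = M' + x := by
            apply mul_right_cancel₀ hω0.ne'
            linarith
          refine ⟨rfl, ?_⟩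
          have : (M' : ℝ) = -(p + 1) := by linarith
          exact_mod_cast this)
    have hpN' : -(p + 1) ≡ N [ZMOD 2] := by
      simp only [Int.ModEq] at hpN ⊢
      omega
    obtain ⟨j, n, hj⟩ := exists_rotation hpk hpN'
    refine ⟨_, hcl j n hj, fun h => absurd h hpN, fun _ m n' hm => ?_⟩
    rw [← rootPt_rotation_eq hk0 hpk hj (j' := m) (n' := n') (by linarith)]
    apply rootPt_mem_sectorQ hk0
    · push_cast; linarith
    · push_cast; linarith

lemma closest_of_ray (hk : 2 ≤ k) (hp : p < 0) (hpk : Nat.gcd p.natAbs k = 1)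
    (hc : P.c = p / k) (hL : 0 < L) {N : ℤ} (hpN : p ≡ N [ZMOD 2])
    (hne : ∃ z, P.rootF k p z = L * exp (((N + 0) * (Real.pi / k) : ℝ) * I)) :
    ∃ z₀, IsClosestSimple (P.rootF k p) (L * exp (((N + 0) * (Real.pi / k) : ℝ) * I)) z₀ ∧
      ∀ m n : ℤ, 2 * p * m - p = N + 2 * k * n → IsPosReal (z₀ * eRot k (-(2 * m) + 1)) := by
  have hk0 : k ≠ 0 := by omega
  obtain ⟨u, φ, hl, -⟩ := P.exists_target hk0 hp hc hL hne
  obtain ⟨u₁, h₁, hmin, hs⟩ := P.exists_start hL hl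
  have hp₁ := P.phase_pi_eq hs
  have hp₂ : (1 : ℝ) * P.phase u₁ Real.pi = ((p : ℝ) + 0) * (Real.pi / k) := by
    rw [hp₁, P.c_mul_pi hc]; ring
  have hkR : (2 : ℝ) ≤ k := by exact_mod_cast hk
  have hω0 : 0 < Real.pi / k := div_pos Real.pi_pos (by linarith)
  obtain ⟨j, n, hj⟩ := exists_rotation hpk hpN
  refine ⟨_, P.isClosestSimple_of_level hk hp hpk hc hL h₁ (Or.inl rfl) hp₂ hj Real.pi_pos
    (Or.inr ⟨rfl, hp₁⟩) (fun u φ h _ => hmin u φ h) ?_ ?_, ?_⟩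
  · rintro ε' M' j' n' (rfl | rfl) hph' hj'
    · rw [hp₂] at hph'
      have h1 : (p : ℝ) + 0 = M' + 0 := mul_right_cancel₀ hω0.ne' hph'
      have h2 : p = M' := by
        have : (p : ℝ) = M' := by linarith
        exact_mod_cast this
      rw [← h2] at hj'
      exact rootPt_rotation_eq hk0 hpk hj hj' _ _
    -- On φ = π the two signs give the same point, since -π and π differ by one turn; hence the
    -- shift of j' by 1.
    · have h1 : -((p : ℝ) + 0) = M' + 0 := by
        apply mul_right_cancel₀ hω0.ne'
        linarith
      have h2 : M' = -p := by
        have : (M' : ℝ) = -p := by linarith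
        exact_mod_cast this
      rw [h2] at hj'
      rw [← rootPt_rotation_eq hk0 hpk hj (j' := j' - 1) (n' := n') (by linarith)]
      congr 1
      push_cast; ring
  · rw [one_mul, exp_logPt_pi, dlogF_ofReal]
    exact_mod_cast (P.dlogR_neg (Real.exp_pos u₁) hs).ne
  · intro m n' hm
    rw [← rootPt_rotation_eq hk0 hpk hj (j' := m - 1) (n' := n') (by linarith), rootPt_mul_eRot]
    convert isPosReal_rootPt_zero k u₁ using 2
    push_cast; ring

/-- The least admissible phase (p + 1)π/k is reached with both signs. Off the real axis these give
two distinct simple points of equal modulus; on φ = 0 they coincide, and the second zero comes from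
the ray itself. -/
lemma closestPair (hk : 2 ≤ k) (hp : p < 0) (hpk : Nat.gcd p.natAbs k = 1)
    (hc : P.c = p / k) (hL : 0 < L) {N : ℤ} (hpN : ¬ p ≡ N [ZMOD 2])
    (hne : ∃ z, P.rootF k p z = L * exp (((N + 0) * (Real.pi / k) : ℝ) * I)) :
    ∃ z₀ z₁, IsClosestPair (P.rootF k p) (L * exp (((N + 0) * (Real.pi / k) : ℝ) * I)) z₀ z₁ ∧
      (‖z₀‖ = ‖z₁‖ ∨ z₀.arg = z₁.arg) ∧
      ∀ m n : ℤ, 2 * p * m + (p + 1) = N + 2 * k * n →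
        (z₀.arg = z₁.arg →
          p = -1 ∧ IsPosReal (z₀ * eRot k (-(2 * m))) ∧ IsPosReal (z₁ * eRot k (-(2 * m)))) ∧
        (z₀ ≠ z₁ → ‖z₀‖ = ‖z₁‖ → ∀ s l : ℤ, N + p * s = k * l →
          z₀ ∈ sectorQ k (2 * m) ∧ z₁ ∈ sectorQ k (-(2 * s) - 2 * m - 1)) := by
  have hk0 : k ≠ 0 := by omega
  have hkR : (2 : ℝ) ≤ k := by exact_mod_cast hk
  have hω0 : 0 < Real.pi / k := div_pos Real.pi_pos (by linarith)
  have hα : (L : ℂ) * exp (((N + 0) * (Real.pi / k) : ℝ) * I) ≠ 0 :=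
    mul_ne_zero (by exact_mod_cast hL.ne') (exp_ne_zero _)
  have hp1 : (p : ℝ) + 1 ≤ 0 := by exact_mod_cast Int.add_one_le_iff.2 hp
  obtain ⟨u₁, u₀, φ₀, h₁, hu, hlev, hph, hmin, hfirst⟩ := P.exists_first_target hL
    (T := (p + 1) * (Real.pi / k))
    (P.exists_target hk0 hp hc hL hne) (by rw [P.c_mul_pi hc]; nlinarith)
    (by
      rw [P.c_mul_pi hc]
      rintro y ⟨ε, M, hε, hy, hM⟩ hy0
      have key : ∃ M' : ℤ, y = M' * (Real.pi / k) ∧ M' ≠ p := by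
        rcases hε with rfl | rfl
        · refine ⟨M, by linarith, ?_⟩
          rintro rfl
          exact hpN hM
        · refine ⟨-M, by push_cast; linarith, ?_⟩
          rintro rfl
          apply hpN
          simp only [Int.ModEq] at hM ⊢
          omega
      obtain ⟨M', rfl, hM'⟩ := key
      have h1 : (p : ℝ) ≤ M' := le_of_mul_le_mul_right hy0 hω0
      have h2 : p < M' := lt_of_le_of_ne (by exact_mod_cast h1) (Ne.symm hM')
      have h3 : (p : ℝ) + 1 ≤ M' := by exact_mod_cast Int.add_one_le_iff.2 h2
      gcongr)
  have hpar : p + 1 ≡ N [ZMOD 2] := by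
    simp only [Int.ModEq] at hpN ⊢
    omega
  have hpar' : -(p + 1) ≡ N [ZMOD 2] := by
    simp only [Int.ModEq] at hpN ⊢
    omega
  obtain ⟨j, n, hj⟩ := exists_rotation hpk hpar
  obtain ⟨j', n', hj'⟩ := exists_rotation hpk hpar'
  have h1 : φ₀ < Real.pi := by
    refine lt_of_le_of_ne hlev.le_pi ?_
    rintro rfl
    exact P.phase_pi_ne hk hc hL hlev hph (by nlinarith) le_rfl
  have hφ₁ : (1 : ℝ) * P.phase u₀ φ₀ = ((p + 1 : ℤ) + 0) * (Real.pi / k) := by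
    rw [hph]; push_cast; ring
  have hφ₂ : (-1 : ℝ) * P.phase u₀ φ₀ = ((-(p + 1) : ℤ) + 0) * (Real.pi / k) := by
    rw [hph]; push_cast; ring
  have hcase : ∀ {ε : ℝ} {M : ℤ}, (ε = 1 ∨ ε = -1) →
      ε * P.phase u₀ φ₀ = (M + 0) * (Real.pi / k) → (ε = 1 ∧ M = p + 1) ∨
        (ε = -1 ∧ M = -(p + 1)) := by
    rintro ε M (rfl | rfl) h
    · rw [hφ₁] at h
      have := mul_right_cancel₀ hω0.ne' h
      refine Or.inl ⟨rfl, ?_⟩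
      have : (M : ℝ) = (p + 1 : ℤ) := by linarith
      exact_mod_cast this
    · rw [hφ₂] at h
      have := mul_right_cancel₀ hω0.ne' h
      refine Or.inr ⟨rfl, ?_⟩
      have : (M : ℝ) = (-(p + 1) : ℤ) := by linarith
      exact_mod_cast this
  have hzα := P.rootF_eq_of_level hk0 hc hL (x := 0) hlev (Or.inl rfl) hφ₁ hj
  rcases hlev.nonneg.eq_or_lt with h0 | h0
  · subst h0
    -- The phase on the positive ray is nonnegative, so p + 1 ≥ 0.
    have hp' : p = -1 := by
      have h2 := P.phase_zero_nonneg u₀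
      rw [hph] at h2
      have h3 : (0 : ℝ) ≤ p + 1 := nonneg_of_mul_nonneg_left h2 hω0
      have h4 : 0 ≤ p + 1 := by exact_mod_cast h3
      omega
    have hph0 : P.phase u₀ 0 = 0 := by rw [hph, hp']; norm_num
    have hno := P.lt_one_of_phase_zero hlev.den_ne_zero hph0
    have hD0 := P.dlogR_nonpos_of_first hL h₁ hlev hu hph0
      (fun u' φ' h2 h3 h4 => by
        have := hfirst u' φ' h2 h3 h4
        rw [← hph, hph0] at this
        exact this)
    have hc1 : -1 < P.c := by
      rw [hc, hp', lt_div_iff₀ (by linarith)]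
      push_cast
      linarith
    have hpow : ∀ v τ : ℝ, τ = 1 * 0 + 2 * Real.pi * j →
        rootPt k v τ ^ k = ((Real.exp v : ℝ) : ℂ) := by
      rintro v τ rfl
      rw [rootPt_pow hk0, exp_logPt_add, one_mul, exp_logPt_zero]
    have hray : ∀ v, ∀ m n : ℤ, 2 * p * m + (p + 1) = N + 2 * k * n →
        IsPosReal (rootPt k v (1 * 0 + 2 * Real.pi * j) * eRot k (-(2 * m))) := by
      intro v m n' hm
      rw [← rootPt_rotation_eq hk0 hpk hj hm, rootPt_mul_eRot]
      convert isPosReal_rootPt_zero k v using 2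
      push_cast; ring
    have hsame : ∀ v, ∀ (ε : ℝ) (j₂ M n₂ : ℤ), P.phase v 0 = 0 → (ε = 1 ∨ ε = -1) →
        ε * P.phase v 0 = (M + 0) * (Real.pi / k) → 2 * p * j₂ + M = N + 2 * k * n₂ →
        rootPt k v (ε * 0 + 2 * Real.pi * j₂) = rootPt k v (1 * 0 + 2 * Real.pi * j) := by
      intro v ε j₂ M n₂ hv hε hM hj₂
      rw [hv, mul_zero] at hM
      have h2 : (M : ℝ) + 0 = 0 := (mul_eq_zero.1 hM.symm).resolve_right hω0.ne'
      have h3 : M = p + 1 := by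
        have : (M : ℝ) = 0 := by linarith
        have : M = 0 := by exact_mod_cast this
        omega
      rw [h3] at hj₂
      rw [mul_zero, mul_zero]
      exact rootPt_rotation_eq hk0 hpk hj hj₂ _ _
    -- A vanishing derivative gives a double zero; a negative one gives a second, outer crossing on
    -- the same ray.
    rcases hD0.eq_or_lt with hD | hD
    · refine ⟨rootPt k u₀ (1 * 0 + 2 * Real.pi * j), rootPt k u₀ (1 * 0 + 2 * Real.pi * j),
        ⟨hzα, hzα, le_rfl, Or.inl ⟨rfl, ?_⟩, fun z hz hz0 _ => ?_⟩, Or.inl rfl, fun m n' hm =>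
          ⟨fun _ => ⟨hp', hray _ m n' hm, hray _ m n' hm⟩, fun h => absurd rfl h⟩⟩
      · exact P.hasMultiplicity_two hc hk0 hp (by rw [hzα]; exact hα) (Real.exp_pos u₀)
          (hpow u₀ _ rfl) hno hD
      · obtain ⟨u, φ, ε, j₂, M, n₂, hl, hε, rfl, hph₂, hj₂⟩ :=
          P.exists_level_of_rootF_eq hk0 hp hc hL hz
        rw [rootPt_norm_lt hk0]
        refine lt_of_le_of_ne (hmin u φ hl ⟨ε, M, hε, hph₂, modEq_of_rotation hj₂⟩) ?_
        rintro rfl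
        rw [hl.eq_of_eq hL hlev] at hph₂ hz0
        exact hz0 (hsame _ ε j₂ M n₂ hph0 hε hph₂ hj₂)
    · obtain ⟨u₃, hlt, hlev₃, hph₃, hD₃, hnone⟩ := P.exists_next_on_ray hL hc1 hlev hph0 hD
      have hφ₃ : (1 : ℝ) * P.phase u₃ 0 = ((p + 1 : ℤ) + 0) * (Real.pi / k) := by
        rw [hph₃, hp']; norm_num
      have hz₃ := P.rootF_eq_of_level hk0 hc hL (x := 0) hlev₃ (Or.inl rfl) hφ₃ hj
      have hn : ‖rootPt k u₀ (1 * 0 + 2 * Real.pi * j)‖ <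
          ‖rootPt k u₃ (1 * 0 + 2 * Real.pi * j)‖ := (rootPt_norm_lt hk0).2 hlt
      have harg : arg (rootPt k u₀ (1 * 0 + 2 * Real.pi * j)) =
          arg (rootPt k u₃ (1 * 0 + 2 * Real.pi * j)) := by
        rw [rootPt_eq, rootPt_eq, Complex.arg_real_mul _ (Real.exp_pos _),
          Complex.arg_real_mul _ (Real.exp_pos _)]
      refine ⟨rootPt k u₀ (1 * 0 + 2 * Real.pi * j), rootPt k u₃ (1 * 0 + 2 * Real.pi * j),
        ⟨hzα, hz₃, hn.le, Or.inr ⟨fun h => ?_, ?_, ?_⟩, fun z hz hz0 hz1 => ?_⟩, Or.inr harg,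
        fun m n' hm => ⟨fun _ => ⟨hp', hray _ m n' hm, hray _ m n' hm⟩,
          fun _ h => absurd h hn.ne⟩⟩
      · rw [h] at hn
        exact lt_irrefl _ hn
      · refine P.hasMultiplicity_one hc hk0 hp (by rw [hzα]; exact hα) ?_
        rw [hpow u₀ _ rfl, dlogF_ofReal]
        exact_mod_cast hD.ne
      · refine P.hasMultiplicity_one hc hk0 hp (by rw [hz₃]; exact hα) ?_
        rw [hpow u₃ _ rfl, dlogF_ofReal]
        exact_mod_cast hD₃.ne'
      · obtain ⟨u, φ, ε, j₂, M, n₂, hl, hε, rfl, hph₂, hj₂⟩ :=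
          P.exists_level_of_rootF_eq hk0 hp hc hL hz
        rw [rootPt_norm_lt hk0]
        have hge : u₀ < u := by
          refine lt_of_le_of_ne (hmin u φ hl ⟨ε, M, hε, hph₂, modEq_of_rotation hj₂⟩) ?_
          rintro rfl
          rw [hl.eq_of_eq hL hlev] at hph₂ hz0
          exact hz0 (hsame _ ε j₂ M n₂ hph0 hε hph₂ hj₂)
        rcases lt_trichotomy u u₃ with h2 | h2 | h2
        · exact absurd hl (hnone u φ hge h2)
        · subst h2
          rw [hl.eq_of_eq hL hlev₃] at hph₂ hz1
          exact absurd (hsame _ ε j₂ M n₂ hph₃ hε hph₂ hj₂) hz1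
        · exact h2
  · have hzα' := P.rootF_eq_of_level hk0 hc hL (x := 0) hlev (Or.inr rfl) hφ₂ hj'
    have hmul : ∀ {ε : ℝ} (i : ℤ), (ε = 1 ∨ ε = -1) →
        P.rootF k p (rootPt k u₀ (ε * φ₀ + 2 * Real.pi * i)) =
          L * exp (((N + 0) * (Real.pi / k) : ℝ) * I) →
        HasMultiplicity (P.rootF k p) (rootPt k u₀ (ε * φ₀ + 2 * Real.pi * i)) 1 := by
      intro ε i hε h
      refine P.hasMultiplicity_one hc hk0 hp (by rw [h]; exact hα) fun h2 => ?_
      rw [rootPt_pow hk0, exp_logPt_add] at h2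
      have := P.dlogF_im_ne_zero (exp_logPt_im_ne_zero (u := u₀) h0 h1 hε)
      rw [h2] at this
      exact this rfl
    have hnorm : ‖rootPt k u₀ (1 * φ₀ + 2 * Real.pi * j)‖ =
        ‖rootPt k u₀ (-1 * φ₀ + 2 * Real.pi * j')‖ := by
      rw [norm_rootPt, norm_rootPt]
    have hdist : rootPt k u₀ (1 * φ₀ + 2 * Real.pi * j) ≠
        rootPt k u₀ (-1 * φ₀ + 2 * Real.pi * j') := by
      intro h
      have h2 := congrArg (fun z => (z ^ k).im) h
      simp only [rootPt_pow hk0, exp_logPt_add] at h2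
      rw [one_mul, neg_one_mul, logPt_neg, Complex.exp_conj, Complex.conj_im] at h2
      have := exp_im_pos_of_strip (ζ := logPt u₀ φ₀) (by simpa using h0) (by simpa using h1)
      linarith
    refine ⟨rootPt k u₀ (1 * φ₀ + 2 * Real.pi * j), rootPt k u₀ (-1 * φ₀ + 2 * Real.pi * j'),
      ⟨hzα, hzα', hnorm.le, Or.inr ⟨hdist, hmul j (Or.inl rfl) hzα, hmul j' (Or.inr rfl) hzα'⟩,
        fun z hz hz0 hz1 => ?_⟩, Or.inl hnorm, fun m n₂ hm => ⟨fun h => ?_, fun _ _ s l hs => ?_⟩⟩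
    · obtain ⟨u, φ, ε, j₂, M, n₂, hl, hε, rfl, hph₂, hj₂⟩ :=
        P.exists_level_of_rootF_eq hk0 hp hc hL hz
      rw [rootPt_norm_lt hk0]
      refine lt_of_le_of_ne (hmin u φ hl ⟨ε, M, hε, hph₂, modEq_of_rotation hj₂⟩) ?_
      rintro rfl
      rw [hl.eq_of_eq hL hlev] at hph₂ hz0 hz1
      rcases hcase hε hph₂ with ⟨rfl, rfl⟩ | ⟨rfl, rfl⟩
      · exact hz0 (rootPt_rotation_eq hk0 hpk hj hj₂ _ _)
      · exact hz1 (rootPt_rotation_eq hk0 hpk hj' hj₂ _ _)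
    -- Equal argument together with equal modulus would identify the two points.
    · exact absurd (Complex.ext_norm_arg hnorm h) hdist
    · constructor
      · rw [← rootPt_rotation_eq hk0 hpk hj hm]
        apply rootPt_mem_sectorQ hk0
        · push_cast; linarith
        · push_cast; linarith
      -- Reversing the sign in the equation for m turns N into -N, and N + ps = kl turns it back;
      -- this yields the rotation index -s - m.
      · rw [← rootPt_rotation_eq hk0 hpk hj' (j' := -s - m) (n' := -n₂ - l) (by
          linear_combination -hm - 2 * hs)]
        apply rootPt_mem_sectorQ hk0
        · push_cast; linarith
        · push_cast; linarith

end PFData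


/-! ### Translation to F and arithmetic of the sector indices -/

/-- The data of `merF`. -/
def merData {ι₁ ι₂ : Type*} {k : ℕ} (hk : 2 ≤ k) {p : ℤ} (hp : p < 0) {A : ℝ} (hA : 0 ≤ A)
    {a : ι₁ → ℝ} (ha : ∀ ν, 0 < a ν) (hasum : Summable fun ν => 1 / a ν)
    {b : ι₂ → ℝ} (hb : ∀ μ, 0 < b μ) (hbsum : Summable fun μ => 1 / b μ)
    (hF : merF k p A a b ≠ fun z : ℂ => z ^ p) : PFData ι₁ ι₂ where
  A := A
  c := p / k
  s := fun ν => 1 / a ν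
  t := fun μ => 1 / b μ
  A_nonneg := hA
  c_neg := div_neg_of_neg_of_pos (by exact_mod_cast hp) (by
    have : 0 < k := by omega
    exact_mod_cast this)
  s_pos := fun ν => one_div_pos.2 (ha ν)
  t_pos := fun μ => one_div_pos.2 (hb μ)
  s_sum := hasum
  t_sum := hbsum
  nontrivial := by
    by_contra h
    rw [not_or, not_or, not_nonempty_iff, not_nonempty_iff] at h
    obtain ⟨h1, h2, h3⟩ := h
    have h4 : A = 0 := le_antisymm (not_lt.1 h1) hA
    apply hF
    funext z
    simp [merF, h4]

lemma merF_eq_rootF {ι₁ ι₂ : Type*} {k : ℕ} (hk : 2 ≤ k) {p : ℤ} (hp : p < 0) {A : ℝ} (hA : 0 ≤ A)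
    {a : ι₁ → ℝ} (ha : ∀ ν, 0 < a ν) (hasum : Summable fun ν => 1 / a ν)
    {b : ι₂ → ℝ} (hb : ∀ μ, 0 < b μ) (hbsum : Summable fun μ => 1 / b μ)
    (hF : merF k p A a b ≠ fun z : ℂ => z ^ p) :
    merF k p A a b = (merData hk hp hA ha hasum hb hbsum hF).rootF k p := by
  funext z
  have h1 : ∀ ν, 1 + z ^ k / (a ν : ℂ) = 1 + z ^ k * ((1 / a ν : ℝ) : ℂ) := fun ν => by
    push_cast; ring
  have h2 : ∀ μ, 1 - z ^ k / (b μ : ℂ) = 1 + z ^ k * ((-(1 / b μ) : ℝ) : ℂ) := fun μ => by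
    push_cast; ring
  simp only [merF, h1, h2, PFData.rootF, PFData.num, PFData.den, linProd, merData]
  ring

/-- This yields α = L exp(i(N + x)π/k) with x the relative position of α in its sector: 0 < x < 1
inside and x = 0 on the initial ray. -/
lemma eq_norm_mul_exp_of_arg_eRot {k : ℕ} (hk : k ≠ 0) {z : ℂ} {s : ℤ} :
    z = ‖z‖ * exp (((s + arg (z * eRot k (-s)) / (Real.pi / k)) * (Real.pi / k) : ℝ) * I) := by
  have hk0 : (k : ℂ) ≠ 0 := by exact_mod_cast hk
  have hkR : (k : ℝ) ≠ 0 := by exact_mod_cast hk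
  have hπ := Real.pi_pos.ne'
  have hn : ‖eRot k (-s)‖ = 1 := by
    have : Complex.I * (((-s : ℤ) : ℂ) / (k : ℂ)) * (Real.pi : ℂ) =
        ((-s / k * Real.pi : ℝ) : ℂ) * I := by push_cast; ring
    rw [eRot, this, Complex.norm_exp_ofReal_mul_I]
  have h1 := Complex.norm_mul_exp_arg_mul_I (z * eRot k (-s))
  rw [norm_mul, hn, mul_one] at h1
  have h2 : z = z * eRot k (-s) * eRot k s := by
    rw [eRot, eRot, mul_assoc, ← exp_add]
    have : Complex.I * (((-s : ℤ) : ℂ) / (k : ℂ)) * (Real.pi : ℂ) +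
        Complex.I * ((s : ℂ) / (k : ℂ)) * (Real.pi : ℂ) = 0 := by push_cast; ring
    rw [this, exp_zero, mul_one]
  conv_lhs =>
    rw [h2, ← h1, show eRot k s = exp (Complex.I * ((s : ℂ) / (k : ℂ)) * (Real.pi : ℂ)) from rfl,
      mul_assoc, ← exp_add]
  congr 2
  have e : (s + arg (z * eRot k (-s)) / (Real.pi / k)) * (Real.pi / k) =
      s * (Real.pi / k) + arg (z * eRot k (-s)) := by
    field_simp
  rw [e]
  push_cast
  ring

lemma arg_eq_zero_of_isPosReal {w : ℂ} (h : IsPosReal w) : arg w = 0 :=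
  Complex.arg_eq_zero_iff.2 ⟨h.1.le, h.2⟩

lemma exists_int_of_im_eq_zero {k : ℕ} (hk : k ≠ 0) {L : ℝ} (hL : 0 < L) {N m : ℤ}
    (h : ((L : ℂ) * exp (((N + 0) * (Real.pi / k) : ℝ) * I) * eRot k m).im = 0) :
    ∃ l : ℤ, N + m = k * l := by
  have hkR : (k : ℝ) ≠ 0 := by exact_mod_cast hk
  have hπ := Real.pi_pos.ne'
  have e : exp (((N + 0) * (Real.pi / k) : ℝ) * I) * eRot k m =
      exp (((N + m) * (Real.pi / k) : ℝ) * I) := by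
    rw [eRot, ← exp_add]
    congr 1
    push_cast
    ring
  rw [mul_assoc, e, Complex.im_ofReal_mul, Complex.exp_ofReal_mul_I_im] at h
  obtain ⟨l, hl⟩ := Real.sin_eq_zero_iff.1 ((mul_eq_zero.1 h).resolve_left hL.ne')
  refine ⟨l, ?_⟩
  have h2 : ((N : ℝ) + m) = k * l := by
    field_simp at hl
    linarith
  exact_mod_cast h2

lemma ceil_half_of_even (r : ℤ) : ⌈((2 * r : ℤ) : ℝ) / 2⌉ = r := by
  rw [Int.ceil_eq_iff]; push_cast; constructor <;> linarith

lemma ceil_half_of_odd (r : ℤ) : ⌈((2 * r + 1 : ℤ) : ℝ) / 2⌉ = r + 1 := by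
  rw [Int.ceil_eq_iff]; push_cast; constructor <;> linarith

theorem mainTheorem7 {ι₁ ι₂ : Type*} (k : ℕ) (hk : 2 ≤ k) (p : ℤ) (hp : p < 0)
    (hpk : Nat.gcd p.natAbs k = 1)
    (A : ℝ) (hA : 0 ≤ A)
    (a : ι₁ → ℝ) (ha : ∀ ν, 0 < a ν) (hasum : Summable fun ν => 1 / a ν)
    (b : ι₂ → ℝ) (hb : ∀ μ, 0 < b μ) (hbsum : Summable fun μ => 1 / b μ)
    (hF : merF k p A a b ≠ fun z : ℂ => z ^ p)
    (α : ℂ) (hα : α ≠ 0) (hne : ∃ z : ℂ, merF k p A a b z = α)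
    (q : ℤ) (hq0 : 0 ≤ q) (hqk : q < k) (κ : ℕ) (hκ : κ = 0 ∨ κ = 1)
    (hακ : α ∈ sectorQtilde k (2 * q - κ)) :
    (α ∈ sectorQ k (2 * q - κ) →
      ∃ z₀ : ℂ, IsClosestSimple (merF k p A a b) α z₀ ∧
        ∀ σ : ℕ, σ = (if Even p then κ else 1 - κ) →
        ∀ m : ℤ, p * m ≡ q - (-1) ^ σ * ⌈(p : ℝ) / 2⌉ [ZMOD k] →
          z₀ ∈ sectorQ k (2 * m - σ)) ∧
    (IsPosReal (α * eRot k (-(2 * q) + κ)) → p ≡ κ [ZMOD 2] →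
      ∃ z₀ : ℂ, IsClosestSimple (merF k p A a b) α z₀ ∧
        ∀ m : ℤ, p * m ≡ q + ⌈((p : ℝ) - 1) / 2⌉ [ZMOD k] →
          IsPosReal (z₀ * eRot k (-(2 * m) + 1))) ∧
    (IsPosReal (α * eRot k (-(2 * q) + κ)) → ¬ p ≡ κ [ZMOD 2] →
      ∃ z₀ z₁ : ℂ, IsClosestPair (merF k p A a b) α z₀ z₁ ∧
        (‖z₀‖ = ‖z₁‖ ∨ z₀.arg = z₁.arg) ∧
        ∀ m : ℤ, p * m ≡ q - ⌈((p : ℝ) + 1) / 2⌉ [ZMOD k] →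
          (z₀.arg = z₁.arg →
            p = -1 ∧ IsPosReal (z₀ * eRot k (-(2 * m))) ∧ IsPosReal (z₁ * eRot k (-(2 * m)))) ∧
          (z₀ ≠ z₁ → ‖z₀‖ = ‖z₁‖ →
            ∀ s : ℤ, (α * eRot k (p * s)).im = 0 →
              (z₀ ∈ sectorQ k (2 * m) ∧ z₁ ∈ sectorQ k (-(2 * s) - 2 * m - 1)) ∨
              (z₁ ∈ sectorQ k (2 * m) ∧ z₀ ∈ sectorQ k (-(2 * s) - 2 * m - 1)))) := by
  have hk0 : k ≠ 0 := by omega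
  have hkpos : (0 : ℝ) < k := by positivity
  have hω0 : 0 < Real.pi / k := div_pos Real.pi_pos hkpos
  have hFP := merF_eq_rootF hk hp hA ha hasum hb hbsum hF
  set P := merData hk hp hA ha hasum hb hbsum hF with hP
  have hc : P.c = p / k := rfl
  rw [hFP] at hne ⊢
  have hL : 0 < ‖α‖ := norm_pos_iff.2 hα
  set L := ‖α‖ with hLdef
  set N : ℤ := 2 * q - κ with hN
  have hrep := eq_norm_mul_exp_of_arg_eRot hk0 (z := α) (s := N)
  have hNκ : N ≡ κ [ZMOD 2] := by
    simp only [Int.ModEq]; omega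
  have hpN : p ≡ κ [ZMOD 2] ↔ p ≡ N [ZMOD 2] :=
    ⟨fun h => h.trans hNκ.symm, fun h => h.trans hNκ⟩
  have hzero : IsPosReal (α * eRot k (-(2 * q) + κ)) →
      α = L * exp (((N + 0) * (Real.pi / k) : ℝ) * I) := by
    intro h
    have e : (-(2 * q) + κ : ℤ) = -N := by rw [hN]; ring
    rw [e] at h
    rw [arg_eq_zero_of_isPosReal h, zero_div] at hrep
    exact hrep
  refine ⟨fun hQ => ?_, fun hpos hpar => ?_, fun hpos hpar => ?_⟩
  · obtain ⟨-, h1, h2⟩ := hQ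
    set x := arg (α * eRot k (-N)) / (Real.pi / k) with hx
    have hx0 : 0 < x := div_pos h1 hω0
    have hx1 : x < 1 := (div_lt_one hω0).2 h2
    rw [hrep] at hne
    obtain ⟨z₀, hcl, hs1, hs2⟩ := P.closest_of_mem_sector hk hp hpk hc hL hx0 hx1 hne
    rw [← hrep] at hcl
    refine ⟨z₀, hcl, fun σ hσ m hm => ?_⟩
    obtain ⟨l, hl⟩ := hm.dvd
    -- Once the ceiling is evaluated by parity, twice the congruence modulo k is the rotation
    -- equation with M = p when σ = 0 and M = -(p + 1) when σ = 1.
    rcases Int.even_or_odd' p with ⟨r, hr | hr⟩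
    · have hev : Even p := ⟨r, by omega⟩
      rw [if_pos hev] at hσ
      rw [hr, ceil_half_of_even] at hl
      rcases hκ with rfl | rfl
      · subst hσ
        have := hs1 (by simp only [Int.ModEq]; omega) m (-l) (by
          rw [pow_zero, one_mul] at hl
          rw [hN, hr]; push_cast; linear_combination -2 * hl)
        simpa using this
      · subst hσ
        have := hs2 (by simp only [Int.ModEq]; omega) m (-l) (by
          rw [pow_one] at hl
          rw [hN, hr]; push_cast; linear_combination -2 * hl)
        simpa using this
    · have hev : ¬ Even p := by rw [Int.not_even_iff_odd]; exact ⟨r, hr⟩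
      rw [if_neg hev] at hσ
      rw [hr, ceil_half_of_odd] at hl
      rcases hκ with rfl | rfl
      · subst hσ
        have := hs2 (by simp only [Int.ModEq]; omega) m (-l) (by
          rw [Nat.sub_zero, pow_one] at hl
          rw [hN, hr]; push_cast; linear_combination -2 * hl)
        simpa using this
      · subst hσ
        have := hs1 (by simp only [Int.ModEq]; omega) m (-l) (by
          rw [Nat.sub_self, pow_zero, one_mul] at hl
          rw [hN, hr]; push_cast; linear_combination -2 * hl)
        simpa using this
  · have hα' := hzero hpos
    rw [hα'] at hne
    obtain ⟨z₀, hcl, hs⟩ := P.closest_of_ray hk hp hpk hc hL (hpN.1 hpar) hne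
    rw [← hα'] at hcl
    refine ⟨z₀, hcl, fun m hm => ?_⟩
    obtain ⟨l, hl⟩ := hm.dvd
    refine hs m (-l) ?_
    rcases hκ with rfl | rfl
    · obtain ⟨r, hr⟩ : ∃ r, p = 2 * r := ⟨p / 2, by simp only [Int.ModEq] at hpar; omega⟩
      have e : ((p : ℝ) - 1) / 2 = ((2 * (r - 1) + 1 : ℤ) : ℝ) / 2 := by rw [hr]; push_cast; ring
      rw [e, ceil_half_of_odd, hr] at hl
      rw [hN, hr]; push_cast; linear_combination -2 * hl
    · obtain ⟨r, hr⟩ : ∃ r, p = 2 * r + 1 := ⟨p / 2, by simp only [Int.ModEq] at hpar; omega⟩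
      have e : ((p : ℝ) - 1) / 2 = ((2 * r : ℤ) : ℝ) / 2 := by rw [hr]; push_cast; ring
      rw [e, ceil_half_of_even, hr] at hl
      rw [hN, hr]; push_cast; linear_combination -2 * hl
  · have hα' := hzero hpos
    rw [hα'] at hne
    obtain ⟨z₀, z₁, hcl, hor, hs⟩ := P.closestPair hk hp hpk hc hL (fun h => hpar (hpN.2 h)) hne
    rw [← hα'] at hcl
    refine ⟨z₀, z₁, hcl, hor, fun m hm => ?_⟩
    obtain ⟨l, hl⟩ := hm.dvd
    obtain ⟨h1, h2⟩ := hs m (-l) (by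
      rcases hκ with rfl | rfl
      · obtain ⟨r, hr⟩ : ∃ r, p = 2 * r + 1 := ⟨p / 2, by simp only [Int.ModEq] at hpar; omega⟩
        have e : ((p : ℝ) + 1) / 2 = ((2 * (r + 1) : ℤ) : ℝ) / 2 := by rw [hr]; push_cast; ring
        rw [e, ceil_half_of_even, hr] at hl
        rw [hN, hr]; push_cast; linear_combination -2 * hl
      · obtain ⟨r, hr⟩ : ∃ r, p = 2 * r := ⟨p / 2, by simp only [Int.ModEq] at hpar; omega⟩
        have e : ((p : ℝ) + 1) / 2 = ((2 * r + 1 : ℤ) : ℝ) / 2 := by rw [hr]; push_cast; ring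
        rw [e, ceil_half_of_odd, hr] at hl
        rw [hN, hr]; push_cast; linear_combination -2 * hl)
    -- The pair comes ordered with the unreflected point first, so the first alternative always
    -- applies.
    refine ⟨h1, fun hz hn s him => Or.inl ?_⟩
    rw [hα'] at him
    obtain ⟨l', hl'⟩ := exists_int_of_im_eq_zero hk0 hL him
    exact h2 hz hn s l' hl'

end
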